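/- Let $(\hat M,\hat g,\hat\nabla,\hat\nabla^*)$ be a statistical manifold of dimension $4m$: $\hat g$ is a Riemannian metric and $\hat\nabla,\hat\nabla^*$ are torsion-free affine connections with $X\hat g(Y,Z)=\hat g(\hat\nabla_XY,Z)+\hat g(Y,\hat\nabla^*_XZ)$; then $\hat\nabla^\circ=\frac12(\hat\nabla+\hat\nabla^*)$ is the Levi-Civita connection. Let $\Lambda\subset\mathrm{End}(T\hat M)$ be a subbundle that is locally spanned by canonical bases $\{J_1,J_2,J_3\}$, that is, $J_\alpha^2=-I$ and $J_\alpha J_{\alpha+1}=-J_{\alpha+1}J_\alpha=J_{\alpha+2}$ (indices mod $3$). Assume that $\hat M$ is quaternion Kaehler-like: for every canonical local basis there are local $1$-forms $\omega_1,\omega_2,\omega_3$ with $$(\hat\nabla_XJ_\alpha)Y=\omega_{\alpha+2}(X)J_{\alpha+1}Y-\omega_{\alpha+1}(X)J_{\alpha+2}Y ,$$ and that, for a real constant $c$, the curvature tensor of $\hat\nabla$ is $$\hat R(X,Y)Z=\tfrac c4\Big\{\hat g(Y,Z)X-\hat g(X,Z)Y+\sum_{\alpha=1}^3\big[\hat g(Z,J_\alpha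 Y)J_\alpha X-\hat g(Z,J_\alpha X)J_\alpha Y\big]+\sum_{\alpha=1}^3\big[\hat g(X,J_\alpha Y)J_\alpha Z-\hat g(J_\alpha X,Y)J_\alpha Z\big]\Big\}.$$ Let $M$ be an immersed submanifold of dimension $n$ of $\hat M$ with the induced metric $g$ and the induced dual connections $\nabla,\nabla^*$, the tangent parts of $\hat\nabla,\hat\nabla^*$; let $\sigma,\sigma^*$ be the second fundamental forms, the normal parts, and $H=\frac1n\sum_i\sigma(e_i,e_i)$, $H^*=\frac1n\sum_i\sigma^*(e_i,e_i)$ the mean curvature vectors, for an orthonormal basis $(e_i)$ of $T_pM$. Suppose that $M$ is Lagrangian: $n=m$ and $J_\alpha(T_pM)\perp T_pM$ for all $p\in M$, $\alpha\in\{1,2,3\}$ and all canonical local bases. For a plane $\pi\subset T_pM$ with orthonormal basis $\{X,Y\}$ let $$K(\pi)=\tfrac12\big[g(R(X,Y)Y,X)+g(R^*(X,Y)Y,X)-2g(R^\circ(X,Y)Y,X)\big],\qquad K_\circ(\pi)=g(R^\circ(X,Y)Y,X),$$ where $R,R^*,R^\circ$ are the curvature tensors of $\nabla$, $\nabla^*$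 and $\nabla^\circ=\frac12(\nabla+\nabla^*)$, and let $\hat K_\circ(\pi)$ be the sectional curvature of $\pi$ with respect to $\hat\nabla^\circ$. Let $\tau,\tau_\circ,\hat\tau_\circ$ be the sums of $K$, $K_\circ$, $\hat K_\circ$ over the planes spanned by $e_i,e_j$, $1\le i<j\le n$, for an orthonormal basis $(e_i)$ of $T_pM$. If $n\ge4$ and $M$ satisfies the equality case of the first Chen inequality, i.e. for every $p\in M$ there is a plane $\pi\subset T_pM$ with $$(\tau-\tau_\circ)-(K(\pi)-K_\circ(\pi))=\frac c8(n-2)(n+1)-\frac{n^2(n-2)}{4(n-1)}\big[\|H\|^2+\|H^*\|^2\big]+2\hat K_\circ(\pi)-2\hat\tau_\circ ,$$ then $M$ is minimal, i.e. $H=H^*=0$ on $M$. -/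

import Mathlib

open scoped Manifold ContDiff Topology
open Bundle

noncomputable section

/-! ### Connections, curvature -/

/-- Vector fields (not necessarily regular) on a `k`-dimensional manifold. -/
abbrev VField (k : ℕ) (N : Type*) [TopologicalSpace N] [ChartedSpace (EuclideanSpace ℝ (Fin k)) N] :=
  Π x : N, TangentSpace (𝓡 k) x

/-- The type of operators `D` with `D Y x v = (∇_v Y)(x)`. -/
abbrev ConnOp (k : ℕ) (N : Type*) [TopologicalSpace N]
    [ChartedSpace (EuclideanSpace ℝ (Fin k)) N] :=
  VField k N → Π x : N, TangentSpace (𝓡 k) x → TangentSpace (𝓡 k) x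

/-- The vector field `Y` is differentiable at `x`. -/
def VField.DiffAt {k : ℕ} {N : Type*} [TopologicalSpace N]
    [ChartedSpace (EuclideanSpace ℝ (Fin k)) N] [IsManifold (𝓡 k) ∞ N] (Y : VField k N) (x : N) : Prop :=
  MDifferentiableAt (𝓡 k) ((𝓡 k).prod 𝓘(ℝ, EuclideanSpace ℝ (Fin k)))
    (fun y ↦ TotalSpace.mk' (EuclideanSpace ℝ (Fin k)) (E := fun z : N ↦ TangentSpace (𝓡 k) z) y
      (Y y)) x

section Connections

variable {k : ℕ} {N : Type*} [TopologicalSpace N] [ChartedSpace (EuclideanSpace ℝ (Fin k)) N]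

/-- `½ (∇ + ∇')`. -/
def ConnOp.mean (D D' : ConnOp k N) : ConnOp k N :=
  fun Y x v ↦ (1 / 2 : ℝ) • (D Y x v + D' Y x v)

/-- The curvature tensor `R(u, v) w = ∇_X ∇_Y Z - ∇_Y ∇_X Z - ∇_{[X, Y]} Z` at `x`, where `X`, `Y`,
`Z` are the vector fields extending `u`, `v`, `w` that are constant in the preferred chart
at `x`. -/
def ConnOp.curvature [IsManifold (𝓡 k) ∞ N] (D : ConnOp k N) (x : N)
    (u v w : TangentSpace (𝓡 k) x) : TangentSpace (𝓡 k) x :=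
  let X : VField k N := FiberBundle.extend (EuclideanSpace ℝ (Fin k)) u
  let Y : VField k N := FiberBundle.extend (EuclideanSpace ℝ (Fin k)) v
  let Z : VField k N := FiberBundle.extend (EuclideanSpace ℝ (Fin k)) w
  D (fun y ↦ D Z y (Y y)) x (X x) - D (fun y ↦ D Z y (X y)) x (Y x)
    - D Z x (VectorField.mlieBracket (𝓡 k) X Y x)

/-- `g(R(u, v) v, u)`, for the curvature `R` of `D`. -/
def ConnOp.sec [IsManifold (𝓡 k) ∞ N] (D : ConnOp k N)
    (g : Π x : N, TangentSpace (𝓡 k) x → TangentSpace (𝓡 k) x → ℝ) (x : N)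
    (u v : TangentSpace (𝓡 k) x) : ℝ :=
  g x (D.curvature x u v v) u

/-- The sectional `K`-curvature
`½ [g(R(u, v) v, u) + g(R*(u, v) v, u) - 2 g(R°(u, v) v, u)]` of a pair of dual connections on the
plane with orthonormal basis `u`, `v`; here `R°` is the curvature of `∇° = ½ (∇ + ∇*)`. -/
def secK [IsManifold (𝓡 k) ∞ N] (D D' : ConnOp k N)
    (g : Π x : N, TangentSpace (𝓡 k) x → TangentSpace (𝓡 k) x → ℝ) (x : N)
    (u v : TangentSpace (𝓡 k) x) : ℝ :=
  (1 / 2) * (D.sec g x u v + D'.sec g x u v - 2 * (D.mean D').sec g x u v)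

end Connections

/-! ### Statistical manifolds -/

/-- A statistical structure on a smooth `k`-manifold: a smooth Riemannian metric together with a
pair of smooth torsion-free affine connections that are dual with respect to it,
`v (g(Y, Z)) = g(∇_v Y, Z) + g(Y, ∇*_v Z)`. (Then `∇g` is totally symmetric.) -/
structure StatisticalStructure (k : ℕ) (N : Type*) [TopologicalSpace N]
    [ChartedSpace (EuclideanSpace ℝ (Fin k)) N] [IsManifold (𝓡 k) ∞ N] where
  metric : ContMDiffRiemannianMetric (𝓡 k) ∞ (EuclideanSpace ℝ (Fin k))
    (fun x : N ↦ TangentSpace (𝓡 k) x)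
  conn : CovariantDerivative (𝓡 k) (EuclideanSpace ℝ (Fin k)) (fun x : N ↦ TangentSpace (𝓡 k) x)
  dual : CovariantDerivative (𝓡 k) (EuclideanSpace ℝ (Fin k)) (fun x : N ↦ TangentSpace (𝓡 k) x)
  conn_smooth :  CovariantDerivative.ContMDiffCovariantDerivative conn ∞
  dual_smooth :  CovariantDerivative.ContMDiffCovariantDerivative dual ∞
  conn_torsion : conn.torsion = 0
  dual_torsion : dual.torsion = 0
  duality : ∀ (x : N) (Y Z : VField k N), Y.DiffAt x → Z.DiffAt x →
    ∀ v : TangentSpace (𝓡 k) x,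
      mvfderiv (𝓡 k) (fun y ↦ metric.inner y (Y y) (Z y)) x v
        = metric.inner x (conn Y x v) (Z x) + metric.inner x (Y x) (dual Z x v)

namespace StatisticalStructure

variable {k : ℕ} {N : Type*} [TopologicalSpace N] [ChartedSpace (EuclideanSpace ℝ (Fin k)) N]
  [IsManifold (𝓡 k) ∞ N] (S : StatisticalStructure k N)

/-- The metric. -/
def g (x : N) (u v : TangentSpace (𝓡 k) x) : ℝ := S.metric.inner x u v

/-- The connection `∇`. -/
def nabla : ConnOp k N := fun Y x v ↦ S.conn Y x v

/-- The dual connection `∇*`. -/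
def nablaStar : ConnOp k N := fun Y x v ↦ S.dual Y x v

/-- The Levi-Civita connection `∇° = ½ (∇ + ∇*)`; it is metric and torsion-free, see
`leviCivita_metric` and `leviCivita_torsion_free`. -/
def leviCivita : ConnOp k N := S.nabla.mean S.nablaStar

theorem leviCivita_metric (x : N) (Y Z : VField k N) (hY : Y.DiffAt x) (hZ : Z.DiffAt x)
    (v : TangentSpace (𝓡 k) x) :
    mvfderiv (𝓡 k) (fun y ↦ S.g y (Y y) (Z y)) x v
      = S.g x (S.leviCivita Y x v) (Z x) + S.g x (Y x) (S.leviCivita Z x v) := by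
  have h1 := S.duality x Y Z hY hZ v
  have h2 := S.duality x Z Y hZ hY v
  have h3 : (fun y ↦ S.metric.inner y (Z y) (Y y)) = fun y ↦ S.metric.inner y (Y y) (Z y) :=
    funext fun y ↦ S.metric.symm y _ _
  rw [h3, S.metric.symm x _ (Y x), S.metric.symm x (Z x)] at h2
  simp only [g, leviCivita, ConnOp.mean, nabla, nablaStar, map_smul, map_add,
    smul_apply, add_apply, smul_eq_mul]
  linarith

theorem leviCivita_torsion_free (x : N) (X Y : VField k N) (hX : X.DiffAt x) (hY : Y.DiffAt x) :
    S.leviCivita Y x (X x) - S.leviCivita X x (Y x) = VectorField.mlieBracket (𝓡 k) X Y x := by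
  have h1 := S.conn.torsion_eq_zero_iff.1 S.conn_torsion (x := x) hX hY
  have h2 := S.dual.torsion_eq_zero_iff.1 S.dual_torsion (x := x) hX hY
  simp only [leviCivita, ConnOp.mean, nabla, nablaStar]
  rw [← smul_sub, add_sub_add_comm, h1, h2, ← two_smul ℝ, smul_smul]
  norm_num

end StatisticalStructure

/-! ### Quaternionic structures -/

/-- `J 0, J 1, J 2` satisfy `J_α² = -1` and `J_α J_{α+1} = -J_{α+1} J_α = J_{α+2}`, indices
modulo `3`. -/
def IsQuaternionTriple {V : Type*} [AddCommGroup V] [Module ℝ V] [TopologicalSpace V]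
    (J : Fin 3 → V →L[ℝ] V) : Prop :=
  ∀ α : Fin 3, ∀ v : V, J α (J α v) = -v ∧ J α (J (α + 1) v) = J (α + 2) v ∧
    J (α + 1) (J α v) = -J (α + 2) v

section Quaternionic

variable {k : ℕ} {N : Type*} [TopologicalSpace N] [ChartedSpace (EuclideanSpace ℝ (Fin k)) N]
  [IsManifold (𝓡 k) ∞ N]

/-- `J` is a canonical local basis, over the open set `U`, of the family `Λ` of spaces of
endomorphisms of the tangent spaces: smooth on `U`, and at each point of `U` a quaternion triple
that spans `Λ`. -/
structure IsCanonicalBasisOn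
    (Λ : Π x : N, Submodule ℝ (TangentSpace (𝓡 k) x →L[ℝ] TangentSpace (𝓡 k) x))
    (U : Set N) (J : Fin 3 → Π x : N, TangentSpace (𝓡 k) x →L[ℝ] TangentSpace (𝓡 k) x) :
    Prop where
  isOpen : IsOpen U
  smooth : ∀ α, ContMDiffOn (𝓡 k)
    ((𝓡 k).prod 𝓘(ℝ, EuclideanSpace ℝ (Fin k) →L[ℝ] EuclideanSpace ℝ (Fin k))) ∞
    (fun x ↦ TotalSpace.mk' (EuclideanSpace ℝ (Fin k) →L[ℝ] EuclideanSpace ℝ (Fin k))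
      (E := fun x : N ↦ TangentSpace (𝓡 k) x →L[ℝ] TangentSpace (𝓡 k) x) x (J α x)) U
  triple : ∀ x ∈ U, IsQuaternionTriple fun α ↦ J α x
  span : ∀ x ∈ U, Submodule.span ℝ (Set.range fun α ↦ J α x) = Λ x

variable (k N) in
/-- An almost quaternionic structure: a subbundle of `End(TN)` that has canonical local bases
around every point. -/
structure AlmostQuaternionicStructure where
  bundle : Π x : N, Submodule ℝ (TangentSpace (𝓡 k) x →L[ℝ] TangentSpace (𝓡 k) x)
  exists_basis : ∀ x : N, ∃ U J, x ∈ U ∧ IsCanonicalBasisOn bundle U J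

/-- A statistical manifold with an almost quaternionic structure is quaternionic Kaehler-like if
for each canonical local basis `J` there are `1`-forms `θ_α` on its domain with
`(∇_v J_α) Y = θ_{α+2}(v) J_{α+1} Y - θ_{α+1}(v) J_{α+2} Y`.

No compatibility of `J_α` with the metric is needed: the endomorphisms `J_α*` with
`g(J_α X, Y) + g(X, J_α* Y) = 0` exist and are unique, being the negatives of the adjoints. -/
def IsQuaternionicKaehlerLike (S : StatisticalStructure k N)
    (Λ : AlmostQuaternionicStructure k N) : Prop :=
  ∀ U J, IsCanonicalBasisOn Λ.bundle U J →
    ∃ θ : Fin 3 → Π x : N, TangentSpace (𝓡 k) x →L[ℝ] ℝ,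
      ∀ α, ∀ x ∈ U, ∀ Y : VField k N, Y.DiffAt x → ∀ v : TangentSpace (𝓡 k) x,
        S.nabla (fun y ↦ J α y (Y y)) x v - J α x (S.nabla Y x v)
          = θ (α + 2) x v • J (α + 1) x (Y x) - θ (α + 1) x v • J (α + 2) x (Y x)

/-- The curvature tensor of `∇` is
`R(X, Y) Z = c/4 { g(Y, Z) X - g(X, Z) Y + ∑_α [g(Z, J_α Y) J_α X - g(Z, J_α X) J_α Y]
+ ∑_α [g(X, J_α Y) J_α Z - g(J_α X, Y) J_α Z] }`. -/
def HasQuaternionicCurvature (S : StatisticalStructure k N)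
    (Λ : AlmostQuaternionicStructure k N) (c : ℝ) : Prop :=
  ∀ U J, IsCanonicalBasisOn Λ.bundle U J → ∀ x ∈ U, ∀ X Y Z : TangentSpace (𝓡 k) x,
    S.nabla.curvature x X Y Z = (c / 4) •
      (S.g x Y Z • X - S.g x X Z • Y
        + ∑ α, (S.g x Z (J α x Y) • J α x X - S.g x Z (J α x X) • J α x Y)
        + ∑ α, (S.g x X (J α x Y) • J α x Z - S.g x (J α x X) Y • J α x Z))

end Quaternionic

/-! ### Submanifolds -/

section Submanifold

variable {k n : ℕ} {N : Type*} [TopologicalSpace N] [ChartedSpace (EuclideanSpace ℝ (Fin k)) N]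
  [IsManifold (𝓡 k) ∞ N]
  {M : Type*} [TopologicalSpace M] [ChartedSpace (EuclideanSpace ℝ (Fin n)) M]
  [IsManifold (𝓡 n) ∞ M]

variable (k n) in
/-- Smooth immersions. -/
def IsSmoothImmersion (f : M → N) : Prop :=
  ContMDiff (𝓡 n) (𝓡 k) ∞ f ∧ ∀ p : M, Function.Injective (mfderiv (𝓡 n) (𝓡 k) f p)

/-- The derivative `∇_v V` at `p`, for the connection `D` of the ambient manifold, of a vector
field `V` along the map `f`, in the direction `v ∈ T_p M`. In the frame `s_i` of `TN` near `f p`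
given by the preferred chart at `f p`, write `V = ∑ c_i (s_i ∘ f)`; then
`∇_v V = ∑ (d_p c_i)(v) s_i + ∑ c_i(p) ∇_{df(v)} s_i`. See `alongDeriv_comp`. -/
def alongDeriv (D : ConnOp k N) (f : M → N) (V : Π q : M, TangentSpace (𝓡 k) (f q)) (p : M)
    (v : TangentSpace (𝓡 n) p) : TangentSpace (𝓡 k) (f p) :=
  let e := trivializationAt (EuclideanSpace ℝ (Fin k)) (fun x : N ↦ TangentSpace (𝓡 k) x) (f p)
  let c : M → EuclideanSpace ℝ (Fin k) := fun q ↦ (e ⟨f q, V q⟩).2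
  e.symmL ℝ (f p) (mvfderiv (𝓡 n) c p v)
    + D (FiberBundle.extend (EuclideanSpace ℝ (Fin k)) (V p)) (f p) (mfderiv (𝓡 n) (𝓡 k) f p v)

set_option linter.unusedSectionVars false in
set_option maxHeartbeats 1000000 in
/-- For the restriction to `M` of a vector field `Y` of the ambient manifold, `alongDeriv` is the
ambient derivative of `Y` in the direction `df(v)`. -/
theorem alongDeriv_comp (D : CovariantDerivative (𝓡 k) (EuclideanSpace ℝ (Fin k))
    (fun x : N ↦ TangentSpace (𝓡 k) x)) (f : M → N) (p : M)
    (hf : MDifferentiableAt (𝓡 n) (𝓡 k) f p) (Y : VField k N) (hY : Y.DiffAt (f p))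
    (v : TangentSpace (𝓡 n) p) :
    alongDeriv (fun Z x w ↦ D Z x w) f (fun q ↦ Y (f q)) p v
      = D Y (f p) (mfderiv (𝓡 n) (𝓡 k) f p v) := by
  set E := EuclideanSpace ℝ (Fin k)
  let e := trivializationAt E (fun x : N ↦ TangentSpace (𝓡 k) x) (f p)
  have hmem : f p ∈ e.baseSet := FiberBundle.mem_baseSet_trivializationAt' (f p)
  have hev : ∀ᶠ y in 𝓝 (f p), y ∈ e.baseSet := e.open_baseSet.mem_nhds hmem
  let r : VField k N → N → E := fun Z y ↦ (e ⟨y, Z y⟩).2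
  have hr : ∀ Z : VField k N, Z.DiffAt (f p) →
      MDifferentiableAt (𝓡 k) 𝓘(ℝ, E) (r Z) (f p) := fun Z hZ ↦
    (mdifferentiableAt_section (𝓡 k) Z (b₀ := f p)).1 hZ
  set w := mfderiv (𝓡 n) (𝓡 k) f p v with hw
  let Φ : VField k N → TangentSpace (𝓡 k) (f p) := fun Z ↦
    D Z (f p) w - e.symmL ℝ (f p) (mvfderiv (𝓡 k) (r Z) (f p) w)
  have hΦ : TensorialAt (𝓡 k) E Φ (f p) := by
    constructor
    · intro h Z hh hZ
      have h1 : r (h • Z) =ᶠ[𝓝 (f p)] fun y ↦ h y • r Z y := by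
        filter_upwards [hev] with y hy
        exact (e.linear ℝ hy).map_smul (h y) (Z y)
      have h2 : mvfderiv (𝓡 k) (r (h • Z)) (f p) w
          = h (f p) • mvfderiv (𝓡 k) (r Z) (f p) w + mvfderiv (𝓡 k) h (f p) w • r Z (f p) := by
        have : mvfderiv (𝓡 k) (r (h • Z)) (f p) = mvfderiv (𝓡 k) (fun y ↦ h y • r Z y) (f p) := by
          simp only [mvfderiv, h1.mfderiv_eq]
          rw [h1.self_of_nhds]
        rw [this]
        change mvfderiv (𝓡 k) (h • r Z) (f p) w = _
        rw [mvfderiv_smul hh (hr Z hZ)]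
        simp
      have h3 : e.symmL ℝ (f p) (r Z (f p)) = Z (f p) :=
        (e.symmL_apply hmem _).trans (e.symm_apply_apply_mk hmem (Z (f p)))
      simp only [Φ]
      rw [D.isCovariantDerivativeOnUniv.leibniz hZ hh, h2, map_add, map_smul, map_smul, h3]
      simp only [add_apply, smul_apply, ContinuousLinearMap.smulRight_apply]
      module
    · intro Z Z' hZ hZ'
      have h1 : r (Z + Z') =ᶠ[𝓝 (f p)] fun y ↦ r Z y + r Z' y := by
        filter_upwards [hev] with y hy
        exact (e.linear ℝ hy).map_add (Z y) (Z' y)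
      have h2 : mvfderiv (𝓡 k) (r (Z + Z')) (f p) w
          = mvfderiv (𝓡 k) (r Z) (f p) w + mvfderiv (𝓡 k) (r Z') (f p) w := by
        have : mvfderiv (𝓡 k) (r (Z + Z')) (f p)
            = mvfderiv (𝓡 k) (fun y ↦ r Z y + r Z' y) (f p) := by
          simp only [mvfderiv, h1.mfderiv_eq]
          rw [h1.self_of_nhds]
        rw [this]
        change mvfderiv (𝓡 k) (r Z + r Z') (f p) w = _
        rw [mvfderiv_add (hr Z hZ) (hr Z' hZ')]
        simp
      simp only [Φ]
      rw [D.isCovariantDerivativeOnUniv.add hZ hZ', h2, map_add]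
      simp only [add_apply]
      module
  have h0 := hΦ.pointwise (σ := Y) (σ' := FiberBundle.extend E (Y (f p))) hY
    (FiberBundle.mdifferentiableAt_extend ..) (by simp)
  have h1 : mvfderiv (𝓡 k) (r (FiberBundle.extend E (Y (f p)))) (f p) w = 0 := by
    have h : r (FiberBundle.extend E (Y (f p))) =ᶠ[𝓝 (f p)] fun _ ↦ (e ⟨f p, Y (f p)⟩).2 := by
      filter_upwards [hev] with y hy
      have h' := congrArg Prod.snd (e.apply_mk_symm hy (e ⟨f p, Y (f p)⟩).2)
      exact h'
    have : mvfderiv (𝓡 k) (r (FiberBundle.extend E (Y (f p)))) (f p)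
        = mvfderiv (𝓡 k) (fun _ : N ↦ (e ⟨f p, Y (f p)⟩).2) (f p) := by
      simp only [mvfderiv, h.mfderiv_eq]
      rw [h.self_of_nhds]
    rw [this, mvfderiv_const]
    rfl
  have h2 : mvfderiv (𝓡 n) (fun q ↦ (e ⟨f q, Y (f q)⟩).2) p v = mvfderiv (𝓡 k) (r Y) (f p) w :=
    mfderiv_comp_apply (f := f) (g := r Y) p (hr Y hY) hf v
  simp only [Φ, h1, map_zero, sub_zero] at h0
  simp only [alongDeriv]
  rw [← h0]
  change e.symmL ℝ (f p) (mvfderiv (𝓡 n) (fun q ↦ (e ⟨f q, Y (f q)⟩).2) p v) + _ = _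
  rw [h2]
  exact add_sub_cancel _ _

/-- The induced metric. -/
def inducedMetric (S : StatisticalStructure k N) (f : M → N) (p : M)
    (u v : TangentSpace (𝓡 n) p) : ℝ :=
  S.g (f p) (mfderiv (𝓡 n) (𝓡 k) f p u) (mfderiv (𝓡 n) (𝓡 k) f p v)

set_option linter.unusedSectionVars false in
/-- For an immersion `f` each `w` has a unique tangent part `u`: `w - df(u)` is normal to `M`. -/
theorem existsUnique_tangentPart (S : StatisticalStructure k N) (f : M → N) (p : M)
    (hf : Function.Injective (mfderiv (𝓡 n) (𝓡 k) f p)) (w : TangentSpace (𝓡 k) (f p)) :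
    ∃! u : TangentSpace (𝓡 n) p, ∀ z : TangentSpace (𝓡 n) p,
      S.g (f p) (w - mfderiv (𝓡 n) (𝓡 k) f p u) (mfderiv (𝓡 n) (𝓡 k) f p z) = 0 := by
  have : FiniteDimensional ℝ (TangentSpace (𝓡 n) p) :=
    inferInstanceAs (FiniteDimensional ℝ (EuclideanSpace ℝ (Fin n)))
  let A := mfderiv (𝓡 n) (𝓡 k) f p
  let L : TangentSpace (𝓡 n) p →ₗ[ℝ] Module.Dual ℝ (TangentSpace (𝓡 n) p) :=
    LinearMap.mk₂ ℝ (fun u z ↦ S.metric.inner (f p) (A u) (A z)) (by simp) (by simp) (by simp)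
      (by simp)
  have hL : Function.Injective L := by
    rw [injective_iff_map_eq_zero]
    intro u hu
    by_contra hne
    have h1 : A u ≠ 0 := fun h ↦ hne (hf (h.trans (map_zero A).symm))
    have h2 : L u u = 0 := by rw [hu]; rfl
    exact (S.metric.pos (f p) _ h1).ne' h2
  have hL' : Function.Bijective L :=
    ⟨hL, (LinearMap.injective_iff_surjective_of_finrank_eq_finrank
      Subspace.dual_finrank_eq.symm).1 hL⟩
  let φ : Module.Dual ℝ (TangentSpace (𝓡 n) p) :=
    (S.metric.inner (f p) w).toLinearMap ∘ₗ A.toLinearMap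
  have key : ∀ u, (∀ z : TangentSpace (𝓡 n) p, S.g (f p) (w - A u) (A z) = 0) ↔ L u = φ := by
    intro u
    rw [LinearMap.ext_iff]
    refine forall_congr' fun z ↦ ?_
    change S.metric.inner (f p) (w - A u) (A z) = 0 ↔
      S.metric.inner (f p) (A u) (A z) = S.metric.inner (f p) w (A z)
    rw [map_sub, sub_apply, sub_eq_zero, eq_comm]
  obtain ⟨u, hu, huniq⟩ := hL'.existsUnique φ
  exact ⟨u, (key u).2 hu, fun y hy ↦ huniq y ((key y).1 hy)⟩

open Classical in
/-- The tangent part of `w ∈ T_{f p} N`: the vector `u ∈ T_p M` such that `w - df(u)` is normal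
to `M`. -/
def tangentPart (S : StatisticalStructure k N) (f : M → N) (p : M)
    (w : TangentSpace (𝓡 k) (f p)) : TangentSpace (𝓡 n) p :=
  if h : ∃ u : TangentSpace (𝓡 n) p, ∀ z : TangentSpace (𝓡 n) p,
      S.g (f p) (w - mfderiv (𝓡 n) (𝓡 k) f p u) (mfderiv (𝓡 n) (𝓡 k) f p z) = 0
  then h.choose else 0

/-- The connection induced on `M` by the ambient connection `D`: the tangent part of the ambient
derivative. -/
def inducedConn (S : StatisticalStructure k N) (D : ConnOp k N) (f : M → N) : ConnOp n M :=
  fun Y p v ↦ tangentPart S f p (alongDeriv D f (fun q ↦ mfderiv (𝓡 n) (𝓡 k) f q (Y q)) p v)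

/-- The second fundamental form `σ(v, w)` for the ambient connection `D`: the normal part of the
ambient derivative, in direction `v`, of a vector field on `M` extending `w`. -/
def secondFundForm (S : StatisticalStructure k N) (D : ConnOp k N) (f : M → N) (p : M)
    (v w : TangentSpace (𝓡 n) p) : TangentSpace (𝓡 k) (f p) :=
  let Y : VField n M := FiberBundle.extend (EuclideanSpace ℝ (Fin n)) w
  alongDeriv D f (fun q ↦ mfderiv (𝓡 n) (𝓡 k) f q (Y q)) p v
    - mfderiv (𝓡 n) (𝓡 k) f p (inducedConn S D f Y p v)

/-- `e` is an orthonormal basis of `T_p M` for the induced metric. -/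
def IsOrthonormalFrame (S : StatisticalStructure k N) (f : M → N) (p : M)
    (e : Fin n → TangentSpace (𝓡 n) p) : Prop :=
  ∀ i j, inducedMetric S f p (e i) (e j) = if i = j then 1 else 0

/-- The mean curvature vector `(1/n) ∑ σ(e_i, e_i)`. -/
def meanCurvature (S : StatisticalStructure k N) (D : ConnOp k N) (f : M → N) (p : M)
    (e : Fin n → TangentSpace (𝓡 n) p) : TangentSpace (𝓡 k) (f p) :=
  (1 / n : ℝ) • ∑ i, secondFundForm S D f p (e i) (e i)

/-- The sum over `i < j` of the (sectional) curvatures `K(e_i, e_j)`. -/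
def scalarSum {V : Type*} (K : V → V → ℝ) (e : Fin n → V) : ℝ :=
  ∑ i, ∑ j, if i < j then K (e i) (e j) else 0

/-- Equality in the first Chen inequality at `p`, for the orthonormal basis `e` of `T_p M` and the
plane `π` spanned by `e i₁`, `e i₂`:
`(τ - τ₀) - (K(π) - K₀(π)) = (c/8) (n-2) (n+1) - n² (n-2) / (4 (n-1)) (‖H‖² + ‖H*‖²)
+ 2 K̂₀(π) - 2 τ̂₀`.
Here `K`, `τ` are the sectional `K`-curvature and the scalar curvature of the induced statistical
structure of `M`, `K₀`, `τ₀` are those of its Levi-Civita connection, and `K̂₀`, `τ̂₀` those of the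
Levi-Civita connection of the ambient manifold, restricted to `T_p M`. -/
def ChenEquality (S : StatisticalStructure k N) (c : ℝ) (f : M → N) (p : M)
    (e : Fin n → TangentSpace (𝓡 n) p) (i₁ i₂ : Fin n) : Prop :=
  let D := inducedConn S S.nabla f
  let D' := inducedConn S S.nablaStar f
  let K := secK D D' (inducedMetric S f) p
  let K₀ := (D.mean D').sec (inducedMetric S f) p
  let K₀' : TangentSpace (𝓡 n) p → TangentSpace (𝓡 n) p → ℝ := fun u v ↦
    S.leviCivita.sec S.g (f p) (mfderiv (𝓡 n) (𝓡 k) f p u) (mfderiv (𝓡 n) (𝓡 k) f p v)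
  let H := meanCurvature S S.nabla f p e
  let H' := meanCurvature S S.nablaStar f p e
  (scalarSum K e - scalarSum K₀ e) - (K (e i₁) (e i₂) - K₀ (e i₁) (e i₂))
    = c / 8 * (n - 2) * (n + 1)
      - (n : ℝ) ^ 2 * (n - 2) / (4 * (n - 1)) * (S.g (f p) H H + S.g (f p) H' H')
      + 2 * K₀' (e i₁) (e i₂) - 2 * scalarSum K₀' e

end Submanifold

/-- An immersed submanifold `f : M → N` of dimension `n` in a manifold of dimension `4 m` is
Lagrangian if `n = m` and it is totally real: `A (T M)` is normal to `M` for each section `A` of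
the quaternionic bundle (equivalently for each `A = J_α` of a canonical basis). -/
def IsLagrangian {m : ℕ} (n : ℕ) {N : Type*} [TopologicalSpace N]
    [ChartedSpace (EuclideanSpace ℝ (Fin (4 * m))) N] [IsManifold (𝓡 (4 * m)) ∞ N]
    {M : Type*} [TopologicalSpace M] [ChartedSpace (EuclideanSpace ℝ (Fin n)) M]
    (S : StatisticalStructure (4 * m) N) (Λ : AlmostQuaternionicStructure (4 * m) N)
    (f : M → N) : Prop :=
  n = m ∧ ∀ p : M, ∀ A ∈ Λ.bundle (f p), ∀ u v : TangentSpace (𝓡 n) p,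
    S.g (f p) (A (mfderiv (𝓡 n) (𝓡 (4 * m)) f p u)) (mfderiv (𝓡 n) (𝓡 (4 * m)) f p v) = 0

end

/-! The equality case of Chen's inequality fixes the algebraic shape of `σ` and `σ*` at each point;
the Lagrangian condition adds a total symmetry, and for `n ≥ 4` the two together leave no room for a
trace.

Gauss. The Gauss equation of a pair of dual connections (`gauss_equation`) involves mixed products
`g(σ, σ*)`. It is used for `∇`, for `∇*`, and for the Levi-Civita connection, whose second
fundamental form is `½(σ + σ*)`. In `K - K₀` the mixed products cancel, so that only `σσ` and `σ*σ*`
terms remain (`secK_sub_sec`). On a Lagrangian submanifold every `J`-term of the ambient curvature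
vanishes on `TM`, which leaves the constant `c/4`. Summed over planes, Chen's equality becomes a
purely algebraic identity between `σ`, `σ*` and their traces (`IsLagrangian.chen_equality`).

Chen. Let `(k, l)` be the distinguished plane and `(n-1)h = ∑ s_ii`. The defect of Chen's inequality
equals `|s_kk + s_ll - h|² + ∑ |s_ii - h|²`, with `i` outside `{k, l}`, plus the squares of the
off-diagonal entries other than `s_kl` and `s_lk` (`chen_defect`). Equality therefore forces `s_ii =
h` and `s_ij = 0` whenever `i` is outside `{k, l}` and `j ≠ i`, for `σ` and for `σ*`
(`chen_equality`).

Symmetry. Differentiating `g(J_α W, U) = 0` along `M` gives `g(J_α σ(v, w), u) = -g(J_α w, σ*(v,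
u))`, because `(∇J_α)W` is a combination of the normal vectors `J_β W`
(`IsLagrangian.g_secondFundForm`). Hence `C_ijr = g(J_α σ(e_i, e_j), e_r)` is totally symmetric, and
so is `g(σ*(e_i, e_j), J_α e_r)`. Given `r`, choose `i` outside `{k, l, r}`; then `∑_j C_jjr = (n-1)
C_iir = (n-1) C_iri = 0` (`trace_eq_zero_of_symm`).

Dimension. Since `dim N = 4 dim M`, the spaces `TM` and `J_α TM` span the ambient tangent space. A
normal trace without components in the sense above is therefore zero. The `J_α` are not assumed to
be isometries, so `σ` and `σ*` need two versions of this last step.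

The geometric identities are obtained by computing in the preferred charts at `p` and `f p`. -/

noncomputable section

/-! ### Linear algebra -/

/-! ### Chen's algebraic inequality, its equality case, and the trace argument. -/

section ChenAlgebra

variable {V : Type*} [AddCommGroup V] [Module ℝ V] {n : ℕ}

/-- The sum of `b(s_ii, s_jj) - b(s_ij, s_ij)` over `i < j`. -/
theorem sum_lt_gauss (b : V →ₗ[ℝ] V →ₗ[ℝ] ℝ) (hb : ∀ u v, b u v = b v u) (s : Fin n → Fin n → V)
    (hs : ∀ i j, s i j = s j i) :
    2 * (∑ i, ∑ j, if i < j then b (s i i) (s j j) - b (s i j) (s i j) else 0)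
      = b (∑ i, s i i) (∑ i, s i i) - ∑ i, ∑ j, b (s i j) (s i j) := by
  have h1 : b (∑ i, s i i) (∑ i, s i i) - ∑ i, ∑ j, b (s i j) (s i j)
      = ∑ i, ∑ j, (b (s i i) (s j j) - b (s i j) (s i j)) := by
    simp [map_sum, LinearMap.sum_apply, Finset.sum_sub_distrib]
    exact Finset.sum_comm
  -- The diagonal terms `i = j` vanish, and the terms `j < i` mirror the terms `i < j`.
  have h2 : ∑ i, ∑ j, (b (s i i) (s j j) - b (s i j) (s i j))
      = (∑ i, ∑ j, if i < j then b (s i i) (s j j) - b (s i j) (s i j) else 0)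
        + ∑ i, ∑ j, if j < i then b (s i i) (s j j) - b (s i j) (s i j) else 0 := by
    simp only [← Finset.sum_add_distrib]
    refine Finset.sum_congr rfl fun i _ ↦ Finset.sum_congr rfl fun j _ ↦ ?_
    rcases lt_trichotomy i j with h | h | h
    · simp [h, h.not_gt]
    · simp [h]
    · simp [h, h.not_gt]
  have h3 : (∑ i, ∑ j, if j < i then b (s i i) (s j j) - b (s i j) (s i j) else 0)
      = ∑ i, ∑ j, if i < j then b (s i i) (s j j) - b (s i j) (s i j) else 0 := by
    rw [Finset.sum_comm]
    refine Finset.sum_congr rfl fun i _ ↦ Finset.sum_congr rfl fun j _ ↦ ?_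
    rw [hb (s j j), hs j i]
  rw [h1, h2, h3]
  ring

theorem sum_eq_add_add_sum_erase {W : Type*} [AddCommMonoid W] {k l : Fin n} (hkl : k ≠ l)
    (f : Fin n → W) :
    ∑ i, f i = f k + (f l + ∑ i ∈ (Finset.univ.erase k).erase l, f i) := by
  have hl : l ∈ Finset.univ.erase k := by simp [hkl.symm]
  rw [← Finset.add_sum_erase _ f (Finset.mem_univ k), ← Finset.add_sum_erase _ f hl]

/-- The defect in Chen's algebraic inequality is a sum of squares. -/
theorem chen_defect (b : V →ₗ[ℝ] V →ₗ[ℝ] ℝ) (hb : ∀ u v, b u v = b v u) (s : Fin n → Fin n → V)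
    (hs : ∀ i j, s i j = s j i) (hn : 2 ≤ n) {k l : Fin n} (hkl : k ≠ l) (h : V)
    (hh : ((n : ℝ) - 1) • h = ∑ i, s i i) :
    ((n : ℝ) - 2) / (n - 1) * b (∑ i, s i i) (∑ i, s i i)
      - 2 * ((∑ i, ∑ j, if i < j then b (s i i) (s j j) - b (s i j) (s i j) else 0)
        - (b (s k k) (s l l) - b (s k l) (s k l)))
      = b (s k k + s l l - h) (s k k + s l l - h)
        + (∑ i ∈ (Finset.univ.erase k).erase l, b (s i i - h) (s i i - h))
        + ∑ i, ∑ j, if i = j ∨ (i = k ∧ j = l) ∨ (i = l ∧ j = k) then 0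
            else b (s i j) (s i j) := by
  have hn' : (n : ℝ) - 1 ≠ 0 := by
    have : (2 : ℝ) ≤ n := by exact_mod_cast hn
    linarith
  have hl : l ∈ Finset.univ.erase k := by simp [hkl.symm]
  have hcard : ((((Finset.univ : Finset (Fin n)).erase k).erase l).card : ℝ) = n - 2 := by
    rw [Finset.card_erase_of_mem hl, Finset.card_erase_of_mem (Finset.mem_univ k),
      Finset.card_univ, Fintype.card_fin, Nat.sub_sub, Nat.cast_sub hn]
    norm_num
  -- The pair `(k, l)` occurs twice, as `(k, l)` and `(l, k)`. This contribution cancels against the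
  -- excluded plane, so `s k l` stays free in the equality case.
  have hoff : ∑ i, ∑ j, b (s i j) (s i j)
      = (∑ i, ∑ j, if i = j ∨ (i = k ∧ j = l) ∨ (i = l ∧ j = k) then 0 else b (s i j) (s i j))
        + ∑ i, b (s i i) (s i i) + 2 * b (s k l) (s k l) := by
    have : ∀ i j, b (s i j) (s i j)
        = (if i = j ∨ (i = k ∧ j = l) ∨ (i = l ∧ j = k) then 0 else b (s i j) (s i j))
          + ((if i = j then b (s i j) (s i j) else 0)
          + ((if i = k then if j = l then b (s k l) (s k l) else 0 else 0)
          + (if i = l then if j = k then b (s k l) (s k l) else 0 else 0))) := by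
      intro i j
      by_cases h1 : i = j
      · subst h1
        by_cases h2 : i = k
        · subst h2; simp [hkl]
        · simp [h2]
      · by_cases h2 : i = k
        · subst h2
          by_cases h3 : j = l
          · subst h3; simp [h1]
          · simp [h1, h3, hkl]
        · by_cases h3 : i = l
          · subst h3
            by_cases h4 : j = k
            · subst h4; simp [h1, hs i j]
            · simp [h1, h2, h4]
          · simp [h1, h2, h3]
    rw [Finset.sum_congr rfl fun i _ ↦ Finset.sum_congr rfl fun j _ ↦ this i j]
    simp only [Finset.sum_add_distrib]
    simp
    ring
  have hg := sum_lt_gauss b hb s hs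
  have hbh : b (∑ i, s i i) (∑ i, s i i) = ((n : ℝ) - 1) ^ 2 * b h h := by
    rw [← hh]; simp; ring
  have hsum : ∑ i ∈ (Finset.univ.erase k).erase l, s i i = ((n : ℝ) - 1) • h - s k k - s l l := by
    rw [hh, sum_eq_add_add_sum_erase hkl fun i ↦ s i i]; abel
  -- `h` is the mean of the `n - 1` vectors `s k k + s l l` and `s i i`, with `i` outside `{k, l}`.
  -- The squared deviations from it produce the coefficient `(n - 2) / (n - 1) = 1 - 1 / (n - 1)`.
  have hsq : ∑ i ∈ (Finset.univ.erase k).erase l, b (s i i - h) (s i i - h)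
      = (∑ i ∈ (Finset.univ.erase k).erase l, b (s i i) (s i i))
        - 2 * b h (((n : ℝ) - 1) • h - s k k - s l l) + (n - 2) * b h h := by
    rw [← hsum, map_sum, Finset.mul_sum, ← hcard, ← nsmul_eq_mul, ← Finset.sum_const,
      ← Finset.sum_sub_distrib, ← Finset.sum_add_distrib]
    refine Finset.sum_congr rfl fun i _ ↦ ?_
    simp only [map_sub, LinearMap.sub_apply]
    rw [hb (s i i) h]; ring
  have hdiag := sum_eq_add_add_sum_erase hkl fun i ↦ b (s i i) (s i i)
  rw [hsq, mul_sub, hg, hoff, hdiag, hbh]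
  simp only [map_sub, map_add, map_smul, LinearMap.sub_apply, LinearMap.add_apply, smul_eq_mul]
  rw [hb (s l l) (s k k), hb (s k k) h, hb (s l l) h]
  field_simp
  ring

/-- The equality case of Chen's algebraic inequality for a pair of symmetric arrays. -/
theorem chen_equality (b : V →ₗ[ℝ] V →ₗ[ℝ] ℝ) (hb : ∀ u v, b u v = b v u)
    (hpos : ∀ v, v ≠ 0 → 0 < b v v) (s t : Fin n → Fin n → V)
    (hs : ∀ i j, s i j = s j i) (ht : ∀ i j, t i j = t j i) (hn : 2 ≤ n) {k l : Fin n} (hkl : k ≠ l)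
    (heq : (∑ i, ∑ j, if i < j then b (s i i) (s j j) - b (s i j) (s i j) else 0)
        - (b (s k k) (s l l) - b (s k l) (s k l))
        + ((∑ i, ∑ j, if i < j then b (t i i) (t j j) - b (t i j) (t i j) else 0)
        - (b (t k k) (t l l) - b (t k l) (t k l)))
      = ((n : ℝ) - 2) / (2 * (n - 1)) *
        (b (∑ i, s i i) (∑ i, s i i) + b (∑ i, t i i) (∑ i, t i i))) :
    (∀ i, i ≠ k → i ≠ l → ((n : ℝ) - 1) • s i i = ∑ j, s j j) ∧
    (∀ i j, i ≠ j → i ≠ k → i ≠ l → s i j = 0) ∧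
    (∀ i, i ≠ k → i ≠ l → ((n : ℝ) - 1) • t i i = ∑ j, t j j) ∧
    (∀ i j, i ≠ j → i ≠ k → i ≠ l → t i j = 0) := by
  have hn' : (n : ℝ) - 1 ≠ 0 := by
    have : (2 : ℝ) ≤ n := by exact_mod_cast hn
    linarith
  have hnn : ∀ v, 0 ≤ b v v := fun v ↦ by
    by_cases hv : v = 0
    · simp [hv]
    · exact (hpos v hv).le
  have hz : ∀ v, b v v ≤ 0 → v = 0 := fun v hv ↦ by
    by_contra h
    exact (hpos v h).not_ge hv
  have hh : ∀ x : V, ((n : ℝ) - 1) • (((n : ℝ) - 1)⁻¹ • x) = x := fun x ↦ by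
    rw [smul_smul, mul_inv_cancel₀ hn', one_smul]
  have key : ∀ r : Fin n → Fin n → V, ∀ h : V, ((n : ℝ) - 1) • h = ∑ i, r i i →
      b (r k k + r l l - h) (r k k + r l l - h)
        + (∑ i ∈ (Finset.univ.erase k).erase l, b (r i i - h) (r i i - h))
        + (∑ i, ∑ j, if i = j ∨ (i = k ∧ j = l) ∨ (i = l ∧ j = k) then 0
            else b (r i j) (r i j)) ≤ 0 →
      (∀ i, i ≠ k → i ≠ l → ((n : ℝ) - 1) • r i i = ∑ j, r j j) ∧
      (∀ i j, i ≠ j → i ≠ k → i ≠ l → r i j = 0) := by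
    intro r h hrh hle
    have h0 := hnn (r k k + r l l - h)
    have h1 : ∀ i ∈ (Finset.univ.erase k).erase l, 0 ≤ b (r i i - h) (r i i - h) :=
      fun i _ ↦ hnn _
    have h2 : ∀ i j, 0 ≤ if i = j ∨ (i = k ∧ j = l) ∨ (i = l ∧ j = k) then 0
        else b (r i j) (r i j) := fun i j ↦ by
      split_ifs
      exacts [le_rfl, hnn _]
    have h1' := Finset.sum_nonneg h1
    have h2' : 0 ≤ ∑ i, ∑ j, if i = j ∨ (i = k ∧ j = l) ∨ (i = l ∧ j = k) then 0
        else b (r i j) (r i j) := Finset.sum_nonneg fun i _ ↦ Finset.sum_nonneg fun j _ ↦ h2 i j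
    constructor
    · intro i hik hil
      have h3 := Finset.single_le_sum h1 (a := i) (by simp [hik, hil])
      have h4 := hz _ (by linarith : b (r i i - h) (r i i - h) ≤ 0)
      rw [sub_eq_zero.1 h4, hrh]
    · intro i j hij hik hil
      have h3 := Finset.single_le_sum (f := fun i ↦ ∑ j, if i = j ∨ (i = k ∧ j = l) ∨
        (i = l ∧ j = k) then 0 else b (r i j) (r i j))
        (fun i _ ↦ Finset.sum_nonneg fun j _ ↦ h2 i j) (Finset.mem_univ i)
      have h4 := Finset.single_le_sum (f := fun j ↦ if i = j ∨ (i = k ∧ j = l) ∨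
        (i = l ∧ j = k) then 0 else b (r i j) (r i j))
        (fun j _ ↦ h2 i j) (Finset.mem_univ j)
      rw [if_neg (show ¬(i = j ∨ (i = k ∧ j = l) ∨ (i = l ∧ j = k)) by tauto)] at h4
      exact hz _ (by linarith)
  have d1 := chen_defect b hb s hs hn hkl _ (hh (∑ i, s i i))
  have d2 := chen_defect b hb t ht hn hkl _ (hh (∑ i, t i i))
  have hnn2 : ∀ (r : Fin n → Fin n → V) (h : V), 0 ≤ b (r k k + r l l - h) (r k k + r l l - h)
        + (∑ i ∈ (Finset.univ.erase k).erase l, b (r i i - h) (r i i - h))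
        + (∑ i, ∑ j, if i = j ∨ (i = k ∧ j = l) ∨ (i = l ∧ j = k) then 0
            else b (r i j) (r i j)) := by
    intro r h
    refine add_nonneg (add_nonneg (hnn _) (Finset.sum_nonneg fun _ _ ↦ hnn _))
      (Finset.sum_nonneg fun i _ ↦ Finset.sum_nonneg fun j _ ↦ ?_)
    split_ifs
    exacts [le_rfl, hnn _]
  -- `heq` says that the defects of `s` and `t` add up to zero; both are sums of squares, so each of
  -- them is zero.
  have hc : ((n : ℝ) - 2) / (2 * (n - 1)) = 1 / 2 * (((n : ℝ) - 2) / (n - 1)) := by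
    field_simp
  rw [hc] at heq
  have n1 := hnn2 s (((n : ℝ) - 1)⁻¹ • ∑ i, s i i)
  have n2 := hnn2 t (((n : ℝ) - 1)⁻¹ • ∑ i, t i i)
  obtain ⟨a1, a2⟩ := key s _ (hh _) (by linarith)
  obtain ⟨a3, a4⟩ := key t _ (hh _) (by linarith)
  exact ⟨a1, a2, a3, a4⟩

/-- A totally symmetric array with the vanishing pattern of the equality case of Chen's inequality
is trace free. -/
theorem trace_eq_zero_of_symm (C : Fin n → Fin n → Fin n → ℝ) (h1 : ∀ i j k, C i j k = C j i k)
    (h2 : ∀ i j k, C i j k = C k j i) (hn : 4 ≤ n) {k l : Fin n}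
    (hd : ∀ r i, i ≠ k → i ≠ l → ((n : ℝ) - 1) * C i i r = ∑ j, C j j r)
    (ho : ∀ r i j, i ≠ j → i ≠ k → i ≠ l → C i j r = 0) (r : Fin n) : ∑ j, C j j r = 0 := by
  -- This is where `n ≥ 4` is needed.
  obtain ⟨i, hi⟩ : ∃ i, i ∉ ({k, l, r} : Finset (Fin n)) := by
    by_contra! h
    have h3 : (Finset.univ : Finset (Fin n)) ⊆ {k, l, r} := fun i _ ↦ h i
    have h4 := Finset.card_le_card h3
    have h5 := Finset.card_le_three (a := k) (b := l) (c := r)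
    simp at h4
    omega
  simp only [Finset.mem_insert, Finset.mem_singleton, not_or] at hi
  -- `C i i r = C i r i` by symmetry, and the right side has the off-diagonal pair `(i, r)` in
  -- front.
  rw [← hd r i hi.1 hi.2.1, h2, h1, ho i i r hi.2.2 hi.1 hi.2.1, mul_zero]

end ChenAlgebra

/-! ### Totally real subspaces of quaternionic vector spaces. -/

section QuaternionAlgebra

variable {T V : Type*} [AddCommGroup T] [Module ℝ T] [AddCommGroup V] [Module ℝ V]
  [TopologicalSpace V]

/-- A totally real subspace of a quarter of the dimension spans, over the quaternions, the whole
space. -/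
theorem exists_quaternion_decomposition [FiniteDimensional ℝ T] [FiniteDimensional ℝ V]
    (hdim : Module.finrank ℝ V = 4 * Module.finrank ℝ T) {J : Fin 3 → V →L[ℝ] V}
    (hJ : IsQuaternionTriple J) (b : V →ₗ[ℝ] V →ₗ[ℝ] ℝ) (hpos : ∀ v, v ≠ 0 → 0 < b v v)
    (A : T →ₗ[ℝ] V) (hA : Function.Injective A) (hreal : ∀ α u v, b (J α (A u)) (A v) = 0) (h : V) :
    ∃ x y : T, ∃ z w : T, h = A x + J 0 (A y) + J 1 (A z) + J 2 (A w) := by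
  have j00 := fun v ↦ (hJ 0 v).1
  have j01 : ∀ v, J 0 (J 1 v) = J 2 v := fun v ↦ (hJ 0 v).2.1
  have j10 : ∀ v, J 1 (J 0 v) = - J 2 v := fun v ↦ (hJ 0 v).2.2
  have j11 := fun v ↦ (hJ 1 v).1
  have j12 : ∀ v, J 1 (J 2 v) = J 0 v := fun v ↦ (hJ 1 v).2.1
  have j21 : ∀ v, J 2 (J 1 v) = - J 0 v := fun v ↦ (hJ 1 v).2.2
  have j22 := fun v ↦ (hJ 2 v).1
  have j20 : ∀ v, J 2 (J 0 v) = J 1 v := fun v ↦ (hJ 2 v).2.1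
  have j02 : ∀ v, J 0 (J 2 v) = - J 1 v := fun v ↦ (hJ 2 v).2.2
  let Φ : T × T × T × T →ₗ[ℝ] V := A.coprod (((J 0).toLinearMap ∘ₗ A).coprod
    (((J 1).toLinearMap ∘ₗ A).coprod ((J 2).toLinearMap ∘ₗ A)))
  have hzero : ∀ u : T, b (A u) (A u) = 0 → u = 0 := fun u hu ↦ by
    by_contra hne
    exact (hpos (A u) fun h ↦ hne (hA (h.trans (map_zero A).symm))).ne' hu
  have hinj : Function.Injective Φ := by
    rw [injective_iff_map_eq_zero]
    rintro ⟨x, y, z, w⟩ h0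
    have h0' : A x + (J 0 (A y) + (J 1 (A z) + J 2 (A w))) = 0 := h0
    -- Multiplying the relation by `1, J 0, J 1, J 2` brings one summand at a time back to the image
    -- of `A`, up to sign. The other three become `J`-images, which are orthogonal to that image.
    have e0 := congrArg (fun q ↦ b q (A x)) h0'
    have e1 := congrArg (fun q ↦ b (J 0 q) (A y)) h0'
    have e2 := congrArg (fun q ↦ b (J 1 q) (A z)) h0'
    have e3 := congrArg (fun q ↦ b (J 2 q) (A w)) h0'
    simp only [map_add, map_zero, map_neg, LinearMap.add_apply, LinearMap.neg_apply,
      LinearMap.zero_apply, hreal, j00, j01, j02, j10, j11, j12, j20, j21, j22, add_zero,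
      zero_add, neg_zero, neg_eq_zero] at e0 e1 e2 e3
    rw [hzero x e0, hzero y e1, hzero z e2, hzero w e3]
    rfl
  have hsurj : Function.Surjective Φ := by
    refine (LinearMap.injective_iff_surjective_of_finrank_eq_finrank ?_).1 hinj
    simp only [Module.finrank_prod, hdim]
    ring
  obtain ⟨⟨x, y, z, w⟩, hx⟩ := hsurj h
  refine ⟨x, y, z, w, hx.symm.trans ?_⟩
  change A x + (J 0 (A y) + (J 1 (A z) + J 2 (A w))) = _
  abel

/-- By the decomposition, `h` is orthogonal to everything, in particular to itself. This is the
version for `σ*`. -/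
theorem eq_zero_of_orthogonal_quaternion [FiniteDimensional ℝ T] [FiniteDimensional ℝ V]
    (hdim : Module.finrank ℝ V = 4 * Module.finrank ℝ T) {J : Fin 3 → V →L[ℝ] V}
    (hJ : IsQuaternionTriple J) (b : V →ₗ[ℝ] V →ₗ[ℝ] ℝ) (hpos : ∀ v, v ≠ 0 → 0 < b v v)
    (A : T →ₗ[ℝ] V) (hA : Function.Injective A) (hreal : ∀ α u v, b (J α (A u)) (A v) = 0) {h : V}
    (h0 : ∀ v, b h (A v) = 0) (h1 : ∀ α v, b h (J α (A v)) = 0) : h = 0 := by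
  obtain ⟨x, y, z, w, hh⟩ := exists_quaternion_decomposition hdim hJ b hpos A hA hreal h
  by_contra hne
  refine (hpos h hne).ne' ?_
  nth_rewrite 2 [hh]
  simp [h0, h1]

/-- The version for `σ`. The form `b` need not be invariant under `J α`, so `b (J α h) (A v) = 0`
does not say that `h` is orthogonal to `J α (A v)`. Instead `b (J α h) (A y)` isolates, up to sign,
the component of `h` in `J α (A T)`, again because the image of `A` is totally real. -/
theorem eq_zero_of_quaternion_orthogonal [FiniteDimensional ℝ T] [FiniteDimensional ℝ V]
    (hdim : Module.finrank ℝ V = 4 * Module.finrank ℝ T) {J : Fin 3 → V →L[ℝ] V}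
    (hJ : IsQuaternionTriple J) (b : V →ₗ[ℝ] V →ₗ[ℝ] ℝ) (hpos : ∀ v, v ≠ 0 → 0 < b v v)
    (A : T →ₗ[ℝ] V) (hA : Function.Injective A) (hreal : ∀ α u v, b (J α (A u)) (A v) = 0) {h : V}
    (h0 : ∀ v, b h (A v) = 0) (h1 : ∀ α v, b (J α h) (A v) = 0) : h = 0 := by
  have j00 := fun v ↦ (hJ 0 v).1
  have j01 : ∀ v, J 0 (J 1 v) = J 2 v := fun v ↦ (hJ 0 v).2.1
  have j10 : ∀ v, J 1 (J 0 v) = - J 2 v := fun v ↦ (hJ 0 v).2.2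
  have j11 := fun v ↦ (hJ 1 v).1
  have j12 : ∀ v, J 1 (J 2 v) = J 0 v := fun v ↦ (hJ 1 v).2.1
  have j21 : ∀ v, J 2 (J 1 v) = - J 0 v := fun v ↦ (hJ 1 v).2.2
  have j22 := fun v ↦ (hJ 2 v).1
  have j20 : ∀ v, J 2 (J 0 v) = J 1 v := fun v ↦ (hJ 2 v).2.1
  have j02 : ∀ v, J 0 (J 2 v) = - J 1 v := fun v ↦ (hJ 2 v).2.2
  obtain ⟨x, y, z, w, hh⟩ := exists_quaternion_decomposition hdim hJ b hpos A hA hreal h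
  have hzero : ∀ u : T, b (A u) (A u) = 0 → A u = 0 := fun u hu ↦ by
    by_contra hne
    exact (hpos (A u) hne).ne' hu
  have e0 := h0 x
  have e1 := h1 0 y
  have e2 := h1 1 z
  have e3 := h1 2 w
  rw [hh] at e0 e1 e2 e3
  simp only [map_add, map_neg, LinearMap.add_apply, LinearMap.neg_apply,
      hreal, j00, j01, j02, j10, j11, j12, j20, j21, j22, add_zero,
      zero_add, neg_zero, neg_eq_zero] at e0 e1 e2 e3
  rw [hh, hzero x e0, hzero y e1, hzero z e2, hzero w e3]
  simp

end QuaternionAlgebra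

/-- The trace of a vector-valued bilinear map does not depend on the orthonormal basis. -/
theorem trace_eq_of_orthonormal {T V : Type*} [AddCommGroup T] [Module ℝ T]
    [AddCommGroup V] [Module ℝ V] {n : ℕ} [FiniteDimensional ℝ T] (hT : Module.finrank ℝ T = n)
    (c : T →ₗ[ℝ] T →ₗ[ℝ] ℝ) (s : T →ₗ[ℝ] T →ₗ[ℝ] V) (e e' : Fin n → T)
    (he : ∀ i j, c (e i) (e j) = if i = j then 1 else 0)
    (he' : ∀ i j, c (e' i) (e' j) = if i = j then 1 else 0) :
    ∑ i, s (e' i) (e' i) = ∑ i, s (e i) (e i) := by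
  have hli : LinearIndependent ℝ e := by
    rw [Fintype.linearIndependent_iff]
    intro a ha i
    have := congrArg (fun q ↦ c q (e i)) ha
    simpa [map_sum, LinearMap.sum_apply, he] using this
  let B := basisOfLinearIndependentOfCardEqFinrank' e hli (by simp [hT])
  have hB : ∀ i, B i = e i := fun i ↦ by simp [B]
  let a : Matrix (Fin n) (Fin n) ℝ := Matrix.of fun i j ↦ B.repr (e' i) j
  have ha : ∀ i, e' i = ∑ j, a i j • e j := fun i ↦ by
    conv_lhs => rw [← B.sum_repr (e' i)]
    simp [a, hB]
  have h1 : a * a.transpose = 1 := by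
    ext i j
    have := he' i j
    rw [ha i, ha j] at this
    simp only [map_sum, LinearMap.sum_apply, map_smul, LinearMap.smul_apply, smul_eq_mul, he] at this
    simp only [Matrix.mul_apply, Matrix.transpose_apply, Matrix.one_apply]
    rw [← this]
    simp [mul_comm]
  -- Orthonormality of `e'` makes the rows of the transition matrix orthonormal; the trace needs the
  -- columns.
  have h2 : a.transpose * a = 1 := mul_eq_one_comm.1 h1
  have h3 : ∀ j l, ∑ i, a i j * a i l = if j = l then 1 else 0 := fun j l ↦ by
    have := congrFun (congrFun h2 j) l
    simpa [Matrix.mul_apply, Matrix.one_apply] using this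
  calc ∑ i, s (e' i) (e' i) = ∑ i, ∑ j, ∑ l, (a i j * a i l) • s (e j) (e l) := by
        refine Finset.sum_congr rfl fun i _ ↦ ?_
        rw [ha i]
        simp only [map_sum, LinearMap.sum_apply, map_smul, LinearMap.smul_apply, Finset.smul_sum, smul_smul]
        rw [Finset.sum_comm]
        simp [mul_comm]
    _ = ∑ j, ∑ l, (∑ i, a i j * a i l) • s (e j) (e l) := by
        rw [Finset.sum_comm]
        refine Finset.sum_congr rfl fun j _ ↦ ?_
        rw [Finset.sum_comm]
        simp [Finset.sum_smul]
    _ = ∑ i, s (e i) (e i) := by simp [h3, ite_smul]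

/-! ### Connections in coordinates -/

/-! ### Product rules for directional derivatives. -/

section LineDeriv

variable {E F G : Type*} [NormedAddCommGroup E] [NormedSpace ℝ E] [NormedAddCommGroup F]
  [NormedSpace ℝ F] [NormedAddCommGroup G] [NormedSpace ℝ G]

theorem HasLineDerivAt.add' {f g : E → F} {f' g' : F} {x v : E} (hf : HasLineDerivAt ℝ f f' x v)
    (hg : HasLineDerivAt ℝ g g' x v) : HasLineDerivAt ℝ (fun y ↦ f y + g y) (f' + g') x v :=
  HasDerivAt.add hf hg

/-- Along a line this is the one-variable product rule. Iterating it differentiates curried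
expressions such as `G z a b` or `Γ z a u` one slot at a time. -/
theorem HasLineDerivAt.clm_apply {c : E → F →L[ℝ] G} {c' : F →L[ℝ] G} {u : E → F} {u' : F} {x v : E}
    (hc : HasLineDerivAt ℝ c c' x v) (hu : HasLineDerivAt ℝ u u' x v) :
    HasLineDerivAt ℝ (fun y ↦ c y (u y)) (c' (u x) + c x u') x v := by
  have := HasDerivAt.clm_apply (c := fun t : ℝ ↦ c (x + t • v)) (u := fun t : ℝ ↦ u (x + t • v))
    (x := 0) hc hu
  simpa [HasLineDerivAt] using this

theorem HasLineDerivAt.clm_apply_const {c : E → F →L[ℝ] G} {c' : F →L[ℝ] G} {x v : E}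
    (hc : HasLineDerivAt ℝ c c' x v) (u : F) : HasLineDerivAt ℝ (fun y ↦ c y u) (c' u) x v := by
  have h0 : HasLineDerivAt ℝ (fun _ : E ↦ u) 0 x v := hasDerivAt_const (0 : ℝ) u
  simpa using hc.clm_apply h0

theorem DifferentiableAt.hasLineDerivAt_fderiv {f : E → F} {x : E} (hf : DifferentiableAt ℝ f x)
    (v : E) : HasLineDerivAt ℝ f (fderiv ℝ f x v) x v :=
  hf.hasFDerivAt.hasLineDerivAt v

theorem DifferentiableAt.hasLineDerivAt_comp {f : E → F} {g : F → G} {x : E}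
    (hg : DifferentiableAt ℝ g (f x)) (hf : DifferentiableAt ℝ f x) (v : E) :
    HasLineDerivAt ℝ (fun y ↦ g (f y)) (fderiv ℝ g (f x) (fderiv ℝ f x v)) x v :=
  (hg.hasFDerivAt.comp x hf.hasFDerivAt).hasLineDerivAt v

theorem HasLineDerivAt.fderiv_apply {f : E → F} {f' : F} {x v : E} (h : HasLineDerivAt ℝ f f' x v)
    (hf : DifferentiableAt ℝ f x) : fderiv ℝ f x v = f' :=
  (hf.hasLineDerivAt_fderiv v).unique h

theorem ContDiffAt.fderiv_fderiv_comm {f : E → F} {x : E} (hf : ContDiffAt ℝ 2 f x) (u v : E) :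
    fderiv ℝ (fderiv ℝ f) x u v = fderiv ℝ (fderiv ℝ f) x v u :=
  (hf.isSymmSndFDerivAt (by simp)).eq u v

end LineDeriv

/-! ### Curvature, duality and the Gauss equation in a normed space. -/

section Coordinates

set_option maxSynthPendingDepth 3

variable {E E' : Type*} [NormedAddCommGroup E] [NormedSpace ℝ E] [NormedAddCommGroup E']
  [NormedSpace ℝ E']

/-- The curvature of the connection `∇_u a = ∂_u a + Γ(a, u)` on an open subset of `E`. -/
def coordCurvature (Γ : E → E →L[ℝ] E →L[ℝ] E) (y u v a : E) : E :=
  fderiv ℝ Γ y u a v - fderiv ℝ Γ y v a u + Γ y (Γ y a v) u - Γ y (Γ y a u) v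

/-- The curvatures of dual connections are, up to the sign, adjoint to each other. -/
theorem coordCurvature_duality {G : E → E →L[ℝ] E →L[ℝ] ℝ} {Γ Γs : E → E →L[ℝ] E →L[ℝ] E} {y : E}
    (hG : ContDiffAt ℝ 2 G y) (hΓ : DifferentiableAt ℝ Γ y) (hΓs : DifferentiableAt ℝ Γs y)
    (hdual : ∀ᶠ z in 𝓝 y, ∀ u a b : E,
      fderiv ℝ G z u a b = G z (Γ z a u) b + G z a (Γs z b u)) (u v a b : E) :
    G y (coordCurvature Γ y u v a) b = - G y a (coordCurvature Γs y u v b) := by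
  have hG1 : DifferentiableAt ℝ G y := hG.differentiableAt (by simp)
  have hG2 : DifferentiableAt ℝ (fderiv ℝ G) y :=
    (hG.fderiv_right (m := 1) (by norm_num)).differentiableAt (by simp)
  have key : ∀ u v : E, fderiv ℝ (fderiv ℝ G) y u v a b
      = (fderiv ℝ G y u (Γ y a v) b + G y (fderiv ℝ Γ y u a v) b)
        + (fderiv ℝ G y u a (Γs y b v) + G y a (fderiv ℝ Γs y u b v)) := by
    intro u v
    have h1 : HasLineDerivAt ℝ (fun z ↦ fderiv ℝ G z v a b)
        (fderiv ℝ (fderiv ℝ G) y u v a b) y u :=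
      (((hG2.hasLineDerivAt_fderiv u).clm_apply_const v).clm_apply_const a).clm_apply_const b
    have hg := hG1.hasLineDerivAt_fderiv u
    have hγ := ((hΓ.hasLineDerivAt_fderiv u).clm_apply_const a).clm_apply_const v
    have hγs := ((hΓs.hasLineDerivAt_fderiv u).clm_apply_const b).clm_apply_const v
    have h2 := ((hg.clm_apply hγ).clm_apply_const b).add'
      ((hg.clm_apply_const a).clm_apply hγs)
    have h3 := h1.unique (h2.congr_of_eventuallyEq (hdual.mono fun z hz ↦ hz v a b))
    rw [h3]
    simp
  -- The symmetry of the second derivative of the metric is the whole content: expanding both sides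
  -- by duality leaves the two curvature terms.
  have hc : fderiv ℝ (fderiv ℝ G) y u v a b = fderiv ℝ (fderiv ℝ G) y v u a b := by
    rw [hG.fderiv_fderiv_comm]
  rw [key, key] at hc
  have hd := hdual.self_of_nhds
  simp only [hd] at hc
  simp only [coordCurvature, map_add, map_sub, add_apply, sub_apply]
  linarith

/-- The covariant derivative along the map `F`, in direction `x`, of the field `c` along `F`. -/
def coordAlong (Γ : E → E →L[ℝ] E →L[ℝ] E) (F : E' → E) (c : E' → E) (z x : E') : E :=
  fderiv ℝ c z x + Γ (F z) (c z) (fderiv ℝ F z x)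

theorem coordAlong_sub {Γ : E → E →L[ℝ] E →L[ℝ] E} {F : E' → E} {c d : E' → E} {z : E'}
    (hc : DifferentiableAt ℝ c z) (hd : DifferentiableAt ℝ d z) (x : E') :
    coordAlong Γ F (fun q ↦ c q - d q) z x = coordAlong Γ F c z x - coordAlong Γ F d z x := by
  simp only [coordAlong, fderiv_fun_sub hc hd, sub_apply, map_sub]
  abel

/-- Dual connections along a map. -/
theorem coordAlong_duality {G : E → E →L[ℝ] E →L[ℝ] ℝ} {Γ Γs : E → E →L[ℝ] E →L[ℝ] E}
    {F c d : E' → E} {z : E'} (hG : DifferentiableAt ℝ G (F z)) (hF : DifferentiableAt ℝ F z)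
    (hdual : ∀ u a b : E,
      fderiv ℝ G (F z) u a b = G (F z) (Γ (F z) a u) b + G (F z) a (Γs (F z) b u))
    (hc : DifferentiableAt ℝ c z) (hd : DifferentiableAt ℝ d z)
    (h0 : ∀ᶠ q in 𝓝 z, G (F q) (c q) (d q) = 0) (x : E') :
    G (F z) (coordAlong Γ F c z x) (d z) = - G (F z) (c z) (coordAlong Γs F d z x) := by
  have h1 := ((hG.hasLineDerivAt_comp hF x).clm_apply (hc.hasLineDerivAt_fderiv x)).clm_apply
    (hd.hasLineDerivAt_fderiv x)
  -- The pairing `G(c, d)` vanishes near `z`, so its derivative does too; duality splits that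
  -- derivative into the two sides.
  have h2 : HasLineDerivAt ℝ (fun _ : E' ↦ (0 : ℝ)) 0 z x := hasDerivAt_const (0 : ℝ) (0 : ℝ)
  have h3 := h1.unique (h2.congr_of_eventuallyEq h0)
  simp only [add_apply, hdual] at h3
  simp only [coordAlong, map_add, add_apply]
  linarith

/-- The derivative of the field `dF(w)` along `F` in direction `x`. -/
theorem coordAlong_fderiv {Γ : E → E →L[ℝ] E →L[ℝ] E} {F : E' → E} {z : E'}
    (hF : ContDiffAt ℝ 2 F z) (w x : E') :
    coordAlong Γ F (fun q ↦ fderiv ℝ F q w) z x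
      = fderiv ℝ (fderiv ℝ F) z x w + Γ (F z) (fderiv ℝ F z w) (fderiv ℝ F z x) := by
  have h : DifferentiableAt ℝ (fderiv ℝ F) z :=
    (hF.fderiv_right (m := 1) (by norm_num)).differentiableAt (by simp)
  rw [coordAlong, ((h.hasLineDerivAt_fderiv x).clm_apply_const w).fderiv_apply (by fun_prop)]

theorem differentiableAt_coordAlong_fderiv {Γ : E → E →L[ℝ] E →L[ℝ] E} {F : E' → E} {z : E'}
    (hΓ : DifferentiableAt ℝ Γ (F z)) (hF : ContDiffAt ℝ 3 F z) (w x : E') :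
    DifferentiableAt ℝ (fun q ↦ coordAlong Γ F (fun q ↦ fderiv ℝ F q w) q x) z := by
  have h1 : DifferentiableAt ℝ (fderiv ℝ F) z :=
    (hF.fderiv_right (m := 1) (by norm_num)).differentiableAt (by simp)
  have h2 : DifferentiableAt ℝ (fderiv ℝ (fderiv ℝ F)) z :=
    ((hF.fderiv_right (m := 2) (by norm_num)).fderiv_right (m := 1)
      (by norm_num)).differentiableAt (by simp)
  have h3 : DifferentiableAt ℝ (fun q ↦ Γ (F q)) z :=
    hΓ.comp z (hF.differentiableAt (by simp))
  have h4 : DifferentiableAt ℝ (fun q ↦ fderiv ℝ (fderiv ℝ F) q x w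
      + Γ (F q) (fderiv ℝ F q w) (fderiv ℝ F q x)) z :=
    DifferentiableAt.add (by fun_prop) ((h3.clm_apply (by fun_prop)).clm_apply (by fun_prop))
  refine h4.congr_of_eventuallyEq ?_
  filter_upwards [(hF.of_le (m := 2) (by norm_num)).eventually (by simp)] with q hq
  exact coordAlong_fderiv hq w x

/-- The curvature of the connection along `F`. -/
theorem coordAlong_coordAlong_sub {Γ : E → E →L[ℝ] E →L[ℝ] E} {F : E' → E} {z : E'}
    (hΓ : DifferentiableAt ℝ Γ (F z)) (hF : ContDiffAt ℝ 3 F z) (w x y : E') :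
    coordAlong Γ F (fun q ↦ coordAlong Γ F (fun q ↦ fderiv ℝ F q w) q y) z x
      - coordAlong Γ F (fun q ↦ coordAlong Γ F (fun q ↦ fderiv ℝ F q w) q x) z y
      = coordCurvature Γ (F z) (fderiv ℝ F z x) (fderiv ℝ F z y) (fderiv ℝ F z w) := by
  have hF2 : ContDiffAt ℝ 2 F z := hF.of_le (by norm_num)
  have h0 : DifferentiableAt ℝ F z := hF.differentiableAt (by simp)
  have h1' : ContDiffAt ℝ 2 (fderiv ℝ F) z := hF.fderiv_right (by norm_num)
  have h1 : DifferentiableAt ℝ (fderiv ℝ F) z := h1'.differentiableAt (by simp)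
  have h2 : DifferentiableAt ℝ (fderiv ℝ (fderiv ℝ F)) z :=
    (h1'.fderiv_right (m := 1) (by norm_num)).differentiableAt (by simp)
  have key : ∀ x y : E', fderiv ℝ (fun q ↦ coordAlong Γ F (fun q ↦ fderiv ℝ F q w) q y) z x
      = fderiv ℝ (fderiv ℝ (fderiv ℝ F)) z x y w
        + ((fderiv ℝ Γ (F z) (fderiv ℝ F z x) (fderiv ℝ F z w) (fderiv ℝ F z y)
          + Γ (F z) (fderiv ℝ (fderiv ℝ F) z x w) (fderiv ℝ F z y))
        + Γ (F z) (fderiv ℝ F z w) (fderiv ℝ (fderiv ℝ F) z x y)) := by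
    intro x y
    have e1 := ((h2.hasLineDerivAt_fderiv x).clm_apply_const y).clm_apply_const w
    have e2 := (h1.hasLineDerivAt_fderiv x).clm_apply_const w
    have e3 := (h1.hasLineDerivAt_fderiv x).clm_apply_const y
    have e4 := e1.add' (((hΓ.hasLineDerivAt_comp h0 x).clm_apply e2).clm_apply e3)
    have e5 := e4.congr_of_eventuallyEq
      (f₁ := fun q ↦ coordAlong Γ F (fun q ↦ fderiv ℝ F q w) q y) (by
        filter_upwards [hF2.eventually (by simp)] with q hq
        exact coordAlong_fderiv hq w y)
    rw [e5.fderiv_apply (differentiableAt_coordAlong_fderiv hΓ hF w y)]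
    simp
  have hdef : ∀ x y : E', coordAlong Γ F (fun q ↦ coordAlong Γ F (fun q ↦ fderiv ℝ F q w) q y) z x
      = fderiv ℝ (fun q ↦ coordAlong Γ F (fun q ↦ fderiv ℝ F q w) q y) z x
        + Γ (F z) (coordAlong Γ F (fun q ↦ fderiv ℝ F q w) z y) (fderiv ℝ F z x) :=
    fun _ _ ↦ rfl
  -- The second and third derivatives of `F` enter symmetrically in `x` and `y` and cancel; only
  -- derivatives and products of `Γ` survive.
  rw [hdef, hdef, key, key, coordAlong_fderiv hF2, coordAlong_fderiv hF2,
    h1'.fderiv_fderiv_comm x y, hF2.fderiv_fderiv_comm x y]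
  simp only [coordCurvature, map_add, add_apply]
  abel

/-- The Gauss equation, before antisymmetrization: here `B` is the tangent part of the derivative
of `dF(w)` in direction `y`. -/
theorem gauss_coord {G : E → E →L[ℝ] E →L[ℝ] ℝ} {Γ Γs : E → E →L[ℝ] E →L[ℝ] E}
    {F : E' → E} {z : E'} (hG : DifferentiableAt ℝ G (F z))
    (hdual : ∀ u a b : E,
      fderiv ℝ G (F z) u a b = G (F z) (Γ (F z) a u) b + G (F z) a (Γs (F z) b u))
    (hΓ : DifferentiableAt ℝ Γ (F z)) (hF : ContDiffAt ℝ 3 F z) {B : E' → E'}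
    (hBd : DifferentiableAt ℝ B z) (y w : E')
    (hB : ∀ᶠ q in 𝓝 z, ∀ t, G (F q) (coordAlong Γ F (fun q ↦ fderiv ℝ F q w) q y
      - fderiv ℝ F q (B q)) (fderiv ℝ F q t) = 0) (x t : E') :
    G (F z) (coordAlong Γ F (fun q ↦ fderiv ℝ F q (B q)) z x) (fderiv ℝ F z t)
      = G (F z) (coordAlong Γ F (fun q ↦ coordAlong Γ F (fun q ↦ fderiv ℝ F q w) q y) z x)
          (fderiv ℝ F z t)
        + G (F z) (coordAlong Γ F (fun q ↦ fderiv ℝ F q w) z y - fderiv ℝ F z (B z))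
            (coordAlong Γs F (fun q ↦ fderiv ℝ F q t) z x) := by
  have h1 : DifferentiableAt ℝ (fderiv ℝ F) z :=
    (hF.fderiv_right (m := 1) (by norm_num)).differentiableAt (by simp)
  have hA := differentiableAt_coordAlong_fderiv hΓ hF w y
  have hFB : DifferentiableAt ℝ (fun q ↦ fderiv ℝ F q (B q)) z := h1.clm_apply hBd
  -- The difference `∇_y dF(w) - dF(B)` is normal along `F`. Duality therefore moves the derivative
  -- of this normal part, with a minus sign, onto `dF(t)`.
  have := coordAlong_duality hG (hF.differentiableAt (by simp)) hdual (hA.sub hFB)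
    (d := fun q ↦ fderiv ℝ F q t) (by fun_prop) (hB.mono fun q hq ↦ hq t) x
  have hs := coordAlong_sub (Γ := Γ) (F := F) hA hFB x
  simp only [Pi.sub_def] at this
  rw [hs, map_sub, sub_apply] at this
  linarith

/-- Existence of a differentiable tangent part. -/
theorem differentiableAt_of_isTangentPart [FiniteDimensional ℝ E'] {G : E → E →L[ℝ] E →L[ℝ] ℝ}
    {F : E' → E} {z : E'} (hG : DifferentiableAt ℝ G (F z)) (hF : ContDiffAt ℝ 2 F z)
    (hpos : ∀ v, v ≠ 0 → 0 < G (F z) v v) (hinj : Function.Injective (fderiv ℝ F z))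
    {A : E' → E} (hA : DifferentiableAt ℝ A z) {B : E' → E'}
    (hB : ∀ᶠ q in 𝓝 z, ∀ t, G (F q) (A q - fderiv ℝ F q (B q)) (fderiv ℝ F q t) = 0) :
    DifferentiableAt ℝ B z := by
  have h1 : DifferentiableAt ℝ (fderiv ℝ F) z :=
    (hF.fderiv_right (m := 1) (by norm_num)).differentiableAt (by simp)
  have h2 : DifferentiableAt ℝ (fun q ↦ G (F q)) z := hG.comp z (hF.differentiableAt (by simp))
  let P : E' → (E →L[ℝ] ℝ) →L[ℝ] (E' →L[ℝ] ℝ) := fun q ↦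
    (ContinuousLinearMap.compL ℝ E' E ℝ).flip (fderiv ℝ F q)
  have hP : DifferentiableAt ℝ P z :=
    (ContinuousLinearMap.differentiableAt _).comp z h1
  -- `Q` is the Gram operator of the induced metric. It is invertible at `z`, hence nearby, and the
  -- tangent part is its inverse applied to the functional `G(A, dF ·)`.
  let Q : E' → E' →L[ℝ] (E' →L[ℝ] ℝ) := fun q ↦ (P q).comp ((G (F q)).comp (fderiv ℝ F q))
  have hQ : DifferentiableAt ℝ Q z := hP.clm_comp (h2.clm_comp h1)
  have hQapp : ∀ q u t, Q q u t = G (F q) (fderiv ℝ F q u) (fderiv ℝ F q t) := fun q u t ↦ rfl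
  have hQi : Function.Injective (Q z) := by
    rw [injective_iff_map_eq_zero]
    intro u hu
    by_contra hne
    have h3 : fderiv ℝ F z u ≠ 0 := fun h ↦ hne (hinj (h.trans (map_zero _).symm))
    have h4 : Q z u u = 0 := by rw [hu]; rfl
    exact (hpos _ h3).ne' h4
  have hfr : Module.finrank ℝ E' = Module.finrank ℝ (E' →L[ℝ] ℝ) := by
    rw [← LinearMap.toContinuousLinearMap.finrank_eq]
    exact Subspace.dual_finrank_eq.symm
  let e : E' ≃L[ℝ] (E' →L[ℝ] ℝ) :=
    (LinearEquiv.ofInjectiveOfFinrankEq (Q z).toLinearMap hQi hfr).toContinuousLinearEquiv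
  have he : (e : E' →L[ℝ] (E' →L[ℝ] ℝ)) = Q z := by
    ext u : 1
    rfl
  have : CompleteSpace E' := FiniteDimensional.complete ℝ E'
  have hinv : DifferentiableAt ℝ (fun q ↦ (Q q).inverse) z := by
    have h5 : DifferentiableAt ℝ (ContinuousLinearMap.inverse : (E' →L[ℝ] (E' →L[ℝ] ℝ)) → _)
        (Q z) := he ▸ (contDiffAt_map_inverse (n := 1) e).differentiableAt (by simp)
    exact h5.comp z hQ
  have hd : DifferentiableAt ℝ (fun q ↦ (Q q).inverse (P q (G (F q) (A q)))) z :=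
    hinv.clm_apply (hP.clm_apply (h2.clm_apply hA))
  refine hd.congr_of_eventuallyEq ?_
  have hnhds : ∀ᶠ q in 𝓝 z, Q q ∈ Set.range ((↑) : (E' ≃L[ℝ] (E' →L[ℝ] ℝ)) → _) :=
    hQ.continuousAt.eventually (he ▸ e.nhds)
  filter_upwards [hB, hnhds] with q hq ⟨e', he'⟩
  have h6 : Q q (B q) = P q (G (F q) (A q)) := by
    ext t
    have := hq t
    rw [map_sub, sub_apply, sub_eq_zero] at this
    exact this.symm
  rw [← h6, ← he', ContinuousLinearMap.inverse_equiv]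
  simp

end Coordinates

/-! ### Tangent vectors and vector fields in coordinates -/

section TangentCoordinates

set_option maxSynthPendingDepth 3

variable {k : ℕ} {N : Type*} [TopologicalSpace N] [ChartedSpace (EuclideanSpace ℝ (Fin k)) N]

/-- The chart domain of the preferred chart at `x₀`. -/
abbrev chartDomain (k : ℕ) {N : Type*} [TopologicalSpace N]
    [ChartedSpace (EuclideanSpace ℝ (Fin k)) N] (x₀ : N) : Set N :=
  (chartAt (EuclideanSpace ℝ (Fin k)) x₀).source

theorem mem_chartDomain_self (x₀ : N) : x₀ ∈ chartDomain k x₀ := mem_chart_source _ x₀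

theorem chartDomain_mem_nhds {x₀ x : N} (hx : x ∈ chartDomain k x₀) : chartDomain k x₀ ∈ 𝓝 x :=
  (chartAt _ x₀).open_source.mem_nhds hx

theorem eventually_chart_symm {x₀ x : N} (hx : x ∈ chartDomain k x₀) :
    ∀ᶠ y in 𝓝 x, (extChartAt (𝓡 k) x₀).symm (extChartAt (𝓡 k) x₀ y) = y := by
  filter_upwards [chartDomain_mem_nhds hx] with y hy
  exact (extChartAt (𝓡 k) x₀).left_inv (by simpa using hy)

theorem extChartAt_target_mem_nhds_of_mem {x₀ x : N} (hx : x ∈ chartDomain k x₀) :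
    (extChartAt (𝓡 k) x₀).target ∈ 𝓝 (extChartAt (𝓡 k) x₀ x) :=
  extChartAt_target_mem_nhds' ((extChartAt (𝓡 k) x₀).map_source (by simpa using hx))

theorem chart_symm_mem {x₀ : N} {z : EuclideanSpace ℝ (Fin k)}
    (hz : z ∈ (extChartAt (𝓡 k) x₀).target) : (extChartAt (𝓡 k) x₀).symm z ∈ chartDomain k x₀ := by
  simpa using (extChartAt (𝓡 k) x₀).map_target hz

variable [IsManifold (𝓡 k) ∞ N]

/-- The components of tangent vectors in the preferred chart at `x₀`. -/
def coordL (x₀ x : N) : TangentSpace (𝓡 k) x →L[ℝ] EuclideanSpace ℝ (Fin k) :=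
  (trivializationAt (EuclideanSpace ℝ (Fin k)) (fun x : N ↦ TangentSpace (𝓡 k) x)
    x₀).continuousLinearMapAt ℝ x

/-- The tangent vector with given components in the preferred chart at `x₀`. -/
def coordS (x₀ x : N) : EuclideanSpace ℝ (Fin k) →L[ℝ] TangentSpace (𝓡 k) x :=
  (trivializationAt (EuclideanSpace ℝ (Fin k)) (fun x : N ↦ TangentSpace (𝓡 k) x)
    x₀).symmL ℝ x

/-- The vector field with constant components in the preferred chart at `x₀`. -/
def constField (x₀ : N) (a : EuclideanSpace ℝ (Fin k)) : VField k N := fun x ↦ coordS x₀ x a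

theorem mem_baseSet {x₀ x : N} (hx : x ∈ chartDomain k x₀) : x ∈
    (trivializationAt (EuclideanSpace ℝ (Fin k)) (fun x : N ↦ TangentSpace (𝓡 k) x) x₀).baseSet := by
  rwa [TangentBundle.trivializationAt_baseSet (I := 𝓡 k) x₀]

theorem coordL_coordS {x₀ x : N} (hx : x ∈ chartDomain k x₀) (a : EuclideanSpace ℝ (Fin k)) :
    coordL x₀ x (coordS x₀ x a) = a :=
  Trivialization.continuousLinearMapAt_symmL _ (mem_baseSet hx) a

theorem coordS_coordL {x₀ x : N} (hx : x ∈ chartDomain k x₀) (v : TangentSpace (𝓡 k) x) :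
    coordS x₀ x (coordL x₀ x v) = v :=
  Trivialization.symmL_continuousLinearMapAt _ (mem_baseSet hx) v

theorem coordL_injective {x₀ x : N} (hx : x ∈ chartDomain k x₀) :
    Function.Injective (coordL (k := k) x₀ x) :=
  Function.LeftInverse.injective (coordS_coordL hx)

theorem coordL_apply {x₀ x : N} (hx : x ∈ chartDomain k x₀) (v : TangentSpace (𝓡 k) x) :
    coordL x₀ x v = (trivializationAt (EuclideanSpace ℝ (Fin k))
      (fun x : N ↦ TangentSpace (𝓡 k) x) x₀ ⟨x, v⟩).2 :=
  Trivialization.continuousLinearMapAt_apply_of_mem ℝ _ (mem_baseSet hx) v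

theorem coordL_eq_mfderiv {x₀ x : N} (hx : x ∈ chartDomain k x₀) :
    coordL x₀ x = mvfderiv (𝓡 k) (extChartAt (𝓡 k) x₀) x := by
  have := TangentBundle.continuousLinearMapAt_trivializationAt (I := 𝓡 k) hx
  exact this

theorem diffAt_iff_coordL {x₀ x : N} (hx : x ∈ chartDomain k x₀) (Y : VField k N) :
    Y.DiffAt x ↔ MDifferentiableAt (𝓡 k) 𝓘(ℝ, EuclideanSpace ℝ (Fin k))
      (fun y ↦ coordL x₀ y (Y y)) x := by
  have h1 := Trivialization.mdifferentiableAt_section_iff (𝓡 k)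
    (trivializationAt (EuclideanSpace ℝ (Fin k)) (fun x : N ↦ TangentSpace (𝓡 k) x) x₀) Y
    (mem_baseSet hx)
  refine h1.trans (Filter.EventuallyEq.mdifferentiableAt_iff ?_)
  filter_upwards [chartDomain_mem_nhds hx] with y hy
  exact (coordL_apply hy _).symm

theorem diffAt_constField {x₀ x : N} (hx : x ∈ chartDomain k x₀) (a : EuclideanSpace ℝ (Fin k)) :
    (constField x₀ a).DiffAt x := by
  rw [diffAt_iff_coordL hx]
  refine (mdifferentiableAt_const (c := a)).congr_of_eventuallyEq ?_
  filter_upwards [chartDomain_mem_nhds hx] with y hy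
  exact coordL_coordS hy a

/-- `FiberBundle.extend` spreads `v` through the trivialization at its own base point. The
extensions used to define curvature and second fundamental form are thus constant in the chart. -/
theorem extend_eventuallyEq {x₀ : N} (v : TangentSpace (𝓡 k) x₀) {x : N}
    (hx : x ∈ chartDomain k x₀) :
    FiberBundle.extend (EuclideanSpace ℝ (Fin k)) v x = constField x₀ (coordL x₀ x₀ v) x := by
  rw [coordL_apply (mem_chartDomain_self x₀)]
  exact (Trivialization.symmL_apply _ (mem_baseSet hx) _).symm

theorem mdifferentiableAt_extChartAt' {x₀ x : N} (hx : x ∈ chartDomain k x₀) :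
    MDifferentiableAt (𝓡 k) 𝓘(ℝ, EuclideanSpace ℝ (Fin k)) (extChartAt (𝓡 k) x₀) x :=
  mdifferentiableAt_extChartAt hx

variable {W : Type*} [NormedAddCommGroup W] [NormedSpace ℝ W]

/-- A function given in the chart by `h` is differentiable if `h` is. -/
theorem mdifferentiableAt_of_chart {x₀ x : N} (hx : x ∈ chartDomain k x₀) {c : N → W}
    {h : EuclideanSpace ℝ (Fin k) → W} (hc : ∀ᶠ y in 𝓝 x, c y = h (extChartAt (𝓡 k) x₀ y))
    (hh : DifferentiableAt ℝ h (extChartAt (𝓡 k) x₀ x)) :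
    MDifferentiableAt (𝓡 k) 𝓘(ℝ, W) c x := by
  have h1 : MDifferentiableAt (𝓡 k) 𝓘(ℝ, W) (h ∘ extChartAt (𝓡 k) x₀) x :=
    hh.mdifferentiableAt.comp x (mdifferentiableAt_extChartAt' hx)
  exact h1.congr_of_eventuallyEq hc

theorem mvfderiv_of_chart {x₀ x : N} (hx : x ∈ chartDomain k x₀) {c : N → W}
    {h : EuclideanSpace ℝ (Fin k) → W} (hc : ∀ᶠ y in 𝓝 x, c y = h (extChartAt (𝓡 k) x₀ y))
    (hh : DifferentiableAt ℝ h (extChartAt (𝓡 k) x₀ x)) (v : TangentSpace (𝓡 k) x) :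
    mvfderiv (𝓡 k) c x v = fderiv ℝ h (extChartAt (𝓡 k) x₀ x) (coordL x₀ x v) := by
  have h1 : mfderiv (𝓡 k) 𝓘(ℝ, W) c x = mfderiv (𝓡 k) 𝓘(ℝ, W) (h ∘ extChartAt (𝓡 k) x₀) x :=
    Filter.EventuallyEq.mfderiv_eq hc
  have h2 := mfderiv_comp_apply x hh.mdifferentiableAt (mdifferentiableAt_extChartAt' hx) v
  rw [mfderiv_eq_fderiv] at h2
  rw [coordL_eq_mfderiv hx]
  change mfderiv (𝓡 k) 𝓘(ℝ, W) c x v = _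
  rw [h1]
  exact h2

/-- A smooth function is smooth in the chart. -/
theorem contDiffAt_chart {x₀ x : N} (hx : x ∈ chartDomain k x₀) {c : N → W}
    (hc : ContMDiffAt (𝓡 k) 𝓘(ℝ, W) ∞ c x) {h : EuclideanSpace ℝ (Fin k) → W}
    (hh : ∀ z ∈ (extChartAt (𝓡 k) x₀).target, h z = c ((extChartAt (𝓡 k) x₀).symm z)) :
    ContDiffAt ℝ ∞ h (extChartAt (𝓡 k) x₀ x) := by
  have hx' : x ∈ (extChartAt (𝓡 k) x₀).source := by simpa using hx
  have h1 : ContMDiffAt 𝓘(ℝ, EuclideanSpace ℝ (Fin k)) (𝓡 k) ∞ (extChartAt (𝓡 k) x₀).symm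
      (extChartAt (𝓡 k) x₀ x) :=
    (contMDiffOn_extChartAt_symm (n := ∞) x₀).contMDiffAt (extChartAt_target_mem_nhds_of_mem hx)
  have h2 : ContMDiffAt 𝓘(ℝ, EuclideanSpace ℝ (Fin k)) 𝓘(ℝ, W) ∞
      (c ∘ (extChartAt (𝓡 k) x₀).symm) (extChartAt (𝓡 k) x₀ x) :=
    ContMDiffAt.comp _ (by rwa [(extChartAt (𝓡 k) x₀).left_inv hx']) h1
  refine h2.contDiffAt.congr_of_eventuallyEq ?_
  filter_upwards [extChartAt_target_mem_nhds_of_mem hx] with z hz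
  exact hh z hz

theorem lieBracketWithin_eq_zero_of_const {V W : EuclideanSpace ℝ (Fin k) → EuclideanSpace ℝ (Fin k)}
    {a b z : EuclideanSpace ℝ (Fin k)} (hV : V =ᶠ[𝓝 z] fun _ ↦ a) (hW : W =ᶠ[𝓝 z] fun _ ↦ b)
    (s : Set (EuclideanSpace ℝ (Fin k))) : VectorField.lieBracketWithin ℝ V W s z = 0 := by
  have h : ∀ {U : EuclideanSpace ℝ (Fin k) → EuclideanSpace ℝ (Fin k)} {c}, (U =ᶠ[𝓝 z] fun _ ↦ c) →
      fderivWithin ℝ U s z = 0 := by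
    intro U c hU
    rw [Filter.EventuallyEq.fderivWithin_eq (hU.filter_mono nhdsWithin_le_nhds) hU.self_of_nhds]
    simp
  simp [VectorField.lieBracketWithin, h hV, h hW]

/-- The Lie bracket of vector fields with constant components vanishes. -/
theorem mlieBracket_extend {x₀ : N} (u v : TangentSpace (𝓡 k) x₀) :
    VectorField.mlieBracket (𝓡 k) (FiberBundle.extend (EuclideanSpace ℝ (Fin k)) u : VField k N)
      (FiberBundle.extend (EuclideanSpace ℝ (Fin k)) v : VField k N) x₀ = 0 := by
  -- The bracket is computed after pulling back to the chart, where these fields are constant.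
  have key : ∀ w : TangentSpace (𝓡 k) x₀,
      (VectorField.mpullbackWithin 𝓘(ℝ, EuclideanSpace ℝ (Fin k)) (𝓡 k)
        (extChartAt (𝓡 k) x₀).symm (FiberBundle.extend (EuclideanSpace ℝ (Fin k)) w : VField k N)
        (Set.range (𝓡 k)))
      =ᶠ[𝓝 (extChartAt (𝓡 k) x₀ x₀)] fun _ ↦ coordL x₀ x₀ w := by
    intro w
    filter_upwards [extChartAt_target_mem_nhds_of_mem (mem_chartDomain_self (k := k) x₀)] with z hz
    have hz' := chart_symm_mem hz
    rw [VectorField.mpullbackWithin_apply, extend_eventuallyEq w hz']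
    have h1 := TangentBundle.symmL_trivializationAt (I := 𝓡 k) hz'
    rw [(extChartAt (𝓡 k) x₀).right_inv hz] at h1
    rw [← h1]
    change ContinuousLinearMap.inverse (coordS x₀ ((extChartAt (𝓡 k) x₀).symm z))
      (coordS x₀ ((extChartAt (𝓡 k) x₀).symm z) (coordL x₀ x₀ w)) = _
    have h2 : (coordS (k := k) x₀ ((extChartAt (𝓡 k) x₀).symm z)).inverse
        = coordL x₀ ((extChartAt (𝓡 k) x₀).symm z) := by
      refine ContinuousLinearMap.inverse_eq ?_ ?_
      · ext1 a; exact coordS_coordL hz' a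
      · ext1 a; exact coordL_coordS hz' a
    rw [h2, coordL_coordS hz']
  rw [VectorField.mlieBracket, VectorField.mlieBracketWithin_apply]
  exact (congrArg _ (lieBracketWithin_eq_zero_of_const (key u) (key v) _)).trans (map_zero _)

end TangentCoordinates

/-! ### Connections and metrics in coordinates -/

section ConnectionCoordinates

set_option maxSynthPendingDepth 3

variable {k : ℕ} {N : Type*} [TopologicalSpace N] [ChartedSpace (EuclideanSpace ℝ (Fin k)) N]
  [IsManifold (𝓡 k) ∞ N]

/-- In finite dimension a linear map is a fixed smooth expression in its values on the standard
basis. -/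
theorem contDiffAt_clm_of_apply {E W : Type*} [NormedAddCommGroup E] [NormedSpace ℝ E]
    [NormedAddCommGroup W] [NormedSpace ℝ W] {r : ℕ∞ω}
    {f : E → EuclideanSpace ℝ (Fin k) →L[ℝ] W} {z : E} (h : ∀ a, ContDiffAt ℝ r (fun y ↦ f y a) z) :
    ContDiffAt ℝ r f z := by
  have h1 : f = fun y ↦ ∑ i, ContinuousLinearMap.smulRightL ℝ (EuclideanSpace ℝ (Fin k)) W
      (EuclideanSpace.proj i) (f y (EuclideanSpace.basisFun (Fin k) ℝ i)) := by
    funext y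
    ext a
    conv_lhs => rw [← (EuclideanSpace.basisFun (Fin k) ℝ).sum_repr a]
    simp [map_sum]
  rw [h1]
  exact ContDiffAt.sum fun i _ ↦ (ContinuousLinearMap.contDiff _).contDiffAt.comp z (h _)

/-- The pullback of a bilinear form under a linear map. -/
def pullbackForm {V : Type*} [AddCommGroup V] [Module ℝ V] [TopologicalSpace V]
    (b : V →L[ℝ] V →L[ℝ] ℝ) (s : EuclideanSpace ℝ (Fin k) →L[ℝ] V) :
    EuclideanSpace ℝ (Fin k) →L[ℝ] EuclideanSpace ℝ (Fin k) →L[ℝ] ℝ :=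
  LinearMap.toContinuousLinearMap
    { toFun u := (b (s u)).comp s
      map_add' u v := by ext1; simp
      map_smul' r u := by ext1; simp }

variable (k N) in
/-- Affine connections. -/
abbrev AffineConnection :=
  CovariantDerivative (𝓡 k) (EuclideanSpace ℝ (Fin k)) (fun x : N ↦ TangentSpace (𝓡 k) x)

theorem AffineConnection.congr (D : AffineConnection k N) {X Y : VField k N} {x : N}
    (hX : X.DiffAt x) (hXY : ∀ᶠ y in 𝓝 x, X y = Y y) : D X x = D Y x := by
  have hY : Y.DiffAt x := by
    refine MDifferentiableAt.congr_of_eventuallyEq hX ?_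
    filter_upwards [hXY] with y hy
    rw [hy]
  exact D.isCovariantDerivativeOnUniv.congr_of_eventuallyEq hX hY Filter.univ_mem hXY

/-- The derivatives of the constant vector fields at `x`. -/
def constFieldDeriv (D : AffineConnection k N) {x₀ x : N} (hx : x ∈ chartDomain k x₀) :
    EuclideanSpace ℝ (Fin k) →ₗ[ℝ] TangentSpace (𝓡 k) x →L[ℝ] TangentSpace (𝓡 k) x where
  toFun a := D (constField x₀ a) x
  map_add' a b := by
    rw [← D.isCovariantDerivativeOnUniv.add (diffAt_constField hx a) (diffAt_constField hx b)]
    congr 1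
    funext y
    simp [constField]
  map_smul' r a := by
    have := D.isCovariantDerivativeOnUniv.smul_const r (diffAt_constField hx a)
    refine Eq.trans ?_ this
    congr 1
    funext y
    simp [constField]

/-- The Christoffel symbols: `christoffel D x₀ z a u` are the components of `∇_u X`, for the vector
field `X` with constant components `a`. -/
def christoffel (D : AffineConnection k N) (x₀ : N) (z : EuclideanSpace ℝ (Fin k)) :
    EuclideanSpace ℝ (Fin k) →L[ℝ] EuclideanSpace ℝ (Fin k) →L[ℝ] EuclideanSpace ℝ (Fin k) :=
  ∑ i, ContinuousLinearMap.smulRightL ℝ _ _ (EuclideanSpace.proj i)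
    ((coordL x₀ ((extChartAt (𝓡 k) x₀).symm z)).comp
      ((D (constField x₀ (EuclideanSpace.basisFun (Fin k) ℝ i)) ((extChartAt (𝓡 k) x₀).symm z)).comp
        (coordS x₀ ((extChartAt (𝓡 k) x₀).symm z))))

/-- `christoffel` is linear in `a` by construction, from the values on the standard basis. Over the
chart domain constant fields are differentiable, so `D` itself is linear in `a` and the two agree.
-/
theorem christoffel_apply_of_mem_target (D : AffineConnection k N) {x₀ : N}
    {z : EuclideanSpace ℝ (Fin k)} (hz : z ∈ (extChartAt (𝓡 k) x₀).target)
    (a u : EuclideanSpace ℝ (Fin k)) :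
    christoffel D x₀ z a u = coordL x₀ ((extChartAt (𝓡 k) x₀).symm z)
      (D (constField x₀ a) ((extChartAt (𝓡 k) x₀).symm z)
        (coordS x₀ ((extChartAt (𝓡 k) x₀).symm z) u)) := by
  have h1 := congrArg (fun q ↦ coordL x₀ ((extChartAt (𝓡 k) x₀).symm z) (constFieldDeriv D
    (chart_symm_mem hz) q (coordS x₀ ((extChartAt (𝓡 k) x₀).symm z) u)))
    ((EuclideanSpace.basisFun (Fin k) ℝ).sum_repr a)
  simp only [map_sum, map_smul, sum_apply, smul_apply] at h1
  refine Eq.trans ?_ h1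
  simp [christoffel, constFieldDeriv]
  rfl

theorem christoffel_apply (D : AffineConnection k N) {x₀ x : N} (hx : x ∈ chartDomain k x₀)
    (a : EuclideanSpace ℝ (Fin k)) (v : TangentSpace (𝓡 k) x) :
    christoffel D x₀ (extChartAt (𝓡 k) x₀ x) a (coordL x₀ x v)
      = coordL x₀ x (D (constField x₀ a) x v) := by
  have hx' : x ∈ (extChartAt (𝓡 k) x₀).source := by simpa using hx
  have h := (extChartAt (𝓡 k) x₀).left_inv hx'
  rw [christoffel_apply_of_mem_target D ((extChartAt (𝓡 k) x₀).map_source hx')]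
  -- Tangent spaces depend on the base point, so the round trip through the chart has to become a
  -- variable before it can be identified with `x`.
  generalize (extChartAt (𝓡 k) x₀).symm (extChartAt (𝓡 k) x₀ x) = y at h
  subst h
  rw [coordS_coordL hx]

theorem contDiffAt_christoffel [T2Space N] (D : AffineConnection k N)
    (hD : CovariantDerivative.ContMDiffCovariantDerivative D ∞) (x₀ : N) :
    ContDiffAt ℝ ∞ (christoffel D x₀) (extChartAt (𝓡 k) x₀ x₀) := by
  have hx := mem_chartDomain_self (k := k) x₀
  refine contDiffAt_clm_of_apply fun a ↦ ?_
  -- Smoothness of `D` is applied to globally smooth fields, whereas `constField` is smooth on the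
  -- chart domain. The cutoff does not change the field near `x₀`, and `D` is local.
  let χ : SmoothBumpFunction (𝓡 k) x₀ := Classical.arbitrary _
  let Y : VField k N := fun x ↦ χ x • constField x₀ a x
  have hcf : ContMDiffOn (𝓡 k) ((𝓡 k).prod 𝓘(ℝ, EuclideanSpace ℝ (Fin k))) ∞
      (fun y ↦ TotalSpace.mk' (EuclideanSpace ℝ (Fin k)) (E := fun z : N ↦ TangentSpace (𝓡 k) z) y
        (constField x₀ a y)) (chartDomain k x₀) := by
    have h1 := (trivializationAt (EuclideanSpace ℝ (Fin k)) (fun x : N ↦ TangentSpace (𝓡 k) x)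
      x₀).contMDiffOn_section_baseSet_iff (IB := 𝓡 k) (n := ∞) (s := constField x₀ a)
    rw [TangentBundle.trivializationAt_baseSet (I := 𝓡 k) x₀] at h1
    refine h1.2 ((contMDiffOn_const (c := a)).congr fun y hy ↦ ?_)
    rw [← coordL_apply hy]
    exact coordL_coordS hy a
  have hY : ContMDiff (𝓡 k) ((𝓡 k).prod 𝓘(ℝ, EuclideanSpace ℝ (Fin k))) ∞
      (fun y ↦ TotalSpace.mk' (EuclideanSpace ℝ (Fin k)) (E := fun z : N ↦ TangentSpace (𝓡 k) z) y
        (Y y)) :=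
    ContMDiffOn.smul_section_of_tsupport χ.contMDiff.contMDiffOn (chartAt _ x₀).open_source
      χ.tsupport_subset_chartAt_source hcf
  have hDY := (hD.contMDiff.contMDiff (σ := Y) hY.contMDiffOn).contMDiffAt (x := x₀) Filter.univ_mem
  have hc := ((contMDiffAt_hom_bundle _).1 hDY).2
  have hc' := contDiffAt_chart hx hc
    (h := fun z ↦ ContinuousLinearMap.inCoordinates (EuclideanSpace ℝ (Fin k))
      (fun x : N ↦ TangentSpace (𝓡 k) x) (EuclideanSpace ℝ (Fin k))
      (fun x : N ↦ TangentSpace (𝓡 k) x) x₀ ((extChartAt (𝓡 k) x₀).symm z) x₀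
      ((extChartAt (𝓡 k) x₀).symm z) (D Y ((extChartAt (𝓡 k) x₀).symm z))) (fun z _ ↦ rfl)
  refine hc'.congr_of_eventuallyEq ?_
  have hχ : ∀ᶠ x in 𝓝 x₀, D Y x = D (constField x₀ a) x := by
    filter_upwards [χ.eventuallyEq_one.eventually_nhds, chartDomain_mem_nhds hx] with x h1 h2
    refine (AffineConnection.congr D (diffAt_constField h2 a) ?_).symm
    filter_upwards [h1] with y hy
    simp [Y, hy]
  have hcont : Filter.Tendsto (extChartAt (𝓡 k) x₀).symm (𝓝 (extChartAt (𝓡 k) x₀ x₀)) (𝓝 x₀) := by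
    have := continuousAt_extChartAt_symm (I := 𝓡 k) x₀
    rwa [ContinuousAt, extChartAt_to_inv] at this
  filter_upwards [hcont.eventually hχ, extChartAt_target_mem_nhds_of_mem hx] with z h1 hz
  rw [h1]
  ext1 u
  exact christoffel_apply_of_mem_target D hz a u

/-- Fields with constant components commute, so vanishing torsion is exactly this symmetry. -/
theorem christoffel_symm (D : AffineConnection k N) (hD : D.torsion = 0) (x₀ : N)
    (a u : EuclideanSpace ℝ (Fin k)) :
    christoffel D x₀ (extChartAt (𝓡 k) x₀ x₀) a u = christoffel D x₀ (extChartAt (𝓡 k) x₀ x₀) u a := by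
  have hx := mem_chartDomain_self (k := k) x₀
  have key : ∀ v w : TangentSpace (𝓡 k) x₀,
      D (constField x₀ (coordL x₀ x₀ v)) x₀ w = D (constField x₀ (coordL x₀ x₀ w)) x₀ v := by
    intro v w
    have hd : ∀ v : TangentSpace (𝓡 k) x₀,
        VField.DiffAt (FiberBundle.extend (EuclideanSpace ℝ (Fin k)) v : VField k N) x₀ :=
      fun v ↦ FiberBundle.mdifferentiableAt_extend ..
    have h1 := D.torsion_eq_zero_iff.1 hD (x := x₀) (hd v) (hd w)
    have h2 : ∀ v : TangentSpace (𝓡 k) x₀, D (FiberBundle.extend (EuclideanSpace ℝ (Fin k)) v) x₀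
        = D (constField x₀ (coordL x₀ x₀ v)) x₀ := fun v ↦ by
      refine AffineConnection.congr D (hd v) ?_
      filter_upwards [chartDomain_mem_nhds hx] with y hy
      exact extend_eventuallyEq v hy
    rw [mlieBracket_extend, h2, h2, sub_eq_zero] at h1
    simpa using h1.symm
  have h3 := congrArg (coordL x₀ x₀) (key (coordS x₀ x₀ a) (coordS x₀ x₀ u))
  rw [coordL_coordS hx, coordL_coordS hx, ← christoffel_apply D hx, ← christoffel_apply D hx,
    coordL_coordS hx, coordL_coordS hx] at h3
  exact h3

namespace StatisticalStructure

variable (S : StatisticalStructure k N)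

/-- The components of the metric. -/
def metricCoord (x₀ : N) (z : EuclideanSpace ℝ (Fin k)) :
    EuclideanSpace ℝ (Fin k) →L[ℝ] EuclideanSpace ℝ (Fin k) →L[ℝ] ℝ :=
  pullbackForm (S.metric.inner ((extChartAt (𝓡 k) x₀).symm z))
    (coordS x₀ ((extChartAt (𝓡 k) x₀).symm z))

theorem metricCoord_eq (x₀ : N) (z a b : EuclideanSpace ℝ (Fin k)) :
    S.metricCoord x₀ z a b = S.metric.inner ((extChartAt (𝓡 k) x₀).symm z)
      (constField x₀ a ((extChartAt (𝓡 k) x₀).symm z))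
      (constField x₀ b ((extChartAt (𝓡 k) x₀).symm z)) := rfl

theorem metricCoord_apply {x₀ x : N} (hx : x ∈ chartDomain k x₀) (u v : TangentSpace (𝓡 k) x) :
    S.metricCoord x₀ (extChartAt (𝓡 k) x₀ x) (coordL x₀ x u) (coordL x₀ x v) = S.g x u v := by
  have hx' : x ∈ (extChartAt (𝓡 k) x₀).source := by simpa using hx
  have h := (extChartAt (𝓡 k) x₀).left_inv hx'
  simp only [metricCoord_eq, constField]
  generalize (extChartAt (𝓡 k) x₀).symm (extChartAt (𝓡 k) x₀ x) = y at h
  subst h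
  rw [coordS_coordL hx, coordS_coordL hx]
  rfl

theorem contDiffAt_metricCoord (x₀ : N) :
    ContDiffAt ℝ ∞ (S.metricCoord x₀) (extChartAt (𝓡 k) x₀ x₀) := by
  have hx := mem_chartDomain_self (k := k) x₀
  refine contDiffAt_clm_of_apply fun a ↦ contDiffAt_clm_of_apply fun b ↦ ?_
  have hcf : ∀ a, ContMDiffAt (𝓡 k) ((𝓡 k).prod 𝓘(ℝ, EuclideanSpace ℝ (Fin k))) ∞
      (fun y ↦ TotalSpace.mk' (EuclideanSpace ℝ (Fin k)) (E := fun z : N ↦ TangentSpace (𝓡 k) z) y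
        (constField x₀ a y)) x₀ := by
    intro a
    rw [contMDiffAt_section]
    refine (contMDiffAt_const (c := a)).congr_of_eventuallyEq ?_
    filter_upwards [chartDomain_mem_nhds hx] with y hy
    rw [← coordL_apply hy]
    exact coordL_coordS hy a
  have h1 : ContMDiffAt (𝓡 k) ((𝓡 k).prod 𝓘(ℝ, ℝ)) ∞
      (fun y ↦ TotalSpace.mk' ℝ (E := Bundle.Trivial N ℝ) y
        (S.metric.inner y (constField x₀ a y) (constField x₀ b y))) x₀ :=
    ContMDiffAt.clm_bundle_apply₂ (F₁ := EuclideanSpace ℝ (Fin k)) (F₂ := EuclideanSpace ℝ (Fin k))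
      (S.metric.contMDiff x₀) (hcf a) (hcf b)
  rw [contMDiffAt_section] at h1
  exact contDiffAt_chart hx h1 fun z _ ↦ rfl

theorem metricCoord_pos {x₀ x : N} (hx : x ∈ chartDomain k x₀) (a : EuclideanSpace ℝ (Fin k))
    (ha : a ≠ 0) : 0 < S.metricCoord x₀ (extChartAt (𝓡 k) x₀ x) a a := by
  have h := S.metricCoord_apply hx (coordS x₀ x a) (coordS x₀ x a)
  rw [coordL_coordS hx] at h
  rw [h]
  refine S.metric.pos x _ fun h0 ↦ ha ?_
  rw [← coordL_coordS hx a, h0, map_zero]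

/-- The duality of the two connections, evaluated on fields with constant components. -/
theorem fderiv_metricCoord (x₀ : N) : ∀ᶠ z in 𝓝 (extChartAt (𝓡 k) x₀ x₀),
    ∀ u a b : EuclideanSpace ℝ (Fin k), fderiv ℝ (S.metricCoord x₀) z u a b
      = S.metricCoord x₀ z (christoffel S.conn x₀ z a u) b
        + S.metricCoord x₀ z a (christoffel S.dual x₀ z b u) := by
  have hx := mem_chartDomain_self (k := k) x₀
  have hd := ((S.contDiffAt_metricCoord x₀).of_le (m := 1) (by exact_mod_cast le_top)).eventually
    (by simp)
  filter_upwards [hd, extChartAt_target_mem_nhds_of_mem hx] with z hdz hz u a b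
  have hdz := hdz.differentiableAt (by simp)
  have hy := chart_symm_mem hz
  set y := (extChartAt (𝓡 k) x₀).symm z with hydef
  have hzy : extChartAt (𝓡 k) x₀ y = z := (extChartAt (𝓡 k) x₀).right_inv hz
  rw [← hzy] at hdz ⊢
  have h1 := S.duality y (constField x₀ a) (constField x₀ b) (diffAt_constField hy a)
    (diffAt_constField hy b) (coordS x₀ y u)
  have h2 := ((hdz.hasLineDerivAt_fderiv u).clm_apply_const a).clm_apply_const b
  have h3 := mvfderiv_of_chart hy (c := fun y ↦ S.metric.inner y (constField x₀ a y)
    (constField x₀ b y)) (h := fun z ↦ S.metricCoord x₀ z a b) (by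
      filter_upwards [chartDomain_mem_nhds hy] with y' hy'
      have := S.metricCoord_apply hy' (constField x₀ a y') (constField x₀ b y')
      rw [constField, constField, coordL_coordS hy', coordL_coordS hy'] at this
      exact this.symm) (by fun_prop) (coordS x₀ y u)
  rw [coordL_coordS hy, h2.fderiv_apply (by fun_prop)] at h3
  rw [← h3, h1]
  have h4 := S.metricCoord_apply hy (S.conn (constField x₀ a) y (coordS x₀ y u)) (coordS x₀ y b)
  have h5 := S.metricCoord_apply hy (coordS x₀ y a) (S.dual (constField x₀ b) y (coordS x₀ y u))
  rw [← christoffel_apply _ hy, coordL_coordS hy, coordL_coordS hy] at h4 h5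
  rw [h4, h5]
  rfl

end StatisticalStructure

end ConnectionCoordinates

/-! ### Maps and derivatives along maps in coordinates -/

section MapCoordinates

set_option maxSynthPendingDepth 3

variable {k n : ℕ} {N : Type*} [TopologicalSpace N] [ChartedSpace (EuclideanSpace ℝ (Fin k)) N]
  {M : Type*} [TopologicalSpace M] [ChartedSpace (EuclideanSpace ℝ (Fin n)) M]

variable (k n) in
/-- The map `f` in the preferred charts at `p` and `f p`. -/
def mapCoord (f : M → N) (p : M) (z : EuclideanSpace ℝ (Fin n)) : EuclideanSpace ℝ (Fin k) :=
  extChartAt (𝓡 k) (f p) (f ((extChartAt (𝓡 n) p).symm z))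

theorem mapCoord_chart (f : M → N) {p q : M} (hq : q ∈ chartDomain n p) :
    mapCoord k n f p (extChartAt (𝓡 n) p q) = extChartAt (𝓡 k) (f p) (f q) := by
  rw [mapCoord, (eventually_chart_symm hq).self_of_nhds]

variable [IsManifold (𝓡 k) ∞ N] [IsManifold (𝓡 n) ∞ M]

theorem contDiffAt_mapCoord {f : M → N} (hf : ContMDiff (𝓡 n) (𝓡 k) ∞ f) {p q : M}
    (hq : q ∈ chartDomain n p) (hfq : f q ∈ chartDomain k (f p)) :
    ContDiffAt ℝ ∞ (mapCoord k n f p) (extChartAt (𝓡 n) p q) := by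
  have h1 : ContMDiffAt (𝓡 k) 𝓘(ℝ, EuclideanSpace ℝ (Fin k)) ∞ (extChartAt (𝓡 k) (f p)) (f q) :=
    contMDiffAt_extChartAt' hfq
  exact contDiffAt_chart hq (h1.comp q (hf q)) fun z _ ↦ rfl

theorem coordL_mfderiv {f : M → N} (hf : ContMDiff (𝓡 n) (𝓡 k) ∞ f) {p q : M}
    (hq : q ∈ chartDomain n p) (hfq : f q ∈ chartDomain k (f p)) (v : TangentSpace (𝓡 n) q) :
    coordL (f p) (f q) (mfderiv (𝓡 n) (𝓡 k) f q v)
      = fderiv ℝ (mapCoord k n f p) (extChartAt (𝓡 n) p q) (coordL p q v) := by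
  have h1 := mvfderiv_of_chart hq (c := fun q ↦ extChartAt (𝓡 k) (f p) (f q))
    (h := mapCoord k n f p) (by
      filter_upwards [chartDomain_mem_nhds hq] with q' hq'
      exact (mapCoord_chart f hq').symm)
    ((contDiffAt_mapCoord hf hq hfq).differentiableAt (by simp)) v
  rw [← h1, coordL_eq_mfderiv hfq]
  exact (mfderiv_comp_apply q (mdifferentiableAt_extChartAt' hfq)
    ((hf q).mdifferentiableAt (by simp)) v).symm

set_option maxHeartbeats 1000000 in
/-- The derivative of a vector field along `f`, in the preferred charts at `p` and `f p`. -/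
theorem coordL_alongDeriv (D : AffineConnection k N) {f : M → N}
    (hf : ContMDiff (𝓡 n) (𝓡 k) ∞ f) {p q : M} (hq : q ∈ chartDomain n p)
    (hfq : f q ∈ chartDomain k (f p)) (V : Π q : M, TangentSpace (𝓡 k) (f q))
    {C : EuclideanSpace ℝ (Fin n) → EuclideanSpace ℝ (Fin k)}
    (hC : DifferentiableAt ℝ C (extChartAt (𝓡 n) p q))
    (hV : ∀ᶠ q' in 𝓝 q, coordL (f p) (f q') (V q') = C (extChartAt (𝓡 n) p q'))
    (v : TangentSpace (𝓡 n) q) :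
    coordL (f p) (f q) (alongDeriv (fun Z x w ↦ D Z x w) f V q v)
      = coordAlong (christoffel D (f p)) (mapCoord k n f p) C (extChartAt (𝓡 n) p q)
          (coordL p q v) := by
  let e₀ := trivializationAt (EuclideanSpace ℝ (Fin k)) (fun x : N ↦ TangentSpace (𝓡 k) x) (f p)
  let e₁ := trivializationAt (EuclideanSpace ℝ (Fin k)) (fun x : N ↦ TangentSpace (𝓡 k) x) (f q)
  have h0 : f q ∈ e₀.baseSet := mem_baseSet hfq
  have h1 : f q ∈ e₁.baseSet := mem_baseSet (mem_chartDomain_self (f q))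
  have hcont : Filter.Tendsto f (𝓝 q) (𝓝 (f q)) := hf.continuous.continuousAt
  have hev0 : ∀ᶠ q' in 𝓝 q, f q' ∈ chartDomain k (f p) :=
    hcont.eventually (chartDomain_mem_nhds hfq)
  have hev1 : ∀ᶠ q' in 𝓝 q, f q' ∈ chartDomain k (f q) :=
    hcont.eventually (chartDomain_mem_nhds (mem_chartDomain_self (f q)))
  let τ : N → EuclideanSpace ℝ (Fin k) →L[ℝ] EuclideanSpace ℝ (Fin k) :=
    fun y ↦ e₀.coordChangeL ℝ e₁ y
  let T : EuclideanSpace ℝ (Fin n) → EuclideanSpace ℝ (Fin k) →L[ℝ] EuclideanSpace ℝ (Fin k) :=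
    fun z ↦ τ (f ((extChartAt (𝓡 n) p).symm z))
  have hT : DifferentiableAt ℝ T (extChartAt (𝓡 n) p q) := by
    have h2 : ContMDiffAt (𝓡 k) 𝓘(ℝ, EuclideanSpace ℝ (Fin k) →L[ℝ] EuclideanSpace ℝ (Fin k)) ∞
      τ (f q) := contMDiffAt_coordChangeL h0 h1
    exact (contDiffAt_chart hq (h2.comp q (hf q)) fun z _ ↦ rfl).differentiableAt (by simp)
  have hTq : ∀ q' ∈ chartDomain n p, T (extChartAt (𝓡 n) p q') = τ (f q') := by
    intro q' hq'
    simp only [T, (eventually_chart_symm hq').self_of_nhds]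
  have hτ : ∀ y ∈ chartDomain k (f p), y ∈ chartDomain k (f q) → ∀ w : TangentSpace (𝓡 k) y,
      τ y (coordL (f p) y w) = (e₁ ⟨y, w⟩).2 := by
    intro y hy hy' w
    have h2 := e₀.coordChangeL_apply e₁ (R := ℝ) ⟨mem_baseSet hy, mem_baseSet hy'⟩
      (coordL (f p) y w)
    have h3 : e₀.symm y (coordL (f p) y w) = w :=
      (Trivialization.symmL_apply (R := ℝ) e₀ (mem_baseSet hy) _).symm.trans (coordS_coordL hy w)
    rw [h3] at h2
    exact h2
  have hCq : C (extChartAt (𝓡 n) p q) = coordL (f p) (f q) (V q) := hV.self_of_nhds.symm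
  -- `alongDeriv` at `q` uses the chart at `f q`, not at `f p`. Comparing `V` with a constant field
  -- that agrees with it at `q` cancels the derivative of the transition map `T`, and
  -- `alongDeriv_comp` evaluates the constant field.
  let Y : VField k N := constField (f p) (C (extChartAt (𝓡 n) p q))
  have hYq : Y (f q) = V q := by
    simp only [Y, constField]
    rw [hCq, coordS_coordL hfq]
  have hd1 : mvfderiv (𝓡 n) (fun q' ↦ (e₁ ⟨f q', V q'⟩).2) q v
      = fderiv ℝ T (extChartAt (𝓡 n) p q) (coordL p q v) (C (extChartAt (𝓡 n) p q))
        + T (extChartAt (𝓡 n) p q) (fderiv ℝ C (extChartAt (𝓡 n) p q) (coordL p q v)) := by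
    rw [mvfderiv_of_chart hq (h := fun z ↦ T z (C z)) _ (hT.clm_apply hC) v]
    · exact ((hT.hasLineDerivAt_fderiv _).clm_apply (hC.hasLineDerivAt_fderiv _)).fderiv_apply
        (hT.clm_apply hC)
    · filter_upwards [hev0, hev1, hV, chartDomain_mem_nhds hq] with q' a1 a2 a3 a4
      rw [hTq q' a4, ← a3, hτ _ a1 a2]
  have hd2 : mvfderiv (𝓡 n) (fun q' ↦ (e₁ ⟨f q', Y (f q')⟩).2) q v
      = fderiv ℝ T (extChartAt (𝓡 n) p q) (coordL p q v) (C (extChartAt (𝓡 n) p q)) := by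
    rw [mvfderiv_of_chart hq (h := fun z ↦ T z (C (extChartAt (𝓡 n) p q))) _
      (hT.clm_apply (differentiableAt_const _)) v]
    · exact ((hT.hasLineDerivAt_fderiv _).clm_apply_const _).fderiv_apply
        (hT.clm_apply (differentiableAt_const _))
    · filter_upwards [hev0, hev1, chartDomain_mem_nhds hq] with q' a1 a2 a4
      rw [hTq q' a4, ← hτ _ a1 a2]
      simp only [Y, constField]
      rw [coordL_coordS a1]
  have hcomp := alongDeriv_comp D f q ((hf q).mdifferentiableAt (by simp)) Y
    (diffAt_constField hfq _) v
  have hsymm : e₁.symmL ℝ (f q) (T (extChartAt (𝓡 n) p q)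
      (fderiv ℝ C (extChartAt (𝓡 n) p q) (coordL p q v)))
      = coordS (f p) (f q) (fderiv ℝ C (extChartAt (𝓡 n) p q) (coordL p q v)) := by
    set a := fderiv ℝ C (extChartAt (𝓡 n) p q) (coordL p q v)
    have h4 := hτ (f q) hfq (mem_chartDomain_self _) (coordS (f p) (f q) a)
    rw [coordL_coordS hfq, ← coordL_apply (mem_chartDomain_self (f q))] at h4
    rw [hTq q hq, h4]
    exact coordS_coordL (mem_chartDomain_self (f q)) _
  have hmain : alongDeriv (fun Z x w ↦ D Z x w) f V q v
      = D Y (f q) (mfderiv (𝓡 n) (𝓡 k) f q v)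
        + coordS (f p) (f q) (fderiv ℝ C (extChartAt (𝓡 n) p q) (coordL p q v)) := by
    rw [← hcomp, ← hsymm]
    have e1 : alongDeriv (fun Z x w ↦ D Z x w) f V q v
        = e₁.symmL ℝ (f q) (mvfderiv (𝓡 n) (fun q' ↦ (e₁ ⟨f q', V q'⟩).2) q v)
          + D (FiberBundle.extend (EuclideanSpace ℝ (Fin k)) (V q)) (f q)
            (mfderiv (𝓡 n) (𝓡 k) f q v) := rfl
    have e2 : alongDeriv (fun Z x w ↦ D Z x w) f (fun q ↦ Y (f q)) q v
        = e₁.symmL ℝ (f q) (mvfderiv (𝓡 n) (fun q' ↦ (e₁ ⟨f q', Y (f q')⟩).2) q v)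
          + D (FiberBundle.extend (EuclideanSpace ℝ (Fin k)) (Y (f q))) (f q)
            (mfderiv (𝓡 n) (𝓡 k) f q v) := rfl
    rw [e1, e2, hd1, hd2, hYq, map_add]
    abel
  rw [hmain, map_add, coordL_coordS hfq, ← christoffel_apply D hfq, coordL_mfderiv hf hq hfq,
    coordAlong, mapCoord_chart f hq, add_comm]

/-- The derivative of a vector field in coordinates. -/
theorem coordL_conn (D : AffineConnection k N) {x₀ x : N} (hx : x ∈ chartDomain k x₀)
    (Y : VField k N) {C : EuclideanSpace ℝ (Fin k) → EuclideanSpace ℝ (Fin k)}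
    (hC : DifferentiableAt ℝ C (extChartAt (𝓡 k) x₀ x))
    (hY : ∀ᶠ y in 𝓝 x, coordL x₀ y (Y y) = C (extChartAt (𝓡 k) x₀ y))
    (v : TangentSpace (𝓡 k) x) :
    coordL x₀ x (D Y x v) = fderiv ℝ C (extChartAt (𝓡 k) x₀ x) (coordL x₀ x v)
      + christoffel D x₀ (extChartAt (𝓡 k) x₀ x) (C (extChartAt (𝓡 k) x₀ x)) (coordL x₀ x v) := by
  have hd : Y.DiffAt x := (diffAt_iff_coordL hx Y).2 (mdifferentiableAt_of_chart hx hY hC)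
  -- A vector field on `N` is a field along the identity, so the formula along maps specializes.
  have h1 := alongDeriv_comp D (id : N → N) x mdifferentiableAt_id Y hd v
  rw [mfderiv_id] at h1
  have h2 := coordL_alongDeriv D (f := (id : N → N)) contMDiff_id (p := x₀) hx hx Y hC hY v
  have h3 : (D Y x v) = alongDeriv (fun Z x w ↦ D Z x w) (id : N → N) Y x v := h1.symm
  have hid : mapCoord k k (id : N → N) x₀ =ᶠ[𝓝 (extChartAt (𝓡 k) x₀ x)] id := by
    filter_upwards [extChartAt_target_mem_nhds_of_mem hx] with z hz
    exact (extChartAt (𝓡 k) x₀).right_inv hz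
  rw [h3]
  refine h2.trans ?_
  rw [coordAlong, hid.fderiv_eq, hid.self_of_nhds]
  simp

/-- The curvature in coordinates. -/
theorem coordL_curvature (D : AffineConnection k N) {x : N}
    (hD : DifferentiableAt ℝ (christoffel D x) (extChartAt (𝓡 k) x x))
    (u v w : TangentSpace (𝓡 k) x) :
    coordL x x (ConnOp.curvature (fun Z x w ↦ D Z x w) x u v w)
      = coordCurvature (christoffel D x) (extChartAt (𝓡 k) x x) (coordL x x u) (coordL x x v)
          (coordL x x w) := by
  have hx := mem_chartDomain_self (k := k) x
  let E (u : TangentSpace (𝓡 k) x) : VField k N := FiberBundle.extend (EuclideanSpace ℝ (Fin k)) u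
  have hEx : ∀ u, E u x = u := fun u ↦ by simp [E]
  have hE : ∀ u, ∀ y ∈ chartDomain k x, coordL x y (E u y) = coordL x x u := by
    intro u y hy
    simp only [E]
    rw [extend_eventuallyEq u hy]
    exact coordL_coordS hy _
  have hDE : ∀ w v : TangentSpace (𝓡 k) x, ∀ y ∈ chartDomain k x,
      coordL x y (D (E w) y (E v y))
        = christoffel D x (extChartAt (𝓡 k) x y) (coordL x x w) (coordL x x v) := by
    intro w v y hy
    rw [coordL_conn D hy (E w) (C := fun _ ↦ coordL x x w) (differentiableAt_const _)
      (by filter_upwards [chartDomain_mem_nhds hy] with y' hy'; exact hE w y' hy'), hE v y hy]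
    simp
  have key : ∀ w v u : TangentSpace (𝓡 k) x,
      coordL x x (D (fun y ↦ D (E w) y (E v y)) x (E u x))
        = fderiv ℝ (christoffel D x) (extChartAt (𝓡 k) x x) (coordL x x u) (coordL x x w)
            (coordL x x v)
          + christoffel D x (extChartAt (𝓡 k) x x) (christoffel D x (extChartAt (𝓡 k) x x)
            (coordL x x w) (coordL x x v)) (coordL x x u) := by
    intro w v u
    rw [hEx u, coordL_conn D hx (fun y ↦ D (E w) y (E v y))
      (C := fun z ↦ christoffel D x z (coordL x x w) (coordL x x v)) (by fun_prop)
      (by filter_upwards [chartDomain_mem_nhds hx] with y' hy'; exact hDE w v y' hy')]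
    rw [(((hD.hasLineDerivAt_fderiv _).clm_apply_const _).clm_apply_const _).fderiv_apply
      (by fun_prop)]
  have hb : VectorField.mlieBracket (𝓡 k) (E u) (E v) x = 0 := mlieBracket_extend u v
  have hcurv : ConnOp.curvature (fun Z x w ↦ D Z x w) x u v w
      = D (fun y ↦ D (E w) y (E v y)) x (E u x) - D (fun y ↦ D (E w) y (E u y)) x (E v x)
        - D (E w) x (VectorField.mlieBracket (𝓡 k) (E u) (E v) x) := rfl
  rw [hcurv, hb, map_zero, sub_zero, map_sub, key, key, coordCurvature]
  abel

end MapCoordinates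

/-! ### The induced connection and the Gauss equation -/

section Gauss

set_option maxSynthPendingDepth 3
set_option linter.unusedSectionVars false

variable {k n : ℕ} {N : Type*} [TopologicalSpace N] [ChartedSpace (EuclideanSpace ℝ (Fin k)) N]
  [IsManifold (𝓡 k) ∞ N]
  {M : Type*} [TopologicalSpace M] [ChartedSpace (EuclideanSpace ℝ (Fin n)) M]
  [IsManifold (𝓡 n) ∞ M]

theorem natCast_le_smooth (r : ℕ) : ((r : ℕ∞) : ℕ∞ω) ≤ ∞ := by
  exact_mod_cast (le_top : (r : ℕ∞) ≤ ⊤)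

namespace StatisticalStructure

variable (S : StatisticalStructure k N)

theorem g_comm (x : N) (u v : TangentSpace (𝓡 k) x) : S.g x u v = S.g x v u := S.metric.symm x u v

theorem g_add_left (x : N) (u v w : TangentSpace (𝓡 k) x) :
    S.g x (u + v) w = S.g x u w + S.g x v w := by simp [g]

theorem g_sub_left (x : N) (u v w : TangentSpace (𝓡 k) x) :
    S.g x (u - v) w = S.g x u w - S.g x v w := by simp [g]

theorem g_sub_right (x : N) (u v w : TangentSpace (𝓡 k) x) :
    S.g x u (v - w) = S.g x u v - S.g x u w := by simp [g]

theorem g_smul_left (x : N) (r : ℝ) (u v : TangentSpace (𝓡 k) x) :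
    S.g x (r • u) v = r * S.g x u v := by simp [g]

end StatisticalStructure

variable (S : StatisticalStructure k N) {f : M → N} {p : M}

theorem tangentPart_spec (hf : Function.Injective (mfderiv (𝓡 n) (𝓡 k) f p))
    (w : TangentSpace (𝓡 k) (f p)) (z : TangentSpace (𝓡 n) p) :
    S.g (f p) (w - mfderiv (𝓡 n) (𝓡 k) f p (tangentPart S f p w)) (mfderiv (𝓡 n) (𝓡 k) f p z)
      = 0 := by
  have h := (existsUnique_tangentPart S f p hf w).exists
  have h1 : tangentPart S f p w = h.choose := dif_pos h
  rw [h1]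
  exact h.choose_spec z

theorem tangentPart_eq (hf : Function.Injective (mfderiv (𝓡 n) (𝓡 k) f p))
    {w : TangentSpace (𝓡 k) (f p)} {u : TangentSpace (𝓡 n) p}
    (h : ∀ z : TangentSpace (𝓡 n) p,
      S.g (f p) (w - mfderiv (𝓡 n) (𝓡 k) f p u) (mfderiv (𝓡 n) (𝓡 k) f p z) = 0) :
    tangentPart S f p w = u :=
  (existsUnique_tangentPart S f p hf w).unique (tangentPart_spec S hf w) h

theorem tangentPart_add (hf : Function.Injective (mfderiv (𝓡 n) (𝓡 k) f p))
    (v w : TangentSpace (𝓡 k) (f p)) :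
    (tangentPart S f p (v + w) : TangentSpace (𝓡 n) p)
      = tangentPart S f p v + tangentPart S f p w := by
  refine tangentPart_eq S hf fun z ↦ ?_
  have h1 := tangentPart_spec S hf v z
  have h2 := tangentPart_spec S hf w z
  rw [map_add, add_sub_add_comm, S.g_add_left, h1, h2, add_zero]

theorem tangentPart_smul (hf : Function.Injective (mfderiv (𝓡 n) (𝓡 k) f p)) (r : ℝ)
    (w : TangentSpace (𝓡 k) (f p)) :
    (tangentPart S f p (r • w) : TangentSpace (𝓡 n) p) = r • tangentPart S f p w := by
  refine tangentPart_eq S hf fun z ↦ ?_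
  rw [map_smul, ← smul_sub, S.g_smul_left, tangentPart_spec S hf w z, mul_zero]

theorem inducedMetric_tangentPart (hf : Function.Injective (mfderiv (𝓡 n) (𝓡 k) f p))
    (w : TangentSpace (𝓡 k) (f p)) (z : TangentSpace (𝓡 n) p) :
    inducedMetric S f p (tangentPart S f p w) z = S.g (f p) w (mfderiv (𝓡 n) (𝓡 k) f p z) := by
  have := tangentPart_spec S hf w z
  rw [S.g_sub_left] at this
  rw [inducedMetric]
  linarith

theorem g_secondFundForm_tangent (hf : Function.Injective (mfderiv (𝓡 n) (𝓡 k) f p))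
    (D : ConnOp k N) (v w z : TangentSpace (𝓡 n) p) :
    S.g (f p) (secondFundForm S D f p v w) (mfderiv (𝓡 n) (𝓡 k) f p z) = 0 :=
  tangentPart_spec S hf _ z

/-- The image under `df` of the vector field on `M` that extends `w` with constant components. -/
def pushExtend (k : ℕ) {n : ℕ} {N : Type*} [TopologicalSpace N]
    [ChartedSpace (EuclideanSpace ℝ (Fin k)) N] [IsManifold (𝓡 k) ∞ N]
    {M : Type*} [TopologicalSpace M] [ChartedSpace (EuclideanSpace ℝ (Fin n)) M]
    [IsManifold (𝓡 n) ∞ M] (f : M → N) {p : M} (w : TangentSpace (𝓡 n) p) (q : M) :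
    TangentSpace (𝓡 k) (f q) :=
  mfderiv (𝓡 n) (𝓡 k) f q (FiberBundle.extend (EuclideanSpace ℝ (Fin n)) w q)

theorem secondFundForm_eq (D : ConnOp k N) (v w : TangentSpace (𝓡 n) p) :
    secondFundForm S D f p v w = alongDeriv D f (pushExtend k f w) p v
      - mfderiv (𝓡 n) (𝓡 k) f p (tangentPart S f p (alongDeriv D f (pushExtend k f w) p v)) := rfl

theorem coordL_extend (w : TangentSpace (𝓡 n) p) {q : M} (hq : q ∈ chartDomain n p) :
    coordL p q (FiberBundle.extend (EuclideanSpace ℝ (Fin n)) w q) = coordL p p w := by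
  rw [extend_eventuallyEq w hq]
  exact coordL_coordS hq _

theorem coordL_pushExtend (hf : ContMDiff (𝓡 n) (𝓡 k) ∞ f) (w : TangentSpace (𝓡 n) p) {q : M}
    (hq : q ∈ chartDomain n p) (hfq : f q ∈ chartDomain k (f p)) :
    coordL (f p) (f q) (pushExtend k f w q)
      = fderiv ℝ (mapCoord k n f p) (extChartAt (𝓡 n) p q) (coordL p p w) := by
  rw [pushExtend, coordL_mfderiv hf hq hfq, coordL_extend w hq]

theorem eventually_mem_chartDomains (hf : Continuous f) {q : M} (hq : q ∈ chartDomain n p)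
    (hfq : f q ∈ chartDomain k (f p)) :
    ∀ᶠ q' in 𝓝 q, q' ∈ chartDomain n p ∧ f q' ∈ chartDomain k (f p) :=
  Filter.Eventually.and (chartDomain_mem_nhds hq)
    (hf.continuousAt.eventually (chartDomain_mem_nhds hfq))

theorem differentiableAt_fderiv_mapCoord (hf : ContMDiff (𝓡 n) (𝓡 k) ∞ f) {q : M}
    (hq : q ∈ chartDomain n p) (hfq : f q ∈ chartDomain k (f p)) :
    DifferentiableAt ℝ (fderiv ℝ (mapCoord k n f p)) (extChartAt (𝓡 n) p q) :=
  ((contDiffAt_mapCoord hf hq hfq).fderiv_right (m := 1) (natCast_le_smooth _)).differentiableAt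
    (by simp)

theorem coordL_alongDeriv_pushExtend (D : AffineConnection k N) (hf : ContMDiff (𝓡 n) (𝓡 k) ∞ f)
    (w : TangentSpace (𝓡 n) p) {q : M} (hq : q ∈ chartDomain n p)
    (hfq : f q ∈ chartDomain k (f p)) (v : TangentSpace (𝓡 n) q) :
    coordL (f p) (f q) (alongDeriv (fun Z x w ↦ D Z x w) f (pushExtend k f w) q v)
      = coordAlong (christoffel D (f p)) (mapCoord k n f p)
          (fun z ↦ fderiv ℝ (mapCoord k n f p) z (coordL p p w)) (extChartAt (𝓡 n) p q)
          (coordL p q v) := by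
  have h := differentiableAt_fderiv_mapCoord hf hq hfq
  refine coordL_alongDeriv D hf hq hfq _ (by fun_prop) ?_ v
  filter_upwards [eventually_mem_chartDomains hf.continuous hq hfq] with q' hq'
  exact coordL_pushExtend hf w hq'.1 hq'.2

/-- The metric at `f q` in coordinates. -/
theorem metricCoord_mapCoord {q : M} (hq : q ∈ chartDomain n p)
    (hfq : f q ∈ chartDomain k (f p)) (u v : TangentSpace (𝓡 k) (f q)) :
    S.metricCoord (f p) (mapCoord k n f p (extChartAt (𝓡 n) p q)) (coordL (f p) (f q) u)
      (coordL (f p) (f q) v) = S.g (f q) u v := by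
  rw [mapCoord_chart f hq, S.metricCoord_apply hfq]

/-- In coordinates the derivative is `D²F(v, w) + Γ(dF w, dF v)`. The first term is symmetric
because `F` is smooth, the second because `D` is torsion-free. -/
theorem alongDeriv_pushExtend_symm (D : AffineConnection k N) (hD : D.torsion = 0)
    (hf : ContMDiff (𝓡 n) (𝓡 k) ∞ f) (v w : TangentSpace (𝓡 n) p) :
    alongDeriv (fun Z x w ↦ D Z x w) f (pushExtend k f w) p v
      = alongDeriv (fun Z x w ↦ D Z x w) f (pushExtend k f v) p w := by
  have hp := mem_chartDomain_self (k := n) p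
  have hfp := mem_chartDomain_self (k := k) (f p)
  have h2 : ContDiffAt ℝ 2 (mapCoord k n f p) (extChartAt (𝓡 n) p p) :=
    (contDiffAt_mapCoord hf hp hfp).of_le (natCast_le_smooth _)
  refine coordL_injective hfp ?_
  rw [coordL_alongDeriv_pushExtend D hf w hp hfp, coordL_alongDeriv_pushExtend D hf v hp hfp,
    coordAlong_fderiv h2, coordAlong_fderiv h2, h2.fderiv_fderiv_comm, mapCoord_chart f hp,
    christoffel_symm D hD]

theorem secondFundForm_symm (D : AffineConnection k N) (hD : D.torsion = 0)
    (hf : ContMDiff (𝓡 n) (𝓡 k) ∞ f) (v w : TangentSpace (𝓡 n) p) :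
    secondFundForm S (fun Z x w ↦ D Z x w) f p v w
      = secondFundForm S (fun Z x w ↦ D Z x w) f p w v := by
  rw [secondFundForm_eq, secondFundForm_eq, alongDeriv_pushExtend_symm D hD hf]

theorem alongDeriv_add_dir (D : AffineConnection k N) (V : Π q : M, TangentSpace (𝓡 k) (f q))
    (u v : TangentSpace (𝓡 n) p) :
    alongDeriv (fun Z x w ↦ D Z x w) f V p (u + v)
      = alongDeriv (fun Z x w ↦ D Z x w) f V p u + alongDeriv (fun Z x w ↦ D Z x w) f V p v := by
  simp only [alongDeriv, map_add]
  abel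

theorem alongDeriv_smul_dir (D : AffineConnection k N) (V : Π q : M, TangentSpace (𝓡 k) (f q))
    (r : ℝ) (v : TangentSpace (𝓡 n) p) :
    alongDeriv (fun Z x w ↦ D Z x w) f V p (r • v)
      = r • alongDeriv (fun Z x w ↦ D Z x w) f V p v := by
  simp only [alongDeriv, map_smul, smul_add]

theorem secondFundForm_add_left (D : AffineConnection k N)
    (hf : Function.Injective (mfderiv (𝓡 n) (𝓡 k) f p)) (u v w : TangentSpace (𝓡 n) p) :
    secondFundForm S (fun Z x w ↦ D Z x w) f p (u + v) w
      = secondFundForm S (fun Z x w ↦ D Z x w) f p u w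
        + secondFundForm S (fun Z x w ↦ D Z x w) f p v w := by
  simp only [secondFundForm_eq]
  rw [alongDeriv_add_dir, tangentPart_add S hf, map_add]
  abel

theorem secondFundForm_smul_left (D : AffineConnection k N)
    (hf : Function.Injective (mfderiv (𝓡 n) (𝓡 k) f p)) (r : ℝ) (v w : TangentSpace (𝓡 n) p) :
    secondFundForm S (fun Z x w ↦ D Z x w) f p (r • v) w
      = r • secondFundForm S (fun Z x w ↦ D Z x w) f p v w := by
  simp only [secondFundForm_eq]
  rw [alongDeriv_smul_dir, tangentPart_smul S hf, map_smul, smul_sub]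

/-- The second fundamental form as a bilinear map. -/
def secondFundFormLin (D : AffineConnection k N) (hD : D.torsion = 0)
    (hf : ContMDiff (𝓡 n) (𝓡 k) ∞ f) (hi : Function.Injective (mfderiv (𝓡 n) (𝓡 k) f p)) :
    TangentSpace (𝓡 n) p →ₗ[ℝ] TangentSpace (𝓡 n) p →ₗ[ℝ] TangentSpace (𝓡 k) (f p) :=
  LinearMap.mk₂ ℝ (secondFundForm S (fun Z x w ↦ D Z x w) f p)
    (secondFundForm_add_left S D hi) (secondFundForm_smul_left S D hi)
    -- Linearity in the direction is immediate from the definition; linearity in the extended vector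
    -- is inherited from it by symmetry.
    (fun u v w ↦ by
      rw [secondFundForm_symm S D hD hf u, secondFundForm_add_left S D hi,
        secondFundForm_symm S D hD hf v, secondFundForm_symm S D hD hf w])
    (fun r u v ↦ by
      rw [secondFundForm_symm S D hD hf u, secondFundForm_smul_left S D hi,
        secondFundForm_symm S D hD hf v])

/-- The curvature of the induced connection, in terms of derivatives along `f`. -/
theorem inducedMetric_curvature (hi : ∀ q, Function.Injective (mfderiv (𝓡 n) (𝓡 k) f q))
    (D : AffineConnection k N) (u v w t : TangentSpace (𝓡 n) p) :
    let Dop : ConnOp k N := fun Z x w ↦ D Z x w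
    let B : TangentSpace (𝓡 n) p → TangentSpace (𝓡 n) p → VField n M := fun v w q ↦
      tangentPart S f q (alongDeriv Dop f (pushExtend k f w) q
        (FiberBundle.extend (EuclideanSpace ℝ (Fin n)) v q))
    inducedMetric S f p ((inducedConn S Dop f).curvature p u v w) t
      = S.g (f p) (alongDeriv Dop f (fun q ↦ mfderiv (𝓡 n) (𝓡 k) f q (B v w q)) p u)
          (mfderiv (𝓡 n) (𝓡 k) f p t)
        - S.g (f p) (alongDeriv Dop f (fun q ↦ mfderiv (𝓡 n) (𝓡 k) f q (B u w q)) p v)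
          (mfderiv (𝓡 n) (𝓡 k) f p t) := by
  intro Dop B
  have hcurv : (inducedConn S Dop f).curvature p u v w
      = tangentPart S f p (alongDeriv Dop f (fun q ↦ mfderiv (𝓡 n) (𝓡 k) f q (B v w q)) p
          (FiberBundle.extend (EuclideanSpace ℝ (Fin n)) u p))
        - tangentPart S f p (alongDeriv Dop f (fun q ↦ mfderiv (𝓡 n) (𝓡 k) f q (B u w q)) p
          (FiberBundle.extend (EuclideanSpace ℝ (Fin n)) v p))
        - tangentPart S f p (alongDeriv Dop f (pushExtend k f w) p
            (VectorField.mlieBracket (𝓡 n) (FiberBundle.extend (EuclideanSpace ℝ (Fin n)) u)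
              (FiberBundle.extend (EuclideanSpace ℝ (Fin n)) v) p)) := rfl
  have h0 : alongDeriv Dop f (pushExtend k f w) p (0 : TangentSpace (𝓡 n) p) = 0 := by
    have := alongDeriv_smul_dir D (pushExtend k f w) 0 (0 : TangentSpace (𝓡 n) p)
    rwa [zero_smul, zero_smul] at this
  have h00 : (tangentPart S f p 0 : TangentSpace (𝓡 n) p) = 0 := by
    have := tangentPart_smul S (hi p) 0 0
    rwa [zero_smul, zero_smul] at this
  have hsub : ∀ a b : TangentSpace (𝓡 n) p,
      inducedMetric S f p (a - b) t = inducedMetric S f p a t - inducedMetric S f p b t := by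
    intro a b
    simp only [inducedMetric, map_sub, S.g_sub_left]
  rw [hcurv, mlieBracket_extend, h0, h00, sub_zero, hsub, inducedMetric_tangentPart S (hi p),
    inducedMetric_tangentPart S (hi p), FiberBundle.extend_apply_self,
    FiberBundle.extend_apply_self]

set_option maxHeartbeats 1000000 in
-- Half of the Gauss equation, with the first summand left in coordinates. Replacing `∇_v W` by its
-- tangent part costs the derivative of `σ(v, w)`, which paired with `df t` gives `-g(σ(v, w), σ*(u,
-- t))` by duality.
theorem g_alongDeriv_tangentPart [T2Space N] (hf : ContMDiff (𝓡 n) (𝓡 k) ∞ f)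
    (hi : ∀ q, Function.Injective (mfderiv (𝓡 n) (𝓡 k) f q)) (u v w t : TangentSpace (𝓡 n) p) :
    S.g (f p) (alongDeriv S.nabla f (fun q ↦ mfderiv (𝓡 n) (𝓡 k) f q (tangentPart S f q
        (alongDeriv S.nabla f (pushExtend k f w) q
          (FiberBundle.extend (EuclideanSpace ℝ (Fin n)) v q)))) p u) (mfderiv (𝓡 n) (𝓡 k) f p t)
      = S.metricCoord (f p) (mapCoord k n f p (extChartAt (𝓡 n) p p))
          (coordAlong (christoffel S.conn (f p)) (mapCoord k n f p)
            (fun z ↦ coordAlong (christoffel S.conn (f p)) (mapCoord k n f p)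
              (fun z ↦ fderiv ℝ (mapCoord k n f p) z (coordL p p w)) z (coordL p p v))
            (extChartAt (𝓡 n) p p) (coordL p p u))
          (fderiv ℝ (mapCoord k n f p) (extChartAt (𝓡 n) p p) (coordL p p t))
        + S.g (f p) (secondFundForm S S.nabla f p v w) (secondFundForm S S.nablaStar f p u t) := by
  have hp := mem_chartDomain_self (k := n) p
  have hfp := mem_chartDomain_self (k := k) (f p)
  set F := mapCoord k n f p with hF
  set z₀ := extChartAt (𝓡 n) p p with hz₀
  set G := S.metricCoord (f p) with hG
  set Γ := christoffel S.conn (f p) with hΓ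
  set Γs := christoffel S.dual (f p) with hΓs
  have hFz : F z₀ = extChartAt (𝓡 k) (f p) (f p) := mapCoord_chart f hp
  have hFs : ContDiffAt ℝ ∞ F z₀ := contDiffAt_mapCoord hf hp hfp
  have hGd : DifferentiableAt ℝ G (F z₀) := by
    rw [hFz]; exact (S.contDiffAt_metricCoord (f p)).differentiableAt (by simp)
  have hΓd : DifferentiableAt ℝ Γ (F z₀) := by
    rw [hFz]; exact (contDiffAt_christoffel S.conn S.conn_smooth (f p)).differentiableAt (by simp)
  have hdual : ∀ u a b : EuclideanSpace ℝ (Fin k),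
      fderiv ℝ G (F z₀) u a b = G (F z₀) (Γ (F z₀) a u) b + G (F z₀) a (Γs (F z₀) b u) := by
    rw [hFz]; exact (S.fderiv_metricCoord (f p)).self_of_nhds
  have hpos : ∀ a : EuclideanSpace ℝ (Fin k), a ≠ 0 → 0 < G (F z₀) a a := by
    rw [hFz]; exact S.metricCoord_pos hfp
  have hinj : Function.Injective (fderiv ℝ F z₀) := by
    intro a b hab
    have h1 := coordL_mfderiv hf hp hfp (coordS p p a)
    have h2 := coordL_mfderiv hf hp hfp (coordS p p b)
    rw [coordL_coordS hp] at h1 h2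
    have h3 := hi p (coordL_injective hfp (h1.trans (hab.trans h2.symm)))
    rw [← coordL_coordS hp a, h3, coordL_coordS hp]
  let A : Π q : M, TangentSpace (𝓡 k) (f q) := fun q ↦ alongDeriv S.nabla f (pushExtend k f w) q
    (FiberBundle.extend (EuclideanSpace ℝ (Fin n)) v q)
  let Ac : EuclideanSpace ℝ (Fin n) → EuclideanSpace ℝ (Fin k) := fun z ↦
    coordAlong Γ F (fun z ↦ fderiv ℝ F z (coordL p p w)) z (coordL p p v)
  have hA : ∀ q, q ∈ chartDomain n p → f q ∈ chartDomain k (f p) →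
      coordL (f p) (f q) (A q) = Ac (extChartAt (𝓡 n) p q) := by
    intro q hq hfq
    have := coordL_alongDeriv_pushExtend S.conn hf w hq hfq
      (FiberBundle.extend (EuclideanSpace ℝ (Fin n)) v q)
    rw [coordL_extend v hq] at this
    exact this
  let B : VField n M := fun q ↦ tangentPart S f q (A q)
  let Bc : EuclideanSpace ℝ (Fin n) → EuclideanSpace ℝ (Fin n) := fun z ↦
    coordL p ((extChartAt (𝓡 n) p).symm z) (B ((extChartAt (𝓡 n) p).symm z))
  have hBc : ∀ q ∈ chartDomain n p, coordL p q (B q) = Bc (extChartAt (𝓡 n) p q) := by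
    intro q hq
    simp only [Bc]
    rw [(eventually_chart_symm hq).self_of_nhds]
  have hAd : DifferentiableAt ℝ Ac z₀ := differentiableAt_coordAlong_fderiv hΓd
    (hFs.of_le (natCast_le_smooth _)) _ _
  have hgood : ∀ᶠ z in 𝓝 z₀, z ∈ (extChartAt (𝓡 n) p).target ∧
      f ((extChartAt (𝓡 n) p).symm z) ∈ chartDomain k (f p) := by
    have hcont : Filter.Tendsto (extChartAt (𝓡 n) p).symm (𝓝 z₀) (𝓝 p) := by
      have := continuousAt_extChartAt_symm (I := 𝓡 n) p
      rwa [ContinuousAt, extChartAt_to_inv] at this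
    filter_upwards [extChartAt_target_mem_nhds_of_mem hp,
      hcont.eventually (hf.continuous.continuousAt.eventually (chartDomain_mem_nhds hfp))]
      with z h1 h2
    exact ⟨h1, h2⟩
  have hBt : ∀ᶠ z in 𝓝 z₀, ∀ t, G (F z) (Ac z - fderiv ℝ F z (Bc z)) (fderiv ℝ F z t) = 0 := by
    filter_upwards [hgood] with z hz t
    have hq := chart_symm_mem hz.1
    have hr := (extChartAt (𝓡 n) p).right_inv hz.1
    have h1 := tangentPart_spec S (hi ((extChartAt (𝓡 n) p).symm z))
      (A ((extChartAt (𝓡 n) p).symm z)) (coordS p _ t)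
    rw [← metricCoord_mapCoord S hq hz.2, map_sub, hA _ hq hz.2, coordL_mfderiv hf hq hz.2,
      coordL_mfderiv hf hq hz.2, coordL_coordS hq, hr] at h1
    exact h1
  have hBd : DifferentiableAt ℝ Bc z₀ := differentiableAt_of_isTangentPart hGd
    (hFs.of_le (natCast_le_smooth _)) hpos hinj hAd hBt
  have h3 : ContDiffAt ℝ 3 F z₀ := hFs.of_le (natCast_le_smooth _)
  have hF1 : DifferentiableAt ℝ (fderiv ℝ F) z₀ := differentiableAt_fderiv_mapCoord hf hp hfp
  have hL : coordL (f p) (f p) (alongDeriv S.nabla f (fun q ↦ mfderiv (𝓡 n) (𝓡 k) f q (B q)) p u)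
      = coordAlong Γ F (fun q ↦ fderiv ℝ F q (Bc q)) z₀ (coordL p p u) := by
    refine coordL_alongDeriv S.conn hf hp hfp _ (hF1.clm_apply hBd) ?_ u
    filter_upwards [eventually_mem_chartDomains hf.continuous hp hfp] with q hq
    rw [coordL_mfderiv hf hq.1 hq.2, hBc q hq.1]
  have hσ : coordL (f p) (f p) (secondFundForm S S.nabla f p v w)
      = Ac z₀ - fderiv ℝ F z₀ (Bc z₀) := by
    have hAp : A p = alongDeriv S.nabla f (pushExtend k f w) p v := by
      simp only [A]
      rw [FiberBundle.extend_apply_self]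
    rw [secondFundForm_eq, ← hAp, map_sub, hA p hp hfp, coordL_mfderiv hf hp hfp]
    change _ - fderiv ℝ F z₀ (coordL p p (B p)) = _
    rw [hBc p hp]
  have hσs : S.g (f p) (secondFundForm S S.nabla f p v w) (secondFundForm S S.nablaStar f p u t)
      = G (F z₀) (Ac z₀ - fderiv ℝ F z₀ (Bc z₀))
          (coordAlong Γs F (fun q ↦ fderiv ℝ F q (coordL p p t)) z₀ (coordL p p u)) := by
    have h4 := coordL_alongDeriv_pushExtend S.dual hf t hp hfp u
    -- `σ(v, w)` is normal and therefore sees only the normal part `σ*(u, t)` of the dual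
    -- derivative.
    rw [← hσ, ← h4, metricCoord_mapCoord S hp hfp, secondFundForm_eq S S.nablaStar, S.g_sub_right,
      g_secondFundForm_tangent S (hi p), sub_zero]
    rfl
  have hgauss := gauss_coord hGd hdual hΓd h3 hBd (coordL p p v) (coordL p p w) hBt
    (coordL p p u) (coordL p p t)
  rw [← metricCoord_mapCoord S hp hfp, coordL_mfderiv hf hp hfp, hσs]
  rw [← hL] at hgauss
  exact hgauss

/-- The Gauss equation. -/
theorem gauss_equation [T2Space N] (hf : ContMDiff (𝓡 n) (𝓡 k) ∞ f)
    (hi : ∀ q, Function.Injective (mfderiv (𝓡 n) (𝓡 k) f q)) (u v w t : TangentSpace (𝓡 n) p) :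
    inducedMetric S f p ((inducedConn S S.nabla f).curvature p u v w) t
      = S.g (f p) (S.nabla.curvature (f p) (mfderiv (𝓡 n) (𝓡 k) f p u)
          (mfderiv (𝓡 n) (𝓡 k) f p v) (mfderiv (𝓡 n) (𝓡 k) f p w)) (mfderiv (𝓡 n) (𝓡 k) f p t)
        + S.g (f p) (secondFundForm S S.nabla f p v w) (secondFundForm S S.nablaStar f p u t)
        - S.g (f p) (secondFundForm S S.nabla f p u w) (secondFundForm S S.nablaStar f p v t) := by
  have hp := mem_chartDomain_self (k := n) p
  have hfp := mem_chartDomain_self (k := k) (f p)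
  have hFz : mapCoord k n f p (extChartAt (𝓡 n) p p) = extChartAt (𝓡 k) (f p) (f p) :=
    mapCoord_chart f hp
  have hΓd : DifferentiableAt ℝ (christoffel S.conn (f p)) (extChartAt (𝓡 k) (f p) (f p)) :=
    (contDiffAt_christoffel S.conn S.conn_smooth (f p)).differentiableAt (by simp)
  have h1 : inducedMetric S f p ((inducedConn S S.nabla f).curvature p u v w) t = _ :=
    inducedMetric_curvature S hi S.conn u v w t
  have h2 : S.g (f p) (S.nabla.curvature (f p) (mfderiv (𝓡 n) (𝓡 k) f p u)
      (mfderiv (𝓡 n) (𝓡 k) f p v) (mfderiv (𝓡 n) (𝓡 k) f p w)) (mfderiv (𝓡 n) (𝓡 k) f p t) = _ :=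
    (metricCoord_mapCoord S hp hfp _ _).symm
  have h3 := coordL_curvature S.conn hΓd (mfderiv (𝓡 n) (𝓡 k) f p u)
      (mfderiv (𝓡 n) (𝓡 k) f p v) (mfderiv (𝓡 n) (𝓡 k) f p w)
  -- The ambient curvature on vectors `dF` is the commutator of derivatives along `F`, that is, the
  -- antisymmetrization of the coordinate term in `g_alongDeriv_tangentPart`.
  rw [← hFz, coordL_mfderiv hf hp hfp, coordL_mfderiv hf hp hfp, coordL_mfderiv hf hp hfp,
    ← coordAlong_coordAlong_sub (by rwa [hFz])
      ((contDiffAt_mapCoord hf hp hfp).of_le (natCast_le_smooth _))] at h3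
  have h4 : coordL (f p) (f p) (S.nabla.curvature (f p) (mfderiv (𝓡 n) (𝓡 k) f p u)
      (mfderiv (𝓡 n) (𝓡 k) f p v) (mfderiv (𝓡 n) (𝓡 k) f p w)) = _ := h3
  rw [h1, h2, h4, coordL_mfderiv hf hp hfp, map_sub, sub_apply]
  have h5 := g_alongDeriv_tangentPart S hf hi u v w t
  have h6 := g_alongDeriv_tangentPart S hf hi v u w t
  refine (congrArg₂ (· - ·) h5 h6).trans ?_
  ring

end Gauss

/-! ### Sectional curvatures of submanifolds of statistical manifolds -/

section Sectional

set_option maxSynthPendingDepth 3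
set_option linter.unusedSectionVars false

variable {k n : ℕ} {N : Type*} [TopologicalSpace N] [ChartedSpace (EuclideanSpace ℝ (Fin k)) N]
  [IsManifold (𝓡 k) ∞ N]
  {M : Type*} [TopologicalSpace M] [ChartedSpace (EuclideanSpace ℝ (Fin n)) M]
  [IsManifold (𝓡 n) ∞ M]

namespace StatisticalStructure

variable (S : StatisticalStructure k N)

theorem g_add_right (x : N) (u v w : TangentSpace (𝓡 k) x) :
    S.g x u (v + w) = S.g x u v + S.g x u w := by simp [g]

theorem g_smul_right (x : N) (r : ℝ) (u v : TangentSpace (𝓡 k) x) :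
    S.g x u (r • v) = r * S.g x u v := by simp [g]

/-- The statistical structure with the two connections interchanged. -/
def swap : StatisticalStructure k N where
  metric := S.metric
  conn := S.dual
  dual := S.conn
  conn_smooth := S.dual_smooth
  dual_smooth := S.conn_smooth
  conn_torsion := S.dual_torsion
  dual_torsion := S.conn_torsion
  duality x Y Z hY hZ v := by
    have h := S.duality x Z Y hZ hY v
    have h3 : (fun y ↦ S.metric.inner y (Z y) (Y y)) = fun y ↦ S.metric.inner y (Y y) (Z y) :=
      funext fun y ↦ S.metric.symm y _ _
    rw [h3, S.metric.symm x _ (Y x), S.metric.symm x (Z x)] at h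
    rw [h, add_comm]

/-- The Levi-Civita connection as a covariant derivative. -/
def leviCivitaConn : AffineConnection k N :=
  CovariantDerivative.affineCombination S.conn S.dual fun _ ↦ 1 / 2

theorem leviCivitaConn_apply (Y : VField k N) (x : N) (v : TangentSpace (𝓡 k) x) :
    S.leviCivitaConn Y x v = S.leviCivita Y x v := by
  have h : S.leviCivitaConn Y x v
      = (1 / 2 : ℝ) • S.conn Y x v + (1 - 1 / 2 : ℝ) • S.dual Y x v := rfl
  rw [h, leviCivita, ConnOp.mean, nabla, nablaStar, smul_add]
  norm_num

theorem leviCivitaConn_torsion : S.leviCivitaConn.torsion = 0 := by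
  refine S.leviCivitaConn.torsion_eq_zero_iff.2 fun {X Y x} hX hY ↦ ?_
  rw [leviCivitaConn_apply, leviCivitaConn_apply]
  exact S.leviCivita_torsion_free x X Y hX hY

/-- The metric with its Levi-Civita connection. -/
def leviCivitaStructure : StatisticalStructure k N where
  metric := S.metric
  conn := S.leviCivitaConn
  dual := S.leviCivitaConn
  conn_smooth := .affineCombination _ _ contMDiff_const S.conn_smooth S.dual_smooth
  dual_smooth := .affineCombination _ _ contMDiff_const S.conn_smooth S.dual_smooth
  conn_torsion := S.leviCivitaConn_torsion
  dual_torsion := S.leviCivitaConn_torsion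
  duality x Y Z hY hZ v := by
    rw [leviCivitaConn_apply, leviCivitaConn_apply]
    exact S.leviCivita_metric x Y Z hY hZ v

theorem leviCivitaStructure_nabla : S.leviCivitaStructure.nabla = S.leviCivita := by
  funext Y x v
  exact S.leviCivitaConn_apply Y x v

theorem leviCivitaStructure_nablaStar : S.leviCivitaStructure.nablaStar = S.leviCivita :=
  S.leviCivitaStructure_nabla

/-- The curvature tensors of dual connections are dual. -/
theorem curvature_duality [T2Space N] (x : N) (u v a b : TangentSpace (𝓡 k) x) :
    S.g x (S.nabla.curvature x u v a) b = -S.g x a (S.nablaStar.curvature x u v b) := by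
  have hx := mem_chartDomain_self (k := k) x
  have h1 := (contDiffAt_christoffel S.conn S.conn_smooth x).differentiableAt (by simp)
  have h2 := (contDiffAt_christoffel S.dual S.dual_smooth x).differentiableAt (by simp)
  have h := coordCurvature_duality ((S.contDiffAt_metricCoord x).of_le (natCast_le_smooth 2)) h1 h2
    (S.fderiv_metricCoord x) (coordL x x u) (coordL x x v) (coordL x x a) (coordL x x b)
  rw [← coordL_curvature S.conn h1, ← coordL_curvature S.dual h2, S.metricCoord_apply hx,
    S.metricCoord_apply hx] at h
  exact h

/-- The curvature hypothesis concerns `∇` only; duality carries it over to the `∇*` term of `K`. -/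
theorem nablaStar_sec [T2Space N] (x : N) (u v : TangentSpace (𝓡 k) x) :
    S.nablaStar.sec S.g x u v = -S.g x (S.nabla.curvature x u v u) v := by
  rw [ConnOp.sec, S.curvature_duality, neg_neg, S.g_comm]

end StatisticalStructure

variable (S : StatisticalStructure k N) {f : M → N} {p : M}

theorem alongDeriv_mean (D D' : ConnOp k N) (V : Π q : M, TangentSpace (𝓡 k) (f q))
    (v : TangentSpace (𝓡 n) p) :
    alongDeriv (D.mean D') f V p v = (1 / 2 : ℝ) • (alongDeriv D f V p v + alongDeriv D' f V p v) := by
  simp only [alongDeriv, ConnOp.mean]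
  module

theorem inducedConn_mean (hi : ∀ q, Function.Injective (mfderiv (𝓡 n) (𝓡 k) f q))
    (D D' : ConnOp k N) :
    (inducedConn S D f : ConnOp n M).mean (inducedConn S D' f) = inducedConn S (D.mean D') f := by
  funext Y q v
  change _ = tangentPart S f q (alongDeriv (D.mean D') f _ q v)
  rw [alongDeriv_mean, tangentPart_smul S (hi q), tangentPart_add S (hi q)]
  rfl

theorem secondFundForm_mean (hi : Function.Injective (mfderiv (𝓡 n) (𝓡 k) f p))
    (D D' : ConnOp k N) (v w : TangentSpace (𝓡 n) p) :
    secondFundForm S (D.mean D') f p v w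
      = (1 / 2 : ℝ) • (secondFundForm S D f p v w + secondFundForm S D' f p v w) := by
  rw [secondFundForm_eq, secondFundForm_eq, secondFundForm_eq, alongDeriv_mean,
    tangentPart_smul S hi, tangentPart_add S hi, map_smul, map_add]
  module

theorem inducedConn_sec [T2Space N] (hf : ContMDiff (𝓡 n) (𝓡 k) ∞ f)
    (hi : ∀ q, Function.Injective (mfderiv (𝓡 n) (𝓡 k) f q)) (u v : TangentSpace (𝓡 n) p) :
    (inducedConn S S.nabla f).sec (inducedMetric S f) p u v
      = S.nabla.sec S.g (f p) (mfderiv (𝓡 n) (𝓡 k) f p u) (mfderiv (𝓡 n) (𝓡 k) f p v)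
        + S.g (f p) (secondFundForm S S.nabla f p v v) (secondFundForm S S.nablaStar f p u u)
        - S.g (f p) (secondFundForm S S.nabla f p u v) (secondFundForm S S.nablaStar f p u v) := by
  have h : secondFundForm S S.nablaStar f p v u = secondFundForm S S.nablaStar f p u v :=
    secondFundForm_symm S S.dual S.dual_torsion hf v u
  rw [ConnOp.sec, gauss_equation S hf hi, h]
  rfl

/-- The difference `K - K₀` of the sectional curvatures. -/
theorem secK_sub_sec [T2Space N] (hf : ContMDiff (𝓡 n) (𝓡 k) ∞ f)
    (hi : ∀ q, Function.Injective (mfderiv (𝓡 n) (𝓡 k) f q)) (u v : TangentSpace (𝓡 n) p) :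
    let D : ConnOp n M := inducedConn S S.nabla f
    let D' : ConnOp n M := inducedConn S S.nablaStar f
    let σ := secondFundForm S S.nabla f p
    let σ' := secondFundForm S S.nablaStar f p
    let X := mfderiv (𝓡 n) (𝓡 k) f p u
    let Y := mfderiv (𝓡 n) (𝓡 k) f p v
    secK D D' (inducedMetric S f) p u v - (D.mean D').sec (inducedMetric S f) p u v
      = 1 / 2 * (S.g (f p) (S.nabla.curvature (f p) X Y Y) X
          - S.g (f p) (S.nabla.curvature (f p) X Y X) Y) - 2 * S.leviCivita.sec S.g (f p) X Y
        - 1 / 2 * ((S.g (f p) (σ u u) (σ v v) - S.g (f p) (σ u v) (σ u v))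
          + (S.g (f p) (σ' u u) (σ' v v) - S.g (f p) (σ' u v) (σ' u v))) := by
  intro D D' σ σ' X Y
  -- One Gauss equation serves three times: for `S`, for `S.swap`, and for the metric with its
  -- self-dual Levi-Civita connection.
  have h1 : D.sec (inducedMetric S f) p u v = S.g (f p) (S.nabla.curvature (f p) X Y Y) X
      + S.g (f p) (σ v v) (σ' u u) - S.g (f p) (σ u v) (σ' u v) := inducedConn_sec S hf hi u v
  have h2 : D'.sec (inducedMetric S f) p u v = S.nablaStar.sec S.g (f p) X Y
      + S.g (f p) (σ' v v) (σ u u) - S.g (f p) (σ' u v) (σ u v) :=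
    inducedConn_sec S.swap hf hi u v
  have h3 : (inducedConn S S.leviCivita f).sec (inducedMetric S f) p u v
      = S.leviCivita.sec S.g (f p) X Y
        + S.g (f p) (secondFundForm S S.leviCivita f p v v) (secondFundForm S S.leviCivita f p u u)
        - S.g (f p) (secondFundForm S S.leviCivita f p u v)
          (secondFundForm S S.leviCivita f p u v) := by
    have h := inducedConn_sec S.leviCivitaStructure hf hi u v
    rw [S.leviCivitaStructure_nabla, S.leviCivitaStructure_nablaStar] at h
    exact h
  have h4 : ∀ a b, secondFundForm S S.leviCivita f p a b = (1 / 2 : ℝ) • (σ a b + σ' a b) :=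
    fun a b ↦ secondFundForm_mean S (hi p) _ _ a b
  -- The Levi-Civita term enters with total coefficient `-2`. With `½(σ + σ')` in its Gauss
  -- equation, its mixed products are exactly those of the average of `h1` and `h2`, and they
  -- cancel.
  have h5 : D.mean D' = inducedConn S S.leviCivita f := inducedConn_mean S hi _ _
  rw [secK, h5, h1, h2, h3, h4, h4, h4, S.nablaStar_sec]
  simp only [S.g_smul_left, S.g_smul_right, S.g_add_left, S.g_add_right]
  have e1 := S.g_comm (f p) (σ v v) (σ u u)
  have e2 := S.g_comm (f p) (σ' v v) (σ' u u)
  have e3 := S.g_comm (f p) (σ' u v) (σ u v)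
  have e4 := S.g_comm (f p) (σ' v v) (σ u u)
  have e5 := S.g_comm (f p) (σ v v) (σ' u u)
  rw [e1, e2, e3, e4, e5]
  ring

end Sectional

/-! ### Sections of the endomorphism bundle along a submanifold -/

section Endomorphisms

set_option maxSynthPendingDepth 3
set_option linter.unusedSectionVars false

variable {k n : ℕ} {N : Type*} [TopologicalSpace N] [ChartedSpace (EuclideanSpace ℝ (Fin k)) N]
  [IsManifold (𝓡 k) ∞ N]
  {M : Type*} [TopologicalSpace M] [ChartedSpace (EuclideanSpace ℝ (Fin n)) M]
  [IsManifold (𝓡 n) ∞ M]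

/-- The matrix of a field of endomorphisms in the preferred chart at `x₀`. -/
def endCoord (A : Π x : N, TangentSpace (𝓡 k) x →L[ℝ] TangentSpace (𝓡 k) x) (x₀ : N)
    (z : EuclideanSpace ℝ (Fin k)) : EuclideanSpace ℝ (Fin k) →L[ℝ] EuclideanSpace ℝ (Fin k) :=
  (coordL x₀ ((extChartAt (𝓡 k) x₀).symm z)).comp
    ((A ((extChartAt (𝓡 k) x₀).symm z)).comp (coordS x₀ ((extChartAt (𝓡 k) x₀).symm z)))

theorem endCoord_apply (A : Π x : N, TangentSpace (𝓡 k) x →L[ℝ] TangentSpace (𝓡 k) x) {x₀ x : N}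
    (hx : x ∈ chartDomain k x₀) (v : TangentSpace (𝓡 k) x) :
    endCoord A x₀ (extChartAt (𝓡 k) x₀ x) (coordL x₀ x v) = coordL x₀ x (A x v) := by
  have h := (eventually_chart_symm (k := k) hx).self_of_nhds
  simp only [endCoord, ContinuousLinearMap.comp_apply]
  generalize (extChartAt (𝓡 k) x₀).symm (extChartAt (𝓡 k) x₀ x) = y at h
  subst h
  rw [coordS_coordL hx]

theorem contDiffAt_endCoord {A : Π x : N, TangentSpace (𝓡 k) x →L[ℝ] TangentSpace (𝓡 k) x} {x₀ : N}
    (hA : ContMDiffAt (𝓡 k)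
      ((𝓡 k).prod 𝓘(ℝ, EuclideanSpace ℝ (Fin k) →L[ℝ] EuclideanSpace ℝ (Fin k))) ∞
      (fun x ↦ TotalSpace.mk' (EuclideanSpace ℝ (Fin k) →L[ℝ] EuclideanSpace ℝ (Fin k))
        (E := fun x : N ↦ TangentSpace (𝓡 k) x →L[ℝ] TangentSpace (𝓡 k) x) x (A x)) x₀) :
    ContDiffAt ℝ ∞ (endCoord A x₀) (extChartAt (𝓡 k) x₀ x₀) := by
  have hx := mem_chartDomain_self (k := k) x₀
  have hc := ((contMDiffAt_hom_bundle _).1 hA).2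
  exact contDiffAt_chart hx hc fun z _ ↦ rfl

/-- The product rule for `A` applied to a constant field: it trades the derivative of the matrix of
`A` for `∇A` and Christoffel symbols. -/
theorem fderiv_endCoord (D : AffineConnection k N)
    {A : Π x : N, TangentSpace (𝓡 k) x →L[ℝ] TangentSpace (𝓡 k) x} {x₀ : N}
    (hA : DifferentiableAt ℝ (endCoord A x₀) (extChartAt (𝓡 k) x₀ x₀))
    (a : EuclideanSpace ℝ (Fin k)) (v : TangentSpace (𝓡 k) x₀) :
    fderiv ℝ (endCoord A x₀) (extChartAt (𝓡 k) x₀ x₀) (coordL x₀ x₀ v) a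
        + christoffel D x₀ (extChartAt (𝓡 k) x₀ x₀)
          (endCoord A x₀ (extChartAt (𝓡 k) x₀ x₀) a) (coordL x₀ x₀ v)
      = endCoord A x₀ (extChartAt (𝓡 k) x₀ x₀)
          (christoffel D x₀ (extChartAt (𝓡 k) x₀ x₀) a (coordL x₀ x₀ v))
        + coordL x₀ x₀ (D (fun y ↦ A y (constField x₀ a y)) x₀ v - A x₀ (D (constField x₀ a) x₀ v)) := by
  have hx := mem_chartDomain_self (k := k) x₀
  have h1 := coordL_conn D hx (fun y ↦ A y (constField x₀ a y))
    (C := fun z ↦ endCoord A x₀ z a) (by fun_prop) (by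
      filter_upwards [chartDomain_mem_nhds hx] with y hy
      have := endCoord_apply A hy (constField x₀ a y)
      rw [← this, constField, coordL_coordS hy]) v
  rw [((hA.hasLineDerivAt_fderiv _).clm_apply_const _).fderiv_apply (by fun_prop)] at h1
  rw [map_sub, h1, ← endCoord_apply A hx, ← christoffel_apply D hx a]
  abel

variable {f : M → N} {p : M}

/-- The product rule for the derivative along `f` of `A (df W)`. -/
theorem alongDeriv_end_pushExtend (D : AffineConnection k N) (hf : ContMDiff (𝓡 n) (𝓡 k) ∞ f)
    {A : Π x : N, TangentSpace (𝓡 k) x →L[ℝ] TangentSpace (𝓡 k) x}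
    (hA : DifferentiableAt ℝ (endCoord A (f p)) (extChartAt (𝓡 k) (f p) (f p)))
    (v w : TangentSpace (𝓡 n) p) :
    let X := mfderiv (𝓡 n) (𝓡 k) f p v
    let Y := constField (f p) (coordL (f p) (f p) (mfderiv (𝓡 n) (𝓡 k) f p w))
    coordAlong (christoffel D (f p)) (mapCoord k n f p)
        (fun z ↦ endCoord A (f p) (mapCoord k n f p z)
          (fderiv ℝ (mapCoord k n f p) z (coordL p p w)))
        (extChartAt (𝓡 n) p p) (coordL p p v)
      = coordL (f p) (f p) (A (f p) (alongDeriv (fun Z x w ↦ D Z x w) f (pushExtend k f w) p v)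
        + (D (fun y ↦ A y (Y y)) (f p) X - A (f p) (D Y (f p) X))) := by
  intro X Y
  have hp := mem_chartDomain_self (k := n) p
  have hfp := mem_chartDomain_self (k := k) (f p)
  have hFz : mapCoord k n f p (extChartAt (𝓡 n) p p) = extChartAt (𝓡 k) (f p) (f p) :=
    mapCoord_chart f hp
  have hF := (contDiffAt_mapCoord hf hp hfp).differentiableAt (by simp)
  have hF1 := differentiableAt_fderiv_mapCoord hf hp hfp
  have hA' : DifferentiableAt ℝ (endCoord A (f p)) (mapCoord k n f p (extChartAt (𝓡 n) p p)) := by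
    rwa [hFz]
  have hA'' := hA'.comp _ hF
  have hd : DifferentiableAt ℝ (fun z ↦ endCoord A (f p) (mapCoord k n f p z)
      (fderiv ℝ (mapCoord k n f p) z (coordL p p w))) (extChartAt (𝓡 n) p p) :=
    hA''.clm_apply (hF1.clm_apply (differentiableAt_const _))
  have h1 := ((hA'.hasLineDerivAt_comp hF (coordL p p v)).clm_apply
    ((hF1.hasLineDerivAt_fderiv (coordL p p v)).clm_apply_const (coordL p p w))).fderiv_apply hd
  have h2 := fderiv_endCoord D hA (coordL (f p) (f p) (mfderiv (𝓡 n) (𝓡 k) f p w)) X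
  have h3 := coordL_alongDeriv_pushExtend D hf w hp hfp v
  have h4 : fderiv ℝ (mapCoord k n f p) (extChartAt (𝓡 n) p p) (coordL p p v)
      = coordL (f p) (f p) X := (coordL_mfderiv hf hp hfp v).symm
  have h5 : fderiv ℝ (mapCoord k n f p) (extChartAt (𝓡 n) p p) (coordL p p w)
      = coordL (f p) (f p) (mfderiv (𝓡 n) (𝓡 k) f p w) := (coordL_mfderiv hf hp hfp w).symm
  rw [coordAlong, ((hF1.hasLineDerivAt_fderiv _).clm_apply_const _).fderiv_apply (by fun_prop), h4,
    h5, hFz] at h3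
  rw [coordAlong, h1, h4, h5, hFz, map_add, ← endCoord_apply A hfp, h3, map_add]
  rw [add_right_comm, h2]
  abel

variable (S : StatisticalStructure k N)

/-- If `A` and its covariant derivative map `TM` to the normal bundle, then
`g(A σ(v, w), df u) = -g(A (df w), σ*(v, u))`. -/
theorem g_end_secondFundForm [T2Space N] (hf : ContMDiff (𝓡 n) (𝓡 k) ∞ f)
    {A : Π x : N, TangentSpace (𝓡 k) x →L[ℝ] TangentSpace (𝓡 k) x}
    (hA : DifferentiableAt ℝ (endCoord A (f p)) (extChartAt (𝓡 k) (f p) (f p)))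
    (hreal : ∀ᶠ q in 𝓝 p, ∀ u v : TangentSpace (𝓡 n) q,
      S.g (f q) (A (f q) (mfderiv (𝓡 n) (𝓡 k) f q u)) (mfderiv (𝓡 n) (𝓡 k) f q v) = 0)
    (u v w : TangentSpace (𝓡 n) p)
    (hQ : ∀ Y : VField k N, Y.DiffAt (f p) → Y (f p) = mfderiv (𝓡 n) (𝓡 k) f p w →
      S.g (f p) (S.conn (fun y ↦ A y (Y y)) (f p) (mfderiv (𝓡 n) (𝓡 k) f p v)
        - A (f p) (S.conn Y (f p) (mfderiv (𝓡 n) (𝓡 k) f p v))) (mfderiv (𝓡 n) (𝓡 k) f p u) = 0) :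
    S.g (f p) (A (f p) (secondFundForm S S.nabla f p v w)) (mfderiv (𝓡 n) (𝓡 k) f p u)
      = -S.g (f p) (A (f p) (mfderiv (𝓡 n) (𝓡 k) f p w)) (secondFundForm S S.nablaStar f p v u) := by
  have hp := mem_chartDomain_self (k := n) p
  have hfp := mem_chartDomain_self (k := k) (f p)
  have hFz : mapCoord k n f p (extChartAt (𝓡 n) p p) = extChartAt (𝓡 k) (f p) (f p) :=
    mapCoord_chart f hp
  have hF := (contDiffAt_mapCoord hf hp hfp).differentiableAt (by simp)
  have hF1 := differentiableAt_fderiv_mapCoord hf hp hfp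
  have hA' : DifferentiableAt ℝ (endCoord A (f p)) (mapCoord k n f p (extChartAt (𝓡 n) p p)) := by
    rwa [hFz]
  have hGd : DifferentiableAt ℝ (S.metricCoord (f p)) (mapCoord k n f p (extChartAt (𝓡 n) p p)) := by
    rw [hFz]; exact (S.contDiffAt_metricCoord (f p)).differentiableAt (by simp)
  have hdual := (S.fderiv_metricCoord (f p)).self_of_nhds
  rw [← hFz] at hdual
  have hd1 : DifferentiableAt ℝ (fun z ↦ endCoord A (f p) (mapCoord k n f p z)
      (fderiv ℝ (mapCoord k n f p) z (coordL p p w))) (extChartAt (𝓡 n) p p) :=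
    (hA'.comp _ hF).clm_apply (hF1.clm_apply (differentiableAt_const _))
  have hd2 : DifferentiableAt ℝ (fun z ↦ fderiv ℝ (mapCoord k n f p) z (coordL p p u))
      (extChartAt (𝓡 n) p p) := by fun_prop
  have hcont : Filter.Tendsto (extChartAt (𝓡 n) p).symm (𝓝 (extChartAt (𝓡 n) p p)) (𝓝 p) := by
    have := continuousAt_extChartAt_symm (I := 𝓡 n) p
    rwa [ContinuousAt, extChartAt_to_inv] at this
  have h0 : ∀ᶠ z in 𝓝 (extChartAt (𝓡 n) p p), S.metricCoord (f p) (mapCoord k n f p z)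
      (endCoord A (f p) (mapCoord k n f p z) (fderiv ℝ (mapCoord k n f p) z (coordL p p w)))
      (fderiv ℝ (mapCoord k n f p) z (coordL p p u)) = 0 := by
    filter_upwards [extChartAt_target_mem_nhds_of_mem hp, hcont.eventually hreal,
      hcont.eventually (eventually_mem_chartDomains hf.continuous hp hfp)] with z h1 h2 h3
    have hz := (extChartAt (𝓡 n) p).right_inv h1
    have h4 := h2 (coordS p _ (coordL p p w)) (coordS p _ (coordL p p u))
    rw [← S.metricCoord_apply h3.2, ← endCoord_apply A h3.2, coordL_mfderiv hf h3.1 h3.2,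
      coordL_mfderiv hf h3.1 h3.2, coordL_coordS h3.1, coordL_coordS h3.1, hz] at h4
    exact h4
  -- Differentiate `g(A (df W), df U) = 0` in the direction `v`. The `∇A` term drops out by `hQ`.
  have key := coordAlong_duality hGd hF hdual hd1 hd2 h0 (coordL p p v)
  rw [alongDeriv_end_pushExtend S.conn hf hA, ← coordL_alongDeriv_pushExtend S.dual hf u hp hfp v,
    ← coordL_mfderiv hf hp hfp, ← coordL_mfderiv hf hp hfp, hFz, endCoord_apply A hfp,
    S.metricCoord_apply hfp, S.metricCoord_apply hfp, S.g_add_left,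
    hQ _ (diffAt_constField hfp _) (coordS_coordL hfp _), add_zero] at key
  have hr := hreal.self_of_nhds
  -- `A` maps `TM` to normal vectors, so the tangent parts of the two derivatives do not contribute.
  rw [secondFundForm_eq, secondFundForm_eq, map_sub, S.g_sub_left, S.g_sub_right, hr, hr, sub_zero,
    sub_zero]
  exact key

end Endomorphisms

/-! ### Lagrangian submanifolds -/

section LagrangianAlgebra

variable {T V : Type*} [AddCommGroup T] [Module ℝ T] [AddCommGroup V] [Module ℝ V]
  [TopologicalSpace V] {n : ℕ}

theorem sum_lt_const (n : ℕ) (a : ℝ) :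
    (∑ i : Fin n, ∑ j : Fin n, if i < j then a else 0) = n * (n - 1) / 2 * a := by
  induction n with
  | zero => simp
  | succ n ih =>
    rw [Fin.sum_univ_succ]
    simp only [Fin.sum_univ_succ (fun j : Fin (n + 1) ↦ _), Fin.succ_lt_succ_iff]
    simp only [Fin.not_lt_zero, Fin.succ_pos, if_true, if_false, zero_add, ih]
    simp
    ring

/-- Second fundamental forms of a Lagrangian submanifold whose
components have the shape given by the equality case of Chen's inequality are trace-free. -/
theorem trace_eq_zero_of_lagrangian [FiniteDimensional ℝ T] [FiniteDimensional ℝ V]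
    (hdim : Module.finrank ℝ V = 4 * Module.finrank ℝ T) {J : Fin 3 → V →L[ℝ] V}
    (hJ : IsQuaternionTriple J) (b : V →ₗ[ℝ] V →ₗ[ℝ] ℝ) (hb : ∀ u v, b u v = b v u)
    (hpos : ∀ v, v ≠ 0 → 0 < b v v)
    (A : T →ₗ[ℝ] V) (hA : Function.Injective A) (hreal : ∀ α u v, b (J α (A u)) (A v) = 0)
    (e : Module.Basis (Fin n) ℝ T) (s t : T → T → V) (hs : ∀ u v, s u v = s v u)
    (ht : ∀ u v, t u v = t v u) (hsA : ∀ u v w, b (s u v) (A w) = 0)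
    (htA : ∀ u v w, b (t u v) (A w) = 0)
    (hst : ∀ α u v w, b (J α (s v w)) (A u) = -b (J α (A w)) (t v u))
    (hn : 4 ≤ n) {k l : Fin n}
    (hs1 : ∀ i, i ≠ k → i ≠ l → ((n : ℝ) - 1) • s (e i) (e i) = ∑ j, s (e j) (e j))
    (hs2 : ∀ i j, i ≠ j → i ≠ k → i ≠ l → s (e i) (e j) = 0)
    (ht1 : ∀ i, i ≠ k → i ≠ l → ((n : ℝ) - 1) • t (e i) (e i) = ∑ j, t (e j) (e j))
    (ht2 : ∀ i j, i ≠ j → i ≠ k → i ≠ l → t (e i) (e j) = 0) :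
    ∑ j, s (e j) (e j) = 0 ∧ ∑ j, t (e j) (e j) = 0 := by
  constructor
  · refine eq_zero_of_quaternion_orthogonal hdim hJ b hpos A hA hreal
      (fun v ↦ by simp [map_sum, LinearMap.sum_apply, hsA]) fun α v ↦ ?_
    -- Symmetry of `s` exchanges the first two indices. By `hst` the first and third sit together in
    -- `t`, whose symmetry exchanges them.
    have h1 : ∀ r, ∑ j, b (J α (s (e j) (e j))) (A (e r)) = 0 :=
      trace_eq_zero_of_symm (fun i j r ↦ b (J α (s (e i) (e j))) (A (e r)))
        (fun i j r ↦ by rw [hs]) (fun i j r ↦ by rw [hst, hst, ht]) hn (k := k) (l := l)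
        (fun r i hk hl ↦ by
          have := congrArg (fun q ↦ b (J α q) (A (e r))) (hs1 i hk hl)
          simpa [map_sum, LinearMap.sum_apply] using this)
        (fun r i j hij hk hl ↦ by simp [hs2 i j hij hk hl])
    have h2 : b (J α (∑ j, s (e j) (e j))) ∘ₗ A = 0 := by
      refine e.ext fun r ↦ ?_
      simpa [map_sum, LinearMap.sum_apply] using h1 r
    exact LinearMap.congr_fun h2 v
  · refine eq_zero_of_orthogonal_quaternion hdim hJ b hpos A hA hreal
      (fun v ↦ by simp [map_sum, LinearMap.sum_apply, htA]) fun α v ↦ ?_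
    -- Here the roles are reversed: `hst` turns the first and third indices into the two arguments
    -- of `s`.
    have h1 : ∀ r, ∑ j, b (t (e j) (e j)) (J α (A (e r))) = 0 :=
      trace_eq_zero_of_symm (fun i j r ↦ b (t (e i) (e j)) (J α (A (e r))))
        (fun i j r ↦ by rw [ht])
        (fun i j r ↦ by
          have h3 := hst α (e j) (e i) (e r)
          have h4 := hst α (e j) (e r) (e i)
          rw [hs] at h3
          rw [hb, hb (t _ _)]
          linarith) hn (k := k) (l := l)
        (fun r i hk hl ↦ by
          have := congrArg (fun q ↦ b q (J α (A (e r)))) (ht1 i hk hl)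
          simpa [map_sum, LinearMap.sum_apply] using this)
        (fun r i j hij hk hl ↦ by simp [ht2 i j hij hk hl])
    have h2 : b (∑ j, t (e j) (e j)) ∘ₗ (J α).toLinearMap ∘ₗ A = 0 := by
      refine e.ext fun r ↦ ?_
      simpa [map_sum, LinearMap.sum_apply] using h1 r
    exact LinearMap.congr_fun h2 v

end LagrangianAlgebra

/-! ### Symmetry, curvature and Chen's equality on Lagrangian submanifolds. -/

section Lagrangian

set_option maxSynthPendingDepth 3
set_option linter.unusedSectionVars false

variable {m n : ℕ} {N : Type*} [TopologicalSpace N]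
  [ChartedSpace (EuclideanSpace ℝ (Fin (4 * m))) N] [IsManifold (𝓡 (4 * m)) ∞ N]
  {M : Type*} [TopologicalSpace M] [ChartedSpace (EuclideanSpace ℝ (Fin n)) M]
  [IsManifold (𝓡 n) ∞ M] {S : StatisticalStructure (4 * m) N}
  {Λ : AlmostQuaternionicStructure (4 * m) N} {f : M → N} {p : M} {U : Set N}
  {J : Fin 3 → Π x : N, TangentSpace (𝓡 (4 * m)) x →L[ℝ] TangentSpace (𝓡 (4 * m)) x}

theorem IsCanonicalBasisOn.mem (hJ : IsCanonicalBasisOn Λ.bundle U J) {x : N} (hx : x ∈ U)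
    (α : Fin 3) : J α x ∈ Λ.bundle x := by
  rw [← hJ.span x hx]
  exact Submodule.subset_span ⟨α, rfl⟩

theorem IsLagrangian.g_eq_zero (hL : IsLagrangian n S Λ f) (hJ : IsCanonicalBasisOn Λ.bundle U J)
    (hp : f p ∈ U) (α : Fin 3) (u v : TangentSpace (𝓡 n) p) :
    S.g (f p) (J α (f p) (mfderiv (𝓡 n) (𝓡 (4 * m)) f p u)) (mfderiv (𝓡 n) (𝓡 (4 * m)) f p v)
      = 0 :=
  hL.2 p _ (hJ.mem hp α) u v

/-- The Kaehler-like condition writes `(∇_v J_α) df(w)` as a combination of `J_{α+1} df(w)` and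
`J_{α+2} df(w)`, which are normal. Hence `g_end_secondFundForm` applies to each `J_α`. -/
theorem IsLagrangian.g_secondFundForm [T2Space N] (hL : IsLagrangian n S Λ f)
    (hΛ : IsQuaternionicKaehlerLike S Λ) (hf : ContMDiff (𝓡 n) (𝓡 (4 * m)) ∞ f)
    (hJ : IsCanonicalBasisOn Λ.bundle U J) (hp : f p ∈ U) (α : Fin 3)
    (u v w : TangentSpace (𝓡 n) p) :
    S.g (f p) (J α (f p) (secondFundForm S S.nabla f p v w)) (mfderiv (𝓡 n) (𝓡 (4 * m)) f p u)
      = -S.g (f p) (J α (f p) (mfderiv (𝓡 n) (𝓡 (4 * m)) f p w))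
        (secondFundForm S S.nablaStar f p v u) := by
  obtain ⟨θ, hθ⟩ := hΛ U J hJ
  refine g_end_secondFundForm S hf ((contDiffAt_endCoord ((hJ.smooth α).contMDiffAt
    (hJ.isOpen.mem_nhds hp))).differentiableAt (by simp)) ?_ u v w fun Y hY hYw ↦ ?_
  · filter_upwards [hf.continuous.continuousAt.eventually (hJ.isOpen.mem_nhds hp)] with q hq u v
    exact hL.g_eq_zero hJ hq α u v
  · have h := hθ α (f p) hp Y hY (mfderiv (𝓡 n) (𝓡 (4 * m)) f p v)
    have h' : S.conn (fun y ↦ J α y (Y y)) (f p) (mfderiv (𝓡 n) (𝓡 (4 * m)) f p v)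
        - J α (f p) (S.conn Y (f p) (mfderiv (𝓡 n) (𝓡 (4 * m)) f p v)) = _ := h
    rw [h', hYw, S.g_sub_left, S.g_smul_left, S.g_smul_left, hL.g_eq_zero hJ hp,
      hL.g_eq_zero hJ hp, mul_zero, mul_zero, sub_zero]

/-- Every `J`-term of the curvature has a coefficient pairing a tangent vector with a `J_α`-image of
one, hence zero; a constant curvature tensor remains. -/
theorem IsLagrangian.g_curvature {c : ℝ} (hL : IsLagrangian n S Λ f)
    (hc : HasQuaternionicCurvature S Λ c) (p : M) (x y z w : TangentSpace (𝓡 n) p) :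
    S.g (f p) (S.nabla.curvature (f p) (mfderiv (𝓡 n) (𝓡 (4 * m)) f p x)
        (mfderiv (𝓡 n) (𝓡 (4 * m)) f p y) (mfderiv (𝓡 n) (𝓡 (4 * m)) f p z))
        (mfderiv (𝓡 n) (𝓡 (4 * m)) f p w)
      = c / 4 * (inducedMetric S f p y z * inducedMetric S f p x w
        - inducedMetric S f p x z * inducedMetric S f p y w) := by
  obtain ⟨U, J, hp, hJ⟩ := Λ.exists_basis (f p)
  have h1 := hL.g_eq_zero hJ hp
  have h2 : ∀ α (u v : TangentSpace (𝓡 n) p), S.g (f p) (mfderiv (𝓡 n) (𝓡 (4 * m)) f p v)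
      (J α (f p) (mfderiv (𝓡 n) (𝓡 (4 * m)) f p u)) = 0 := fun α u v ↦ by rw [S.g_comm, h1]
  rw [hc U J hJ (f p) hp]
  simp only [h1, h2, zero_smul, sub_self, Finset.sum_const_zero, add_zero, S.g_smul_left,
    S.g_sub_left, inducedMetric]

/-- `K - K₀` of a plane tangent to a Lagrangian submanifold. -/
theorem IsLagrangian.secK_sub_sec [T2Space N] {c : ℝ} (hL : IsLagrangian n S Λ f)
    (hc : HasQuaternionicCurvature S Λ c) (hf : IsSmoothImmersion (4 * m) n f)
    {u v : TangentSpace (𝓡 n) p} (hu : inducedMetric S f p u u = 1)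
    (hv : inducedMetric S f p v v = 1) (huv : inducedMetric S f p u v = 0) :
    let D : ConnOp n M := inducedConn S S.nabla f
    let D' : ConnOp n M := inducedConn S S.nablaStar f
    let σ := secondFundForm S S.nabla f p
    let σ' := secondFundForm S S.nablaStar f p
    secK D D' (inducedMetric S f) p u v - (D.mean D').sec (inducedMetric S f) p u v
      = c / 4 - 2 * S.leviCivita.sec S.g (f p) (mfderiv (𝓡 n) (𝓡 (4 * m)) f p u)
          (mfderiv (𝓡 n) (𝓡 (4 * m)) f p v)
        - 1 / 2 * ((S.g (f p) (σ u u) (σ v v) - S.g (f p) (σ u v) (σ u v))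
          + (S.g (f p) (σ' u u) (σ' v v) - S.g (f p) (σ' u v) (σ' u v))) := by
  intro D D' σ σ'
  have hvu : inducedMetric S f p v u = 0 := by rw [inducedMetric, S.g_comm]; exact huv
  have h := _root_.secK_sub_sec S hf.1 hf.2 u v
  dsimp only at h
  rw [hL.g_curvature hc, hL.g_curvature hc, hu, hv, huv, hvu] at h
  refine h.trans ?_
  ring

/-- The form in which the equality case of Chen's inequality is used. -/
theorem IsLagrangian.chen_equality [T2Space N] {c : ℝ} (hL : IsLagrangian n S Λ f)
    (hc : HasQuaternionicCurvature S Λ c) (hf : IsSmoothImmersion (4 * m) n f) (hn : 2 ≤ n)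
    {e : Fin n → TangentSpace (𝓡 n) p} (he : IsOrthonormalFrame S f p e) {k l : Fin n}
    (hkl : k ≠ l) (heq : ChenEquality S c f p e k l) :
    let b := S.g (f p)
    let s := fun i j ↦ secondFundForm S S.nabla f p (e i) (e j)
    let t := fun i j ↦ secondFundForm S S.nablaStar f p (e i) (e j)
    (∑ i, ∑ j, if i < j then b (s i i) (s j j) - b (s i j) (s i j) else 0)
        - (b (s k k) (s l l) - b (s k l) (s k l))
        + ((∑ i, ∑ j, if i < j then b (t i i) (t j j) - b (t i j) (t i j) else 0)
        - (b (t k k) (t l l) - b (t k l) (t k l)))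
      = ((n : ℝ) - 2) / (2 * (n - 1)) *
        (b (∑ i, s i i) (∑ i, s i i) + b (∑ i, t i i) (∑ i, t i i)) := by
  intro b s t
  have hn' : (2 : ℝ) ≤ n := by exact_mod_cast hn
  have hne : (n : ℝ) - 1 ≠ 0 := by linarith
  have hne' : (n : ℝ) ≠ 0 := by linarith
  let K := secK (inducedConn S S.nabla f : ConnOp n M) (inducedConn S S.nablaStar f)
    (inducedMetric S f) p
  let K₀ := ((inducedConn S S.nabla f : ConnOp n M).mean (inducedConn S S.nablaStar f)).sec
    (inducedMetric S f) p
  let L : TangentSpace (𝓡 n) p → TangentSpace (𝓡 n) p → ℝ := fun u v ↦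
    S.leviCivita.sec S.g (f p) (mfderiv (𝓡 n) (𝓡 (4 * m)) f p u) (mfderiv (𝓡 n) (𝓡 (4 * m)) f p v)
  have h1 : ∀ i j, i ≠ j → K (e i) (e j) - K₀ (e i) (e j) = c / 4 - 2 * L (e i) (e j)
      - 1 / 2 * ((b (s i i) (s j j) - b (s i j) (s i j))
        + (b (t i i) (t j j) - b (t i j) (t i j))) := fun i j hij ↦
    hL.secK_sub_sec hc hf (by rw [he, if_pos rfl]) (by rw [he, if_pos rfl])
      (by rw [he, if_neg hij])
  have h2 : scalarSum K e - scalarSum K₀ e = n * (n - 1) / 2 * (c / 4) - 2 * scalarSum L e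
      - 1 / 2 * ((∑ i, ∑ j, if i < j then b (s i i) (s j j) - b (s i j) (s i j) else 0)
        + ∑ i, ∑ j, if i < j then b (t i i) (t j j) - b (t i j) (t i j) else 0) := by
    rw [← sum_lt_const]
    simp only [scalarSum, Finset.mul_sum, ← Finset.sum_add_distrib, ← Finset.sum_sub_distrib]
    refine Finset.sum_congr rfl fun i _ ↦ Finset.sum_congr rfl fun j _ ↦ ?_
    split_ifs with hij
    · exact h1 i j hij.ne
    · simp
  have h3 : ∀ h : TangentSpace (𝓡 (4 * m)) (f p),
      (n : ℝ) ^ 2 * b ((1 / n : ℝ) • h) ((1 / n : ℝ) • h) = b h h := by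
    intro h
    simp only [b, S.g_smul_left, S.g_smul_right]
    field_simp
  have h4 : (scalarSum K e - scalarSum K₀ e) - (K (e k) (e l) - K₀ (e k) (e l))
    = c / 8 * (n - 2) * (n + 1)
      - (n : ℝ) ^ 2 * (n - 2) / (4 * (n - 1)) * (b ((1 / n : ℝ) • ∑ i, s i i)
        ((1 / n : ℝ) • ∑ i, s i i) + b ((1 / n : ℝ) • ∑ i, t i i) ((1 / n : ℝ) • ∑ i, t i i))
      + 2 * L (e k) (e l) - 2 * scalarSum L e := heq
  have h5 : (n : ℝ) ^ 2 * (n - 2) / (4 * (n - 1)) * (b ((1 / n : ℝ) • ∑ i, s i i)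
        ((1 / n : ℝ) • ∑ i, s i i) + b ((1 / n : ℝ) • ∑ i, t i i) ((1 / n : ℝ) • ∑ i, t i i))
      = 1 / 2 * (((n : ℝ) - 2) / (2 * (n - 1)) *
        (b (∑ i, s i i) (∑ i, s i i) + b (∑ i, t i i) (∑ i, t i i))) := by
    have e1 := h3 (∑ i, s i i)
    have e2 := h3 (∑ i, t i i)
    rw [← e1, ← e2]
    generalize b ((1 / n : ℝ) • ∑ i, s i i) ((1 / n : ℝ) • ∑ i, s i i) = x
    generalize b ((1 / n : ℝ) • ∑ i, t i i) ((1 / n : ℝ) • ∑ i, t i i) = y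
    field_simp
    ring
  -- The Levi-Civita terms cancel, and so do the constants: `n(n-1)/2 · c/4 - c/4 = c/8 ·
  -- (n-2)(n+1)`.
  rw [h2, h1 k l hkl, h5] at h4
  linarith

end Lagrangian

/-! ### Independence of the mean curvature vector of the orthonormal frame. -/

section Frames

set_option maxSynthPendingDepth 3
set_option linter.unusedSectionVars false

variable {k n : ℕ} {N : Type*} [TopologicalSpace N] [ChartedSpace (EuclideanSpace ℝ (Fin k)) N]
  [IsManifold (𝓡 k) ∞ N]
  {M : Type*} [TopologicalSpace M] [ChartedSpace (EuclideanSpace ℝ (Fin n)) M]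
  [IsManifold (𝓡 n) ∞ M] {S : StatisticalStructure k N} {f : M → N} {p : M}

instance (p : M) : FiniteDimensional ℝ (TangentSpace (𝓡 n) p) :=
  inferInstanceAs (FiniteDimensional ℝ (EuclideanSpace ℝ (Fin n)))

theorem finrank_tangentSpace (p : M) : Module.finrank ℝ (TangentSpace (𝓡 n) p) = n :=
  (finrank_euclideanSpace_fin : Module.finrank ℝ (EuclideanSpace ℝ (Fin n)) = n)

variable (S) in
/-- The metric as a bilinear form. -/
def StatisticalStructure.gLin (x : N) :
    TangentSpace (𝓡 k) x →ₗ[ℝ] TangentSpace (𝓡 k) x →ₗ[ℝ] ℝ :=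
  LinearMap.mk₂ ℝ (S.g x) (S.g_add_left x) (S.g_smul_left x) (S.g_add_right x)
    (fun r u v ↦ S.g_smul_right x r u v)

variable (S f p) in
/-- The induced metric as a bilinear form. -/
def inducedMetricLin : TangentSpace (𝓡 n) p →ₗ[ℝ] TangentSpace (𝓡 n) p →ₗ[ℝ] ℝ :=
  (S.gLin (f p)).compl₁₂ (mfderiv (𝓡 n) (𝓡 k) f p).toLinearMap
    (mfderiv (𝓡 n) (𝓡 k) f p).toLinearMap

theorem IsOrthonormalFrame.linearIndependent {e : Fin n → TangentSpace (𝓡 n) p}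
    (he : IsOrthonormalFrame S f p e) : LinearIndependent ℝ e := by
  rw [Fintype.linearIndependent_iff]
  intro a ha i
  have he' : ∀ i j, inducedMetricLin S f p (e i) (e j) = if i = j then 1 else 0 := he
  have := congrArg (fun q ↦ inducedMetricLin S f p q (e i)) ha
  simpa only [map_sum, map_smul, LinearMap.sum_apply, LinearMap.smul_apply, he', smul_eq_mul,
    mul_ite, mul_one, mul_zero, Finset.sum_ite_eq', Finset.mem_univ, if_true, map_zero,
    LinearMap.zero_apply] using this

/-- The mean curvature vector does not depend on the orthonormal frame. -/
theorem meanCurvature_eq (D : AffineConnection k N) (hD : D.torsion = 0)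
    (hf : IsSmoothImmersion k n f) {e e' : Fin n → TangentSpace (𝓡 n) p}
    (he : IsOrthonormalFrame S f p e) (he' : IsOrthonormalFrame S f p e') :
    meanCurvature S (fun Z x w ↦ D Z x w) f p e'
      = meanCurvature S (fun Z x w ↦ D Z x w) f p e :=
  congrArg ((1 / n : ℝ) • ·) (trace_eq_of_orthonormal (finrank_tangentSpace p) (inducedMetricLin S f p)
    (secondFundFormLin S D hD hf.1 (hf.2 p)) e e' he he')

end Frames

/-- An orthonormal basis of a plane `π` extends to an orthonormal frame, so `π` may be taken to be
spanned by the first two frame vectors. The frame in the conclusion is arbitrary, and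
`meanCurvature_eq` links it to the one adapted to `π`. -/
theorem mainTheorem3 {m n : ℕ} (hn : 4 ≤ n)
    {N : Type*} [TopologicalSpace N] [T2Space N]
    [ChartedSpace (EuclideanSpace ℝ (Fin (4 * m))) N] [IsManifold (𝓡 (4 * m)) ∞ N]
    {M : Type*} [TopologicalSpace M] [T2Space M]
    [ChartedSpace (EuclideanSpace ℝ (Fin n)) M] [IsManifold (𝓡 n) ∞ M]
    (S : StatisticalStructure (4 * m) N) (Λ : AlmostQuaternionicStructure (4 * m) N)
    (hΛ : IsQuaternionicKaehlerLike S Λ) (c : ℝ) (hc : HasQuaternionicCurvature S Λ c)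
    (f : M → N) (hf : IsSmoothImmersion (4 * m) n f) (hL : IsLagrangian n S Λ f)
    (heq : ∀ p : M, ∃ e : Fin n → TangentSpace (𝓡 n) p, IsOrthonormalFrame S f p e ∧
      ChenEquality S c f p e ⟨0, by omega⟩ ⟨1, by omega⟩) :
    ∀ p : M, ∀ e : Fin n → TangentSpace (𝓡 n) p, IsOrthonormalFrame S f p e →
      meanCurvature S S.nabla f p e = 0 ∧ meanCurvature S S.nablaStar f p e = 0 := by
  intro p e' he'
  obtain ⟨e, he, heq⟩ := heq p
  obtain ⟨U, J, hU, hJ⟩ := Λ.exists_basis (f p)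
  have h1 : meanCurvature S S.nabla f p e' = meanCurvature S S.nabla f p e :=
    meanCurvature_eq S.conn S.conn_torsion hf he he'
  have h2 : meanCurvature S S.nablaStar f p e' = meanCurvature S S.nablaStar f p e :=
    meanCurvature_eq S.dual S.dual_torsion hf he he'
  have hs := secondFundForm_symm S S.conn S.conn_torsion hf.1 (p := p)
  have ht := secondFundForm_symm S S.dual S.dual_torsion hf.1 (p := p)
  have hkl : (⟨0, by omega⟩ : Fin n) ≠ ⟨1, by omega⟩ := by simp
  obtain ⟨hs1, hs2, ht1, ht2⟩ := chen_equality (S.gLin (f p)) (S.g_comm (f p)) (S.metric.pos (f p))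
    (fun i j ↦ secondFundForm S S.nabla f p (e i) (e j))
    (fun i j ↦ secondFundForm S S.nablaStar f p (e i) (e j)) (fun i j ↦ hs _ _)
    (fun i j ↦ ht _ _) (by omega) hkl (hL.chen_equality hc hf (by omega) he hkl heq)
  have hdim : Module.finrank ℝ (TangentSpace (𝓡 (4 * m)) (f p))
      = 4 * Module.finrank ℝ (TangentSpace (𝓡 n) p) := by
    rw [finrank_tangentSpace, finrank_tangentSpace, hL.1]
  let B := basisOfLinearIndependentOfCardEqFinrank' e he.linearIndependent
    (by rw [finrank_tangentSpace, Fintype.card_fin])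
  have hB : ∀ i, B i = e i := fun i ↦ by simp [B]
  have key := trace_eq_zero_of_lagrangian hdim (hJ.triple (f p) hU) (S.gLin (f p))
    (S.g_comm (f p)) (S.metric.pos (f p)) (mfderiv (𝓡 n) (𝓡 (4 * m)) f p).toLinearMap (hf.2 p)
    (fun α u v ↦ hL.g_eq_zero hJ hU α u v) B (secondFundForm S S.nabla f p)
    (secondFundForm S S.nablaStar f p) hs ht
    (fun u v w ↦ g_secondFundForm_tangent S (hf.2 p) S.nabla u v w)
    (fun u v w ↦ g_secondFundForm_tangent S (hf.2 p) S.nablaStar u v w)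
    (fun α u v w ↦ hL.g_secondFundForm hΛ hf.1 hJ hU α u v w) hn
    (by simpa only [hB] using hs1) (by simpa only [hB] using hs2)
    (by simpa only [hB] using ht1) (by simpa only [hB] using ht2)
  simp only [hB] at key
  rw [h1, h2, meanCurvature, meanCurvature, key.1, key.2, smul_zero]
  exact ⟨rfl, rfl⟩

end
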